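/- Let $N\ge 1$ and $K\ge 2$, and let $P=(p_{ij})$ be a $K\times K$ stochastic matrix with rows $P_1,\dots,P_K$. Let $X^1,\dots,X^N$ be independent Markov chains ("channels") on $\{1,\dots,K\}$ with common transition matrix $P$ and initial PMFs $\pi^1_0,\dots,\pi^N_0$ (row vectors), let $R=(R_1,\dots,R_K)^T\in\mathbb R^K$, and let $0<\beta<1$. At each time $t=0,1,\dots$ a policy $g$ chooses a channel $U_t$ as a function of the past choices $U_0,\dots,U_{t-1}$ and observations $Y_0,\dots,Y_{t-1}$, observes $Y_t=X^{U_t}_t$, and collects the reward $R(t)=R_{Y_t}$. Problem (P1) is to maximize $E^g\big[\sum_{t=0}^{T}\beta^tR(t)\big]$ for a given horizon $T$, and problem (P2) is to maximize $E^g\big[\sum_{t=0}^{\infty}\beta^tR(t)\big]$, over all policies. The information state at time $t$ is $(\pi^1_t,\dots,\pi^N_t)$, where $\pi^n_t(i)=P(X^n_t=i\mid Y_0,\dots,Y_{t-1},U_0,\dots,U_{t-1})$. For row vectors write $x\ge_{st}y$ if $\sum_{j\ge i}x(j)\ge\sum_{j\ge i}y(j)$ for $i=2,\dots,K$. A channel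 $m$ is a myopic choice at time $t$ if $\pi^m_t\ge_{st}\pi^j_t$ for all $j$, and the myopic policy makes a myopic choice at every time. The Gittins index of a PMF $\pi$ is $$\nu(\pi)=\sup_{\tau\ge1}\frac{E\big[\sum_{t=0}^{\tau-1}\beta^t\,\tilde\pi_tR\big]}{E\big[\sum_{t=0}^{\tau-1}\beta^t\big]},$$ where $(Y_t)_{t\ge0}$ is the Markov chain with initial PMF $\pi$ and transition matrix $P$, $\tilde\pi_0=\pi$, $\tilde\pi_{t+1}=P_{Y_t}$ (the PMF of a channel that is sensed at all times), and $\tau\ge 1$ runs over the (possibly infinite) stopping times of $(\tilde\pi_t)$. A policy follows the Gittins index rule at time $t$ if it chooses, almost surely, a channel $n$ with $\nu(\pi^n_t)=\max_j\nu(\pi^j_t)$. Assume the following conditions. (A1) $P_K\ge_{st}P_{K-1}\ge_{st}\cdots\ge_{st}P_1$. (A2) Every $\pi^n_0$ is of the form $xP$ with a PMF $x$, and $\pi^1_0\le_{st}\cdots\le_{st}\pi^N_0$. (A3) with $L=K$: $P_1P\ge_{st}P_{K-1}$ and $P_KP\le_{st}P_K$. (A4) with $L=K$: let $U$ be the vector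 with $U_i=R_i$ for $i<K$ and $U_K=R_K+\beta(P_K-P_{K-1})U$, and let $$M=U+\beta p_{KK}PU,\qquad h=\frac{P_KR-\beta\sum_{i<K}p_{Ki}P_iR}{1-\beta\sum_{i<K}p_{Ki}}.$$ Then $R_i-R_{i-1}\ge\beta(P_i-P_{i-1})M\ge\beta(P_i-P_{i-1})U\ge0$ for $2\le i\le K-1$, and $R_K-R_{K-1}\ge\beta(h-P_{K-1}R)\ge0$. Then: 1. After time $0$ the Gittins index rule selects the same channel as the myopic policy, up to ties: for every policy and every $t\ge1$, almost surely, a myopic choice exists, every myopic choice $m$ has the maximal Gittins index among all channels, and every channel $n$ with the maximal Gittins index satisfies $\pi^n_tR=\pi^m_tR$. In particular a myopic policy exists and follows the Gittins index rule at all times $t\ge1$. 2. After time $0$ the Gittins index rule is optimal for (P1) and (P2), however ties are broken: a policy that follows the Gittins index rule at all times $t\ge1$ (for (P1): $1\le t\le T$) attains the maximum of the objective over all policies with the same choice at time $0$; if its choice at time $0$ is myopic, then it attains the maximum over all policies. -/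

import Mathlib

open MeasureTheory ProbabilityTheory Matrix

noncomputable section

namespace ChannelSensing

/-! ### Markov chains and stochastic order

A channel has `K = k + 2 ≥ 2` states, listed in increasing quality as `Fin (k + 2)`; state `1` of
the usual numbering is `0`, state `K` is `Fin.last (k + 1)`.  A consecutive pair of states
`(i - 1, i)`, `2 ≤ i ≤ K`, is encoded by `i : Fin (k + 1)` as `(i.castSucc, i.succ)`; for
`i = Fin.last k` it is the pair `(K - 1, K)`.  The row `P_i` of the transition matrix is `P i`. -/

/-- Stochastic dominance `x ≤_st y` between row vectors. -/
def StLE {k : ℕ} (x y : Fin (k + 2) → ℝ) : Prop :=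
  ∀ i : Fin (k + 2), 0 < i → ∑ j ∈ Finset.Ici i, x j ≤ ∑ j ∈ Finset.Ici i, y j

/-- The process `Y` is, under the probability measure `μ`, a time-homogeneous Markov chain with
initial PMF `π` and transition matrix `P`. -/
structure IsMarkovChain {k : ℕ} {Ω : Type*} [MeasurableSpace Ω] (μ : Measure Ω)
    (π : Fin (k + 2) → ℝ) (P : Matrix (Fin (k + 2)) (Fin (k + 2)) ℝ)
    (Y : ℕ → Ω → Fin (k + 2)) : Prop where
  isProbabilityMeasure : IsProbabilityMeasure μ
  measurable : ∀ t, Measurable (Y t)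
  law : ∀ (T : ℕ) (y : ℕ → Fin (k + 2)),
    μ.real {ω | ∀ t ≤ T, Y t ω = y t} = π (y 0) * ∏ t ∈ Finset.range T, P (y t) (y (t + 1))

/-! ### The assumptions -/

/-- (A1): `P_1 ≤_st P_2 ≤_st ⋯ ≤_st P_K`. -/
def A1 {k : ℕ} (P : Matrix (Fin (k + 2)) (Fin (k + 2)) ℝ) : Prop :=
  ∀ i : Fin (k + 1), StLE (P i.castSucc) (P i.succ)

/-- (A2): the initial PMFs are of the form `x P` with `x` a PMF, and they are stochastically
increasing in the number of the channel. -/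
def A2 {k N : ℕ} (P : Matrix (Fin (k + 2)) (Fin (k + 2)) ℝ)
    (π₀ : Fin N → Fin (k + 2) → ℝ) : Prop :=
  (∀ n, ∃ x ∈ stdSimplex ℝ (Fin (k + 2)), π₀ n = x ᵥ* P) ∧
    ∀ n m : Fin N, n ≤ m → StLE (π₀ n) (π₀ m)

/-- (A3): `P_1 P ≥_st P_{L-1}` and `P_K P ≤_st P_L`. -/
def A3 {k : ℕ} (L : Fin (k + 1)) (P : Matrix (Fin (k + 2)) (Fin (k + 2)) ℝ) : Prop :=
  StLE (P L.castSucc) (P 0 ᵥ* P) ∧ StLE (P (Fin.last (k + 1)) ᵥ* P) (P L.succ)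

/-- The linear system defining the vector `U`: `U_i = R_i` for `i < L` and
`U_i = R_i + β (P_i - P_{L-1}) U` for `i ≥ L`. (For a stochastic matrix `P` and `0 < β < 1` it has
exactly one solution.) -/
def IsU {k : ℕ} (L : Fin (k + 1)) (β : ℝ) (P : Matrix (Fin (k + 2)) (Fin (k + 2)) ℝ)
    (R U : Fin (k + 2) → ℝ) : Prop :=
  (∀ i < L.succ, U i = R i) ∧
    ∀ i ≥ L.succ, U i = R i + β * ((P i - P L.castSucc) ⬝ᵥ U)

/-- The vector `M = U + β (∑_{i ≥ L} p_{Ki}) P U`. -/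
def vecM {k : ℕ} (L : Fin (k + 1)) (β : ℝ) (P : Matrix (Fin (k + 2)) (Fin (k + 2)) ℝ)
    (U : Fin (k + 2) → ℝ) : Fin (k + 2) → ℝ :=
  U + (β * ∑ i ∈ Finset.Ici L.succ, P (Fin.last (k + 1)) i) • (P *ᵥ U)

/-- The constant `h = (P_K R - β ∑_{i<L} p_{Ki} P_i R) / (1 - β ∑_{i<L} p_{Ki})`. -/
def constH {k : ℕ} (L : Fin (k + 1)) (β : ℝ) (P : Matrix (Fin (k + 2)) (Fin (k + 2)) ℝ)
    (R : Fin (k + 2) → ℝ) : ℝ :=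
  (P (Fin.last (k + 1)) ⬝ᵥ R
      - β * ∑ i ∈ Finset.Iio L.succ, P (Fin.last (k + 1)) i * (P i ⬝ᵥ R)) /
    (1 - β * ∑ i ∈ Finset.Iio L.succ, P (Fin.last (k + 1)) i)

/-- (A4): the rewards of different states are sufficiently separated. -/
def A4 {k : ℕ} (L : Fin (k + 1)) (β : ℝ) (P : Matrix (Fin (k + 2)) (Fin (k + 2)) ℝ)
    (R : Fin (k + 2) → ℝ) : Prop :=
  ∃ U : Fin (k + 2) → ℝ, IsU L β P R U ∧
    (∀ i : Fin (k + 1), i ≠ L →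
      R i.succ - R i.castSucc ≥ β * ((P i.succ - P i.castSucc) ⬝ᵥ vecM L β P U) ∧
      β * ((P i.succ - P i.castSucc) ⬝ᵥ vecM L β P U)
        ≥ β * ((P i.succ - P i.castSucc) ⬝ᵥ U) ∧
      β * ((P i.succ - P i.castSucc) ⬝ᵥ U) ≥ 0) ∧
    R L.succ - R L.castSucc ≥ β * (constH L β P R - P L.castSucc ⬝ᵥ R) ∧
    β * (constH L β P R - P L.castSucc ⬝ᵥ R) ≥ 0

/-! ### Sensing policies and their rewards -/

/-- A channel sensing policy: the next channel as a function of the history of past pairs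
(sensed channel, observed state), most recent first. Its restriction to lists of length `t`
is the decision rule `g_t` for time `t`; the initial PMFs are known and fixed. -/
abbrev Policy (N k : ℕ) : Type := List (Fin N × Fin (k + 2)) → Fin N

variable {k N : ℕ} {Ω : Type*}

/-- The history `(U_{t-1}, Y_{t-1}), …, (U_0, Y_0)` before time `t` under the policy `g`, where
`X n t` is the state of channel `n` at time `t`. -/
def history (X : Fin N → ℕ → Ω → Fin (k + 2)) (g : Policy N k) :
    ℕ → Ω → List (Fin N × Fin (k + 2))
  | 0, _ => []
  | t + 1, ω =>
    (g (history X g t ω), X (g (history X g t ω)) t ω) :: history X g t ω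

/-- The channel `U_t` sensed at time `t` under the policy `g`. -/
def choice (X : Fin N → ℕ → Ω → Fin (k + 2)) (g : Policy N k) (t : ℕ) (ω : Ω) : Fin N :=
  g (history X g t ω)

/-- The reward `R(t)` collected at time `t` under the policy `g`. -/
def reward (R : Fin (k + 2) → ℝ) (X : Fin N → ℕ → Ω → Fin (k + 2)) (g : Policy N k)
    (t : ℕ) (ω : Ω) : ℝ :=
  R (X (choice X g t ω) t ω)

/-- The objective of Problem (P1) with horizon `T`. -/
def finiteReward [MeasurableSpace Ω] (μ : Measure Ω) (β : ℝ) (R : Fin (k + 2) → ℝ)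
    (X : Fin N → ℕ → Ω → Fin (k + 2)) (T : ℕ) (g : Policy N k) : ℝ :=
  ∫ ω, ∑ t ∈ Finset.range (T + 1), β ^ t * reward R X g t ω ∂μ

/-- The objective of Problem (P2). -/
def infiniteReward [MeasurableSpace Ω] (μ : Measure Ω) (β : ℝ) (R : Fin (k + 2) → ℝ)
    (X : Fin N → ℕ → Ω → Fin (k + 2)) (g : Policy N k) : ℝ :=
  ∫ ω, ∑' t : ℕ, β ^ t * reward R X g t ω ∂μ

/-- The information state at time `t`: `belief μ X g t ω n i` is the conditional probability of
`X n t = i` given the observations and decisions before time `t`. -/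
def belief [MeasurableSpace Ω] (μ : Measure Ω) (X : Fin N → ℕ → Ω → Fin (k + 2))
    (g : Policy N k) (t : ℕ) (ω : Ω) : Fin N → Fin (k + 2) → ℝ := fun n i =>
  (cond μ {ω' | history X g t ω' = history X g t ω}).real {ω' | X n t ω' = i}

/-- Channel `n` is a myopic choice in the information state `b`: it is stochastically largest. -/
def IsStLargest (b : Fin N → Fin (k + 2) → ℝ) (n : Fin N) : Prop :=
  ∀ m, StLE (b m) (b n)

/-! ### The Gittins index -/

/-- The PMF of a channel that is sensed at all times: it starts at `π`, and it is the row of the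
observed state after each observation. The observations are the coordinates of `y`. -/
def sensedPMF (P : Matrix (Fin (k + 2)) (Fin (k + 2)) ℝ) (π : Fin (k + 2) → ℝ) :
    ℕ → (ℕ → Fin (k + 2)) → Fin (k + 2) → ℝ
  | 0, _ => π
  | t + 1, y => P (y t)

theorem stronglyMeasurable_sensedPMF (P : Matrix (Fin (k + 2)) (Fin (k + 2)) ℝ)
    (π : Fin (k + 2) → ℝ) (t : ℕ) : StronglyMeasurable (sensedPMF P π t) := by
  cases t with
  | zero => exact stronglyMeasurable_const
  | succ t =>
    exact ((measurable_of_finite fun i : Fin (k + 2) => P i).comp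
      (measurable_pi_apply t)).stronglyMeasurable

/-- The expected discounted value of the payments `c 0, c 1, …` made before the time `τ`. -/
def discountedBefore (μ : Measure (ℕ → Fin (k + 2))) (β : ℝ)
    (c : ℕ → (ℕ → Fin (k + 2)) → ℝ) (τ : (ℕ → Fin (k + 2)) → WithTop ℕ) : ℝ :=
  ∫ y, ∑' t : ℕ, {t : ℕ | (t : WithTop ℕ) < τ y}.indicator (fun t => β ^ t * c t y) t ∂μ

/-- The Gittins index of a channel with PMF `π`: the maximal ratio of expected discounted reward
to expected discounted time, when the channel is sensed before a stopping time `τ ≥ 1` of the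
process of its PMFs. Here `μ` is the law, on the path space, of the chain with initial PMF `π`. -/
def gittinsIndex (β : ℝ) (P : Matrix (Fin (k + 2)) (Fin (k + 2)) ℝ)
    (R π : Fin (k + 2) → ℝ) : ℝ :=
  sSup {r : ℝ | ∃ (μ : Measure (ℕ → Fin (k + 2))) (τ : (ℕ → Fin (k + 2)) → WithTop ℕ),
    IsMarkovChain μ π P (fun t y => y t) ∧
    IsStoppingTime
      (Filtration.natural (sensedPMF P π) (stronglyMeasurable_sensedPMF P π)) τ ∧
    (∀ y, 1 ≤ τ y) ∧
    r = discountedBefore μ β (fun t y => sensedPMF P π t y ⬝ᵥ R) τ /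
      discountedBefore μ β (fun _ _ => 1) τ}

/-- Channel `n` is a choice of the Gittins index rule in the information state `b`. -/
def HasMaxIndex (β : ℝ) (P : Matrix (Fin (k + 2)) (Fin (k + 2)) ℝ) (R : Fin (k + 2) → ℝ)
    (b : Fin N → Fin (k + 2) → ℝ) (n : Fin N) : Prop :=
  ∀ m, gittinsIndex β P R (b m) ≤ gittinsIndex β P R (b n)

/-- The policy `g` follows the Gittins index rule at time `t`. -/
def FollowsGittins [MeasurableSpace Ω] (μ : Measure Ω) (β : ℝ)
    (P : Matrix (Fin (k + 2)) (Fin (k + 2)) ℝ) (R : Fin (k + 2) → ℝ)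
    (X : Fin N → ℕ → Ω → Fin (k + 2)) (g : Policy N k) (t : ℕ) : Prop :=
  ∀ᵐ ω ∂μ, HasMaxIndex β P R (belief μ X g t ω) (choice X g t ω)

/-- The policy `g` acts as a myopic policy at time `t`. -/
def FollowsMyopic [MeasurableSpace Ω] (μ : Measure Ω)
    (X : Fin N → ℕ → Ω → Fin (k + 2)) (g : Policy N k) (t : ℕ) : Prop :=
  ∀ᵐ ω ∂μ, IsStLargest (belief μ X g t ω) (choice X g t ω)

end ChannelSensing

end

open ChannelSensing

/-! ### Stochastic dominance on finitely many states. -/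

noncomputable section

namespace ChannelSensing

variable {k : ℕ}

/-! Write `K` for the best state. By `A1` and `A3`, a belief that evolves one step unobserved lies
between `P_{K-1}` and `P_K`. So a channel just seen in state `K` dominates all the others, and a
channel seen in any other state is dominated by all the others. If the channels are ranked by
dominance, an observation therefore only moves the sensed channel to the top or to the bottom, and
the myopic policy is a round robin on a ranked list. Its value is `W`.

Optimality of the round robin is an exchange argument. `W` is affine in every belief in the list, so
replacing a belief by a dominating one reduces to comparing consecutive rows of `P`, where the
reward separations of `A4` apply. The inequalities of `Exchange`, stated for arbitrary unranked
lists, support each other and are proved by one induction on the horizon (`exchange`). They give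
`W_swap_le`: of two neighbours, the better should come first. Hence no policy beats the round robin
(`value_le_W`). Neighbours with equal expected reward can be exchanged at no loss (`W_swap_eq`), so
every policy that always senses a channel of maximal expected reward attains the bound
(`value_eq_W`).

For the index, charge `c` per step. For a belief `y` above `P_{K-1}`, sensing until the first
observation other than `K` breaks even at `c = fairCharge y`. At this charge no stopping rule makes
a profit, because going on after another state is not worth it. Used against a dominated belief `x`,
the same charge shows that the index of `x` is smaller by at least `(1 - β)(yR - xR)`
(`gittinsIndex_le`). After time 0 a stochastically largest channel is above `P_{K-1}` or is the only
channel, so a maximal index means a maximal expected reward.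

The probabilistic link is `setIntegral_history`: given the history, the channels are independent
with the recursively computed `beliefs`. The infinite horizon follows by letting the horizon tend to
infinity, as the same policy is optimal for every finite one. -/

theorem StLE.refl (x : Fin (k + 2) → ℝ) : StLE x x := fun _ _ => le_rfl

theorem StLE.trans {x y z : Fin (k + 2) → ℝ} (h : StLE x y) (h' : StLE y z) : StLE x z :=
  fun i hi => (h i hi).trans (h' i hi)

theorem eq_add_sum_increments {n : ℕ} (f : Fin (n + 1) → ℝ) (j : Fin (n + 1)) :
    f j = f 0 + ∑ i : Fin n, if i.succ ≤ j then f i.succ - f i.castSucc else 0 := by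
  induction j using Fin.induction with
  | zero =>
    rw [Finset.sum_eq_zero]
    · simp
    · intro i _
      rw [if_neg]
      simp
  | succ j ih =>
    have : ∀ i : Fin n, (if i.succ ≤ j.succ then f i.succ - f i.castSucc else 0)
        = (if i.succ ≤ j.castSucc then f i.succ - f i.castSucc else 0)
          + if i = j then f j.succ - f j.castSucc else 0 := by
      intro i
      by_cases h1 : i.succ ≤ j.castSucc
      · have h2 : i.succ ≤ j.succ := h1.trans (Fin.castSucc_lt_succ).le
        have h3 : i ≠ j := by
          rintro rfl
          exact absurd h1 (not_le.mpr Fin.castSucc_lt_succ)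
        simp [h1, h2, h3]
      · by_cases h3 : i = j
        · subst h3
          simp [h1]
        · have h2 : ¬ i.succ ≤ j.succ := by
            intro h
            apply h1
            simp only [Fin.le_def, Fin.val_succ, Fin.val_castSucc] at h ⊢
            have : (i : ℕ) ≠ j := fun h => h3 (Fin.ext h)
            omega
          simp [h1, h2, h3]
    simp_rw [this, Finset.sum_add_distrib, Finset.sum_ite_eq', Finset.mem_univ, if_true]
    linarith

/-- Summation by parts: the tails, which define dominance, are weighted by the increments of `f`.
Every later comparison of beliefs goes through increments between consecutive states. -/
theorem dotProduct_eq_sum_tails (x f : Fin (k + 2) → ℝ) :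
    x ⬝ᵥ f = f 0 * ∑ j, x j + ∑ i : Fin (k + 1),
      (f i.succ - f i.castSucc) * ∑ j ∈ Finset.Ici i.succ, x j := by
  have h1 : ∀ j, x j * f j = f 0 * x j + ∑ i : Fin (k + 1),
      if i.succ ≤ j then (f i.succ - f i.castSucc) * x j else 0 := by
    intro j
    conv_lhs => rw [eq_add_sum_increments f j]
    rw [mul_add, Finset.mul_sum, mul_comm (x j)]
    congr 1
    refine Finset.sum_congr rfl fun i _ => ?_
    split_ifs <;> ring
  simp only [dotProduct]
  rw [Finset.sum_congr rfl fun j _ => h1 j, Finset.sum_add_distrib, ← Finset.mul_sum,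
    Finset.sum_comm]
  congr 1
  refine Finset.sum_congr rfl fun i _ => ?_
  rw [← Finset.sum_filter, ← Finset.mul_sum]
  congr 2
  ext j
  simp

/-- Expectations of nondecreasing functions are monotone for stochastic dominance. -/
theorem StLE.dotProduct_le {x y : Fin (k + 2) → ℝ} (h : StLE x y) (hs : ∑ j, x j = ∑ j, y j)
    {f : Fin (k + 2) → ℝ} (hf : ∀ i : Fin (k + 1), f i.castSucc ≤ f i.succ) :
    x ⬝ᵥ f ≤ y ⬝ᵥ f := by
  rw [dotProduct_eq_sum_tails x, dotProduct_eq_sum_tails y, hs]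
  refine add_le_add le_rfl (Finset.sum_le_sum fun i _ => ?_)
  exact mul_le_mul_of_nonneg_left (h _ (Fin.succ_pos i)) (sub_nonneg.mpr (hf i))

theorem StLE.apply_last {x y : Fin (k + 2) → ℝ} (h : StLE x y) :
    x (Fin.last (k + 1)) ≤ y (Fin.last (k + 1)) := by
  have := h (Fin.last (k + 1)) (Fin.last_pos)
  have e : Finset.Ici (Fin.last (k + 1)) = {Fin.last (k + 1)} := by
    ext j
    simp [Fin.last_le_iff]
  simpa [e] using this

/-- Adding a common constant on all states does not matter: comparison through differences. -/
theorem StLE.dotProduct_sub_le {x y : Fin (k + 2) → ℝ} (h : StLE x y)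
    (hs : ∑ j, x j = ∑ j, y j) {f g : Fin (k + 2) → ℝ}
    (hf : ∀ i : Fin (k + 1), f i.succ - f i.castSucc ≤ g i.succ - g i.castSucc) :
    y ⬝ᵥ f - x ⬝ᵥ f ≤ y ⬝ᵥ g - x ⬝ᵥ g := by
  have := h.dotProduct_le hs (f := g - f) (fun i => by
    simp only [Pi.sub_apply]
    linarith [hf i])
  rw [dotProduct_sub, dotProduct_sub] at this
  linarith

/-- A tail of `z P` is the expectation under `z` of the corresponding tail of the rows, which `A1`
makes nondecreasing in the state. -/
theorem StLE.vecMul {P : Matrix (Fin (k + 2)) (Fin (k + 2)) ℝ} (hA : A1 P)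
    {x y : Fin (k + 2) → ℝ} (h : StLE x y) (hs : ∑ j, x j = ∑ j, y j) :
    StLE (x ᵥ* P) (y ᵥ* P) := by
  intro i hi
  have e : ∀ z : Fin (k + 2) → ℝ, ∑ j ∈ Finset.Ici i, (z ᵥ* P) j
      = z ⬝ᵥ fun l => ∑ j ∈ Finset.Ici i, P l j := by
    intro z
    simp only [Matrix.vecMul, dotProduct]
    rw [Finset.sum_comm]
    simp_rw [Finset.mul_sum]
  rw [e, e]
  exact h.dotProduct_le hs fun l => hA l i hi

theorem StLE.antisymm {x y : Fin (k + 2) → ℝ} (h : StLE x y) (h' : StLE y x)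
    (hs : ∑ j, x j = ∑ j, y j) : x = y := by
  have key : ∀ f : Fin (k + 2) → ℝ, x ⬝ᵥ f = y ⬝ᵥ f := by
    intro f
    rw [dotProduct_eq_sum_tails x, dotProduct_eq_sum_tails y, hs]
    congr 1
    refine Finset.sum_congr rfl fun i _ => ?_
    rw [le_antisymm (h _ (Fin.succ_pos i)) (h' _ (Fin.succ_pos i))]
  ext j
  simpa using key (Pi.single j 1)

theorem stLE_row_of_le {P : Matrix (Fin (k + 2)) (Fin (k + 2)) ℝ} (hA : A1 P)
    {i j : Fin (k + 2)} (hij : i ≤ j) : StLE (P i) (P j) := by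
  intro l hl
  have : Monotone fun i => ∑ j ∈ Finset.Ici l, P i j :=
    Fin.monotone_iff_le_succ.mpr fun i => hA i l hl
  exact this hij

theorem vecMul_mem_stdSimplex {P : Matrix (Fin (k + 2)) (Fin (k + 2)) ℝ}
    (hP : ∀ i, P i ∈ stdSimplex ℝ (Fin (k + 2))) {x : Fin (k + 2) → ℝ}
    (hx : x ∈ stdSimplex ℝ (Fin (k + 2))) : x ᵥ* P ∈ stdSimplex ℝ (Fin (k + 2)) := by
  simp only [stdSimplex, Set.mem_ofPred_eq, Matrix.vecMul, dotProduct]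
  refine ⟨fun j => Finset.sum_nonneg fun i _ => mul_nonneg (hx.1 i) ((hP i).1 j), ?_⟩
  rw [Finset.sum_comm]
  simp_rw [← Finset.mul_sum, (hP _).2, mul_one]
  exact hx.2

theorem stLE_vecMul_of_row {P : Matrix (Fin (k + 2)) (Fin (k + 2)) ℝ}
    {x : Fin (k + 2) → ℝ} (hx : x ∈ stdSimplex ℝ (Fin (k + 2))) {z : Fin (k + 2) → ℝ}
    (h : ∀ i, StLE z (P i)) : StLE z (x ᵥ* P) := by
  intro i hi
  simp only [Matrix.vecMul, dotProduct]
  rw [Finset.sum_comm]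
  simp_rw [← Finset.mul_sum]
  calc ∑ j ∈ Finset.Ici i, z j = ∑ l, x l * ∑ j ∈ Finset.Ici i, z j := by
        rw [← Finset.sum_mul, hx.2, one_mul]
    _ ≤ _ := Finset.sum_le_sum fun l _ => mul_le_mul_of_nonneg_left (h l i hi) (hx.1 l)

theorem vecMul_stLE_of_row {P : Matrix (Fin (k + 2)) (Fin (k + 2)) ℝ}
    {x : Fin (k + 2) → ℝ} (hx : x ∈ stdSimplex ℝ (Fin (k + 2))) {z : Fin (k + 2) → ℝ}
    (h : ∀ i, StLE (P i) z) : StLE (x ᵥ* P) z := by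
  intro i hi
  simp only [Matrix.vecMul, dotProduct]
  rw [Finset.sum_comm]
  simp_rw [← Finset.mul_sum]
  calc _ ≤ ∑ l, x l * ∑ j ∈ Finset.Ici i, z j :=
        Finset.sum_le_sum fun l _ => mul_le_mul_of_nonneg_left (h l i hi) (hx.1 l)
    _ = _ := by rw [← Finset.sum_mul, hx.2, one_mul]

/-! ### The sensing model, beliefs, and the auxiliary quantities `U`, `gainU`, `h`. -/

/-- A transition matrix and rewards with the separation of rewards that makes the myopic policy
optimal, together with the auxiliary vector `U` and the constant `h`. -/
structure SensingModel (k : ℕ) where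
  P : Matrix (Fin (k + 2)) (Fin (k + 2)) ℝ
  R : Fin (k + 2) → ℝ
  U : Fin (k + 2) → ℝ
  β : ℝ
  h : ℝ
  row_mem : ∀ i, P i ∈ stdSimplex ℝ (Fin (k + 2))
  β_pos : 0 < β
  β_lt : β < 1
  mono_row : A1 P
  bounds : A3 (Fin.last k) P
  U_apply : ∀ j, U j = R j + if j = Fin.last (k + 1) then
    β * ((P (Fin.last (k + 1)) - P (Fin.last k).castSucc) ⬝ᵥ U) else 0
  U_gap_nonneg : ∀ i : Fin (k + 1), i ≠ Fin.last k → 0 ≤ (P i.succ - P i.castSucc) ⬝ᵥ U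
  gap : ∀ i : Fin (k + 1), i ≠ Fin.last k → β * ((P i.succ - P i.castSucc) ⬝ᵥ
    (U + (β * P (Fin.last (k + 1)) (Fin.last (k + 1))) • (P *ᵥ U))) ≤ R i.succ - R i.castSucc
  gap_last : β * (h - P (Fin.last k).castSucc ⬝ᵥ R)
    ≤ R (Fin.last (k + 1)) - R (Fin.last k).castSucc
  le_h : P (Fin.last k).castSucc ⬝ᵥ R ≤ h
  h_eq : h = P (Fin.last (k + 1)) ⬝ᵥ R + β * ∑ i, P (Fin.last (k + 1)) i *
    if i = Fin.last (k + 1) then 0 else h - P i ⬝ᵥ R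
  gap_U : ∀ i : Fin (k + 1), i ≠ Fin.last k →
    β * ((P i.succ - P i.castSucc) ⬝ᵥ U) ≤ R i.succ - R i.castSucc

/-- For `L = K` the sum over `i ≥ L` in `M` has a single term, and the quotient defining `h` becomes
the fixed-point equation `h_eq`, which is the form used by the induction. -/
theorem exists_sensingModel (P : Matrix (Fin (k + 2)) (Fin (k + 2)) ℝ) (R : Fin (k + 2) → ℝ)
    (β : ℝ) (hP : ∀ i, P i ∈ stdSimplex ℝ (Fin (k + 2))) (hβ0 : 0 < β) (hβ1 : β < 1)
    (h1 : A1 P) (h3 : A3 (Fin.last k) P) (h4 : A4 (Fin.last k) β P R) :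
    ∃ m : SensingModel k, m.P = P ∧ m.R = R ∧ m.β = β := by
  obtain ⟨U, ⟨hU1, hU2⟩, hgap, hl1, hl2⟩ := h4
  have hIci : Finset.Ici (Fin.last k).succ = {Fin.last (k + 1)} := by
    ext j
    simp [Fin.last_le_iff]
  have hI : ∀ f : Fin (k + 2) → ℝ, ∑ i ∈ Finset.Iio (Fin.last k).succ, f i
      = ∑ i, if i = Fin.last (k + 1) then 0 else f i := by
    intro f
    have : Finset.Iio (Fin.last k).succ = Finset.univ.filter (· ≠ Fin.last (k + 1)) := by
      ext j
      rw [Fin.succ_last, Finset.mem_Iio, Finset.mem_filter, Fin.lt_last_iff_ne_last]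
      simp only [Finset.mem_univ, true_and]
    rw [this, Finset.sum_filter]
    simp only [ne_eq, ite_not]
  have hsum : ∑ i ∈ Finset.Iio (Fin.last k).succ, P (Fin.last (k + 1)) i ≤ 1 := by
    rw [← (hP (Fin.last (k + 1))).2]
    exact Finset.sum_le_sum_of_subset_of_nonneg (Finset.subset_univ _)
      fun i _ _ => (hP (Fin.last (k + 1))).1 i
  have hden : 0 < 1 - β * ∑ i ∈ Finset.Iio (Fin.last k).succ, P (Fin.last (k + 1)) i := by
    nlinarith
  have hM : vecM (Fin.last k) β P U
      = U + (β * P (Fin.last (k + 1)) (Fin.last (k + 1))) • (P *ᵥ U) := by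
    rw [vecM, hIci, Finset.sum_singleton]
  refine ⟨⟨P, R, U, β, constH (Fin.last k) β P R, hP, hβ0, hβ1, h1, h3, ?_, ?_, ?_, ?_, ?_, ?_, ?_⟩,
    rfl, rfl, rfl⟩
  · intro j
    by_cases hj : j = Fin.last (k + 1)
    · subst hj
      rw [if_pos rfl]
      exact hU2 _ (by simp)
    · rw [if_neg hj, add_zero]
      exact hU1 j (by simpa [Fin.lt_last_iff_ne_last] using hj)
  · intro i hi
    exact nonneg_of_mul_nonneg_right (hgap i hi).2.2 hβ0
  · intro i hi
    rw [← hM]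
    exact (hgap i hi).1
  · simpa using hl1
  · have := nonneg_of_mul_nonneg_right hl2 hβ0
    linarith
  · have e : constH (Fin.last k) β P R *
        (1 - β * ∑ i ∈ Finset.Iio (Fin.last k).succ, P (Fin.last (k + 1)) i)
        = P (Fin.last (k + 1)) ⬝ᵥ R
      - β * ∑ i ∈ Finset.Iio (Fin.last k).succ, P (Fin.last (k + 1)) i * (P i ⬝ᵥ R) := by
      rw [constH, div_mul_cancel₀ _ hden.ne']
    have e2 : ∑ i, P (Fin.last (k + 1)) i * (if i = Fin.last (k + 1) then 0 else
        constH (Fin.last k) β P R - P i ⬝ᵥ R)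
        = constH (Fin.last k) β P R *
          ∑ i ∈ Finset.Iio (Fin.last k).succ, P (Fin.last (k + 1)) i
        - ∑ i ∈ Finset.Iio (Fin.last k).succ, P (Fin.last (k + 1)) i * (P i ⬝ᵥ R) := by
      rw [hI, hI, Finset.mul_sum, ← Finset.sum_sub_distrib]
      refine Finset.sum_congr rfl fun i _ => ?_
      split_ifs <;> ring
    rw [e2]
    linarith
  · intro i hi
    have := hgap i hi
    linarith [this.1, this.2.1]

namespace SensingModel

variable (m : SensingModel k)

theorem sum_row (i : Fin (k + 2)) : ∑ j, m.P i j = 1 := (m.row_mem i).2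

theorem row_nonneg (i j : Fin (k + 2)) : 0 ≤ m.P i j := (m.row_mem i).1 j

/-- The states of knowledge about a channel: PMFs between the extreme rows. -/
def Bel : Type :=
  {x : Fin (k + 2) → ℝ // x ∈ stdSimplex ℝ (Fin (k + 2)) ∧ StLE (m.P 0) x ∧
    StLE x (m.P (Fin.last (k + 1)))}

variable {m}

theorem Bel.nonneg (x : m.Bel) (i) : 0 ≤ x.1 i := x.2.1.1 i

theorem Bel.sum (x : m.Bel) : ∑ i, x.1 i = 1 := x.2.1.2

variable (m)

/-- The belief right after the state `i` was observed, one step later. -/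
def row (i : Fin (k + 2)) : m.Bel :=
  ⟨m.P i, m.row_mem i, stLE_row_of_le m.mono_row (Fin.zero_le _),
    stLE_row_of_le m.mono_row (Fin.le_last _)⟩

variable {m}

theorem vecMul_mem (x : Fin (k + 2) → ℝ) (hx : x ∈ stdSimplex ℝ (Fin (k + 2))) :
    x ᵥ* m.P ∈ stdSimplex ℝ (Fin (k + 2)) ∧ StLE (m.P 0) (x ᵥ* m.P) ∧
    StLE (x ᵥ* m.P) (m.P (Fin.last (k + 1))) :=
  ⟨vecMul_mem_stdSimplex m.row_mem hx, stLE_vecMul_of_row hx fun i => (m.row i).2.2.1,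
    vecMul_stLE_of_row hx fun i => (m.row i).2.2.2⟩

/-- The belief about an unobserved channel, one step later. -/
def Bel.step (x : m.Bel) : m.Bel := ⟨x.1 ᵥ* m.P, vecMul_mem x.1 x.2.1⟩

/-- Stochastic order of beliefs. -/
def Bel.Le (x y : m.Bel) : Prop := StLE x.1 y.1

theorem Bel.Le.refl (x : m.Bel) : x.Le x := StLE.refl _

theorem Bel.Le.trans {x y z : m.Bel} (h : x.Le y) (h' : y.Le z) : x.Le z := StLE.trans h h'

variable (m)

/-- The best belief `P_K`. -/
abbrev best : m.Bel := m.row (Fin.last (k + 1))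

/-- The second best row `P_{K-1}`. -/
abbrev second : m.Bel := m.row (Fin.last k).castSucc

variable {m}

theorem Bel.le_best (x : m.Bel) : x.Le m.best := x.2.2.2

/-- Every belief dominates `P_1`, so its step dominates `P_1 P`, and `A3` applies. This separates
the unsensed channels from a channel just seen below state `K`. -/
theorem Bel.second_le_step (x : m.Bel) : m.second.Le x.step :=
  m.bounds.1.trans (StLE.vecMul m.mono_row x.2.2.1 (by rw [m.sum_row, x.sum]))

theorem row_le_second {i : Fin (k + 2)} (hi : i ≠ Fin.last (k + 1)) :
    (m.row i).Le m.second := by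
  apply stLE_row_of_le m.mono_row
  have := Fin.val_lt_last hi
  simp only [Fin.le_def, Fin.val_castSucc, Fin.val_last]
  omega

theorem row_le_step {i : Fin (k + 2)} (hi : i ≠ Fin.last (k + 1)) (x : m.Bel) :
    (m.row i).Le x.step := (row_le_second hi).trans x.second_le_step

theorem row_castSucc_le_succ (i : Fin (k + 1)) : (m.row i.castSucc).Le (m.row i.succ) :=
  m.mono_row i

theorem Bel.Le.step {x y : m.Bel} (h : x.Le y) : x.step.Le y.step :=
  StLE.vecMul m.mono_row h (by rw [x.sum, y.sum])

theorem Bel.Le.dotProduct_le {x y : m.Bel} (h : x.Le y) {f : Fin (k + 2) → ℝ}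
    (hf : ∀ i : Fin (k + 1), f i.castSucc ≤ f i.succ) : x.1 ⬝ᵥ f ≤ y.1 ⬝ᵥ f :=
  StLE.dotProduct_le h (by rw [x.sum, y.sum]) hf

theorem Bel.Le.dotProduct_sub_le {x y : m.Bel} (h : x.Le y) {f g : Fin (k + 2) → ℝ}
    (hf : ∀ i : Fin (k + 1), f i.succ - f i.castSucc ≤ g i.succ - g i.castSucc) :
    y.1 ⬝ᵥ f - x.1 ⬝ᵥ f ≤ y.1 ⬝ᵥ g - x.1 ⬝ᵥ g :=
  StLE.dotProduct_sub_le h (by rw [x.sum, y.sum]) hf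

theorem Bel.Le.apply_last {x y : m.Bel} (h : x.Le y) :
    x.1 (Fin.last (k + 1)) ≤ y.1 (Fin.last (k + 1)) := StLE.apply_last h

variable (m)

/-- The gain `(P_K - P_{K-1}) U`. -/
def gainU : ℝ := m.best.1 ⬝ᵥ m.U - m.second.1 ⬝ᵥ m.U

variable {m}

theorem U_castSucc (i : Fin (k + 1)) : m.U i.castSucc = m.R i.castSucc := by
  rw [m.U_apply, if_neg (Fin.castSucc_lt_last i).ne, add_zero]

theorem U_of_ne {i : Fin (k + 2)} (h : i ≠ Fin.last (k + 1)) : m.U i = m.R i := by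
  rw [m.U_apply, if_neg h, add_zero]

theorem U_last : m.U (Fin.last (k + 1)) = m.R (Fin.last (k + 1)) + m.β * m.gainU := by
  rw [m.U_apply, if_pos rfl, sub_dotProduct]
  rfl

/-- `U` is the reward plus a bonus `β * gainU` in the best state. The bonus will bound the worth of
leaving a channel on top after it was seen in state `K` (`best_sub_le`). -/
theorem dotProduct_U (x : m.Bel) :
    x.1 ⬝ᵥ m.U = x.1 ⬝ᵥ m.R + x.1 (Fin.last (k + 1)) * (m.β * m.gainU) := by
  have : m.U = m.R + Pi.single (Fin.last (k + 1)) (m.β * m.gainU) := by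
    ext j
    by_cases hj : j = Fin.last (k + 1)
    · subst hj
      simp [U_last]
    · simp [U_of_ne hj, hj]
  conv_lhs => rw [this]
  rw [dotProduct_add, dotProduct_single]

theorem R_mono (i : Fin (k + 1)) : m.R i.castSucc ≤ m.R i.succ := by
  by_cases hi : i = Fin.last k
  · subst hi
    have h1 := m.gap_last
    have h2 := mul_nonneg m.β_pos.le (sub_nonneg.mpr m.le_h)
    rw [Fin.succ_last]
    linarith
  · have h1 := m.gap_U i hi
    have h2 := mul_nonneg m.β_pos.le (m.U_gap_nonneg i hi)
    linarith

/-- A linear equation for `gainU`; its coefficient is positive by `gainU_factor_pos`, so `gainU` has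
the sign of `(P_K - P_{K-1}) R`. -/
theorem gainU_eq : m.gainU = m.best.1 ⬝ᵥ m.R - m.second.1 ⬝ᵥ m.R +
    (m.best.1 (Fin.last (k + 1)) - m.second.1 (Fin.last (k + 1))) * (m.β * m.gainU) := by
  conv_lhs => rw [gainU, dotProduct_U, dotProduct_U]
  ring

theorem Bel.apply_le_one (x : m.Bel) (i) : x.1 i ≤ 1 := by
  rw [← x.sum]
  exact Finset.single_le_sum (fun i _ => x.nonneg i) (Finset.mem_univ i)

theorem gainU_factor_pos :
    0 < 1 - (m.best.1 (Fin.last (k + 1)) - m.second.1 (Fin.last (k + 1))) * m.β := by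
  have h1 := m.best.apply_le_one (Fin.last (k + 1))
  have h2 := m.second.nonneg (Fin.last (k + 1))
  nlinarith [m.β_pos, m.β_lt]

theorem Bel.Le.R_le {x y : m.Bel} (h : x.Le y) : x.1 ⬝ᵥ m.R ≤ y.1 ⬝ᵥ m.R :=
  h.dotProduct_le R_mono

theorem gainU_nonneg : 0 ≤ m.gainU := by
  have h1 : m.second.1 ⬝ᵥ m.R ≤ m.best.1 ⬝ᵥ m.R := m.second.le_best.R_le
  have h2 := gainU_eq (m := m)
  have h3 := gainU_factor_pos (m := m)
  by_contra hneg
  push Not at hneg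
  nlinarith

theorem U_mono (i : Fin (k + 1)) : m.U i.castSucc ≤ m.U i.succ := by
  have := R_mono (m := m) i
  rw [U_castSucc, m.U_apply i.succ]
  split_ifs
  · have h := mul_nonneg m.β_pos.le (gainU_nonneg (m := m))
    rw [gainU, ← sub_dotProduct] at h
    have : 0 ≤ m.β * ((m.P (Fin.last (k + 1)) - m.P (Fin.last k).castSucc) ⬝ᵥ m.U) := h
    linarith
  · linarith

theorem Bel.Le.U_le {x y : m.Bel} (h : x.Le y) : x.1 ⬝ᵥ m.U ≤ y.1 ⬝ᵥ m.U :=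
  h.dotProduct_le U_mono

theorem step_dotProduct (x : m.Bel) (f : Fin (k + 2) → ℝ) :
    x.step.1 ⬝ᵥ f = x.1 ⬝ᵥ fun i => (m.row i).1 ⬝ᵥ f := by
  show (x.1 ᵥ* m.P) ⬝ᵥ f = _
  rw [← dotProduct_mulVec]
  rfl

theorem row_gap_U (i : Fin (k + 1)) (hi : i ≠ Fin.last k) :
    m.β * ((m.row i.succ).1 ⬝ᵥ m.U - (m.row i.castSucc).1 ⬝ᵥ m.U)
      ≤ m.R i.succ - m.R i.castSucc := by
  have := m.gap_U i hi
  rwa [sub_dotProduct] at this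

/-- Postponing the comparison of two beliefs makes it smaller. -/
theorem Bel.Le.step_U {x y : m.Bel} (h : x.Le y) :
    m.β * (y.step.1 ⬝ᵥ m.U - x.step.1 ⬝ᵥ m.U) ≤ y.1 ⬝ᵥ m.U - x.1 ⬝ᵥ m.U := by
  rw [step_dotProduct, step_dotProduct]
  -- The function `β P U` has smaller increments than `U`: for the pair `(K-1, K)` because the bonus
  -- alone already is `β * gainU`, for the other pairs by `gap_U`.
  have := h.dotProduct_sub_le (f := fun i => m.β * ((m.row i).1 ⬝ᵥ m.U)) (g := m.U) (by
    intro i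
    by_cases hi : i = Fin.last k
    · subst hi
      have h1 := R_mono (m := m) (Fin.last k)
      rw [Fin.succ_last, U_castSucc, U_last, gainU]
      rw [Fin.succ_last] at h1
      linarith
    · have h1 := row_gap_U (m := m) i hi
      have h2 : i.succ ≠ Fin.last (k + 1) := by
        simpa [← Fin.succ_last] using hi
      rw [U_castSucc, U_of_ne h2]
      linarith)
  have e : ∀ z : m.Bel, z.1 ⬝ᵥ (fun i => m.β * ((m.row i).1 ⬝ᵥ m.U))
      = m.β * (z.1 ⬝ᵥ fun i => (m.row i).1 ⬝ᵥ m.U) := by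
    intro z
    simp only [dotProduct, Finset.mul_sum]
    refine Finset.sum_congr rfl fun i _ => ?_
    refine Finset.sum_congr rfl fun j _ => ?_
    ring
  rw [e, e] at this
  linarith

theorem R_gap_le_U_gap {x y : m.Bel} (h : x.Le y) :
    y.1 ⬝ᵥ m.R - x.1 ⬝ᵥ m.R ≤ y.1 ⬝ᵥ m.U - x.1 ⬝ᵥ m.U := by
  rw [dotProduct_U, dotProduct_U]
  have h1 := h.apply_last
  have h2 := mul_nonneg m.β_pos.le (gainU_nonneg (m := m))
  nlinarith

theorem row_gap_R (i : Fin (k + 1)) (hi : i ≠ Fin.last k) :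
    m.β * ((m.row i.succ).1 ⬝ᵥ m.R - (m.row i.castSucc).1 ⬝ᵥ m.R)
      ≤ m.R i.succ - m.R i.castSucc :=
  (mul_le_mul_of_nonneg_left (R_gap_le_U_gap (row_castSucc_le_succ i)) m.β_pos.le).trans
    (row_gap_U i hi)

theorem row_gap_M (i : Fin (k + 1)) (hi : i ≠ Fin.last k) :
    m.β * (((m.row i.succ).1 ⬝ᵥ m.U - (m.row i.castSucc).1 ⬝ᵥ m.U)
      + m.β * m.best.1 (Fin.last (k + 1)) *
        ((m.row i.succ).step.1 ⬝ᵥ m.U - (m.row i.castSucc).step.1 ⬝ᵥ m.U))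
      ≤ m.R i.succ - m.R i.castSucc := by
  have := m.gap i hi
  rw [dotProduct_add, dotProduct_smul, sub_dotProduct, sub_dotProduct] at this
  rw [step_dotProduct, step_dotProduct]
  exact this

theorem best_R_le_h : m.best.1 ⬝ᵥ m.R ≤ m.h := by
  have h1 := m.h_eq
  have h2 : 0 ≤ ∑ i, m.P (Fin.last (k + 1)) i *
      if i = Fin.last (k + 1) then 0 else m.h - m.P i ⬝ᵥ m.R := by
    refine Finset.sum_nonneg fun i _ => mul_nonneg (m.row_nonneg _ _) ?_
    split_ifs with hi
    · rfl
    · have h3 : (m.row i).1 ⬝ᵥ m.R ≤ m.second.1 ⬝ᵥ m.R := (row_le_second hi).R_le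
      have h4 := m.le_h
      have h5 : m.P i ⬝ᵥ m.R ≤ m.P (Fin.last k).castSucc ⬝ᵥ m.R := h3
      linarith
  have h3 := mul_nonneg m.β_pos.le h2
  show m.P (Fin.last (k + 1)) ⬝ᵥ m.R ≤ m.h
  linarith

theorem Bel.R_le_h (x : m.Bel) : x.1 ⬝ᵥ m.R ≤ m.h := x.le_best.R_le.trans best_R_le_h

/-- If two comparable beliefs have the same immediate reward, they have the same `U`-value. -/
theorem Bel.Le.U_eq {x y : m.Bel} (h : x.Le y) (hR : x.1 ⬝ᵥ m.R = y.1 ⬝ᵥ m.R) :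
    x.1 ⬝ᵥ m.U = y.1 ⬝ᵥ m.U := by
  rw [dotProduct_U, dotProduct_U, hR]
  rcases h.apply_last.eq_or_lt with e | hlt
  · rw [e]
  · have hgap : m.R (Fin.last k).castSucc = m.R (Fin.last (k + 1)) := by
      by_contra hne
      have hlt' : m.R (Fin.last k).castSucc < m.R (Fin.last (k + 1)) :=
        lt_of_le_of_ne (by simpa using R_mono (m := m) (Fin.last k)) hne
      set c := m.R (Fin.last (k + 1)) - m.R (Fin.last k).castSucc with hc
      -- Flattening the top reward to `R_{K-1}` leaves a nondecreasing function. If the top gap were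
      -- positive, more mass on `K` would then force a strictly larger expected reward.
      have := h.dotProduct_le (f := m.R - Pi.single (Fin.last (k + 1)) c) (by
        intro i
        have hi := (Fin.castSucc_lt_last i).ne
        by_cases h' : i = Fin.last k
        · subst h'
          simp [hc]
        · have h2 : i.succ ≠ Fin.last (k + 1) := by
            simpa [← Fin.succ_last] using h'
          simpa [hi, h2] using R_mono (m := m) i)
      rw [dotProduct_sub, dotProduct_sub, dotProduct_single, dotProduct_single, hR] at this
      nlinarith
    -- With no gap at the top, `gap_last` squeezes `h` down to `P_{K-1} R`; as `P_K R` lies between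
    -- the two, the bonus vanishes.
    have h0 : m.gainU = 0 := by
      have h1 := m.gap_last
      rw [hgap, sub_self] at h1
      have h2 := m.le_h
      have h3 : m.h ≤ m.second.1 ⬝ᵥ m.R := by
        have : m.h - m.P (Fin.last k).castSucc ⬝ᵥ m.R ≤ 0 := by
          by_contra hh
          push Not at hh
          have := mul_pos m.β_pos hh
          linarith
        show m.h ≤ m.P (Fin.last k).castSucc ⬝ᵥ m.R
        linarith
      have h4 : m.second.1 ⬝ᵥ m.R ≤ m.best.1 ⬝ᵥ m.R := m.second.le_best.R_le
      have h5 := best_R_le_h (m := m)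
      have h6 := gainU_eq (m := m)
      have h7 := gainU_factor_pos (m := m)
      have h8 : m.best.1 ⬝ᵥ m.R = m.second.1 ⬝ᵥ m.R := le_antisymm (h5.trans h3) h4
      have h9 : m.gainU * (1 - (m.best.1 (Fin.last (k + 1)) - m.second.1 (Fin.last (k + 1)))
          * m.β) = 0 := by
        rw [h8] at h6
        linarith
      exact (mul_eq_zero.mp h9).resolve_right h7.ne'
    rw [h0]
    ring

end SensingModel
end ChannelSensing
end

/-! ### The round-robin value `W` and its affine structure. -/

noncomputable section

namespace ChannelSensing
namespace SensingModel

variable {k : ℕ} {m : SensingModel k}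

/-- The list of beliefs after the top channel was observed in state `i`: it stays on top if `i` is
the best state, and it becomes the last one otherwise. -/
def place (i : Fin (k + 2)) (Z : List m.Bel) : List m.Bel :=
  if i = Fin.last (k + 1) then m.row i :: Z else Z ++ [m.row i]

@[simp] theorem place_last (Z : List m.Bel) :
    place (Fin.last (k + 1)) Z = m.best :: Z := if_pos rfl

theorem place_of_ne {i : Fin (k + 2)} (hi : i ≠ Fin.last (k + 1)) (Z : List m.Bel) :
    place i Z = Z ++ [m.row i] := if_neg hi

@[simp] theorem place_castSucc (i : Fin (k + 1)) (Z : List m.Bel) :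
    place i.castSucc Z = Z ++ [m.row i.castSucc] := if_neg (Fin.castSucc_lt_last i).ne

/-- The expected discounted reward over `t` steps of the round-robin policy that senses the top
channel of a list of channels until it is observed not to be in the best state, and then moves it
to the end of the list. -/
def W : ℕ → List m.Bel → ℝ
  | 0, _ => 0
  | _ + 1, [] => 0
  | t + 1, x :: Z => x.1 ⬝ᵥ m.R + m.β * ∑ i, x.1 i * W t (place i (Z.map Bel.step))

@[simp] theorem W_zero (Z : List m.Bel) : W 0 Z = 0 := by
  simp [W]

theorem W_succ (t : ℕ) (x : m.Bel) (Z : List m.Bel) : W (t + 1) (x :: Z)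
    = x.1 ⬝ᵥ m.R + m.β * ∑ i, x.1 i * W t (place i (Z.map Bel.step)) := by
  simp [W]

/-- The round-robin reward is affine in each of the beliefs. -/
theorem W_affine (t : ℕ) : ∀ (A B : List m.Bel) (x : m.Bel) (c : Fin (k + 2) → ℝ)
    (v : Fin (k + 2) → m.Bel), (∀ j, x.1 j = ∑ l, c l * (v l).1 j) → ∑ l, c l = 1 →
    W t (A ++ x :: B) = ∑ l, c l * W t (A ++ v l :: B) := by
  induction t with
  | zero => simp
  | succ t ih =>
    intro A B x c v hx hc
    cases A with
    | nil =>
      simp only [List.nil_append, W_succ, mul_add, Finset.sum_add_distrib]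
      have e1 : x.1 ⬝ᵥ m.R = ∑ l, c l * ((v l).1 ⬝ᵥ m.R) := by
        simp only [dotProduct, Finset.mul_sum]
        rw [Finset.sum_comm]
        refine Finset.sum_congr rfl fun j _ => ?_
        rw [hx, Finset.sum_mul]
        exact Finset.sum_congr rfl fun l _ => by ring
      rw [e1]
      congr 1
      simp_rw [Finset.mul_sum]
      rw [Finset.sum_comm]
      refine Finset.sum_congr rfl fun j _ => ?_
      rw [hx, Finset.sum_mul, Finset.mul_sum]
      exact Finset.sum_congr rfl fun l _ => by ring
    | cons a A =>
      simp only [List.cons_append, W_succ, mul_add, Finset.sum_add_distrib]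
      rw [← Finset.sum_mul, hc, one_mul]
      congr 1
      have hstep : ∀ j, x.step.1 j = ∑ l, c l * (v l).step.1 j := by
        intro j
        show (x.1 ᵥ* m.P) j = ∑ l, c l * ((v l).1 ᵥ* m.P) j
        simp only [vecMul, dotProduct, Finset.mul_sum]
        rw [Finset.sum_comm]
        refine Finset.sum_congr rfl fun i _ => ?_
        rw [hx, Finset.sum_mul]
        exact Finset.sum_congr rfl fun l _ => by ring
      have key : ∀ i, W t (place i ((A ++ x :: B).map Bel.step))
          = ∑ l, c l * W t (place i ((A ++ v l :: B).map Bel.step)) := by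
        intro i
        by_cases hi : i = Fin.last (k + 1)
        · subst hi
          simpa using ih (m.best :: A.map Bel.step) (B.map Bel.step) x.step c
            (fun l => (v l).step) hstep hc
        · simpa [place_of_ne hi] using ih (A.map Bel.step) (B.map Bel.step ++ [m.row i]) x.step c
            (fun l => (v l).step) hstep hc
      simp_rw [key, Finset.mul_sum]
      rw [Finset.sum_comm]
      refine Finset.sum_congr rfl fun l _ => Finset.sum_congr rfl fun i _ => by ring

/-- Conditions on the hidden current state of an unsensed channel: its belief one step later is a
mixture of rows of `P`. -/
theorem W_step (t : ℕ) (A B : List m.Bel) (x : m.Bel) :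
    W t (A ++ x.step :: B) = ∑ l, x.1 l * W t (A ++ m.row l :: B) :=
  W_affine t A B x.step x.1 m.row (fun _ => rfl) x.sum

theorem W_step_cons (t : ℕ) (B : List m.Bel) (x : m.Bel) :
    W t (x.step :: B) = ∑ l, x.1 l * W t (m.row l :: B) :=
  W_step t [] B x

theorem W_place_step (t : ℕ) (i : Fin (k + 2)) (A B : List m.Bel) (x : m.Bel) :
    W t (place i (A ++ x.step :: B)) = ∑ l, x.1 l * W t (place i (A ++ m.row l :: B)) := by
  by_cases hi : i = Fin.last (k + 1)
  · subst hi
    simpa using W_step t (m.best :: A) B x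
  · simpa [place_of_ne hi] using W_step t A (B ++ [m.row i]) x

/-- Expansion of the first step, with the top channel always moved to the end of the list up to a
correction when it was observed in the best state. -/
theorem W_succ_eq (t : ℕ) (x : m.Bel) (Z : List m.Bel) : W (t + 1) (x :: Z)
    = x.1 ⬝ᵥ m.R + m.β * W t (Z.map Bel.step ++ [x.step])
      + m.β * x.1 (Fin.last (k + 1)) * (W t (m.best :: Z.map Bel.step)
        - W t (Z.map Bel.step ++ [m.best])) := by
  rw [W_succ, W_step, add_assoc]
  congr 1
  have : ∀ i, x.1 i * W t (place i (Z.map Bel.step))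
      = x.1 i * W t (Z.map Bel.step ++ [m.row i]) + if i = Fin.last (k + 1) then
        x.1 i * (W t (m.best :: Z.map Bel.step) - W t (Z.map Bel.step ++ [m.best])) else 0 := by
    intro i
    by_cases hi : i = Fin.last (k + 1)
    · subst hi
      simp
      ring
    · simp [place_of_ne hi, hi]
  simp_rw [this, Finset.sum_add_distrib, Finset.sum_ite_eq', Finset.mem_univ, if_true]
  ring

theorem W_succ_append (t : ℕ) (a : m.Bel) (A : List m.Bel) (x : m.Bel) (B : List m.Bel) :
    W (t + 1) (a :: (A ++ x :: B)) = a.1 ⬝ᵥ m.R + m.β * ∑ i, a.1 i *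
      W t (place i (A.map Bel.step ++ x.step :: B.map Bel.step)) := by
  rw [W_succ]
  simp

end SensingModel
end ChannelSensing
end

/-! ### The exchange inequalities, and the inductive steps for `top_end` and `rotate`. -/

noncomputable section

namespace ChannelSensing
namespace SensingModel

variable {k : ℕ} {m : SensingModel k}

theorem Bel.sum_mul_sub_le (a : m.Bel) {f₁ f₂ g₁ g₂ : Fin (k + 2) → ℝ}
    (H : ∀ i, f₁ i - f₂ i ≤ g₁ i - g₂ i) :
    ∑ i, a.1 i * f₁ i - ∑ i, a.1 i * f₂ i ≤ ∑ i, a.1 i * g₁ i - ∑ i, a.1 i * g₂ i := by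
  rw [← Finset.sum_sub_distrib, ← Finset.sum_sub_distrib]
  refine Finset.sum_le_sum fun i _ => ?_
  rw [← mul_sub, ← mul_sub]
  exact mul_le_mul_of_nonneg_left (H i) (a.nonneg i)

theorem Bel.sum_sum_mul_sub_le (a b : m.Bel) {f₁ f₂ g₁ g₂ : Fin (k + 2) → Fin (k + 2) → ℝ}
    (H : ∀ i l, f₁ i l - f₂ i l ≤ g₁ i l - g₂ i l) :
    ∑ i, a.1 i * ∑ l, b.1 l * f₁ i l - ∑ i, a.1 i * ∑ l, b.1 l * f₂ i l
      ≤ ∑ i, a.1 i * ∑ l, b.1 l * g₁ i l - ∑ i, a.1 i * ∑ l, b.1 l * g₂ i l :=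
  a.sum_mul_sub_le fun i => b.sum_mul_sub_le fun l => H i l

theorem sum_sum_mul_comm (a b : m.Bel) (f : Fin (k + 2) → Fin (k + 2) → ℝ) :
    ∑ i, a.1 i * ∑ l, b.1 l * f i l = ∑ l, b.1 l * ∑ i, a.1 i * f i l := by
  simp_rw [Finset.mul_sum]
  rw [Finset.sum_comm]
  exact Finset.sum_congr rfl fun l _ => Finset.sum_congr rfl fun i _ => by ring

theorem Bel.sum_mul_const (a : m.Bel) (c : ℝ) : ∑ i, a.1 i * c = c := by
  rw [← Finset.sum_mul, a.sum, one_mul]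

theorem W_succ_cons_cons (t : ℕ) (q b : m.Bel) (Z : List m.Bel) : W (t + 1) (q :: b :: Z)
    = q.1 ⬝ᵥ m.R + m.β * ∑ l, q.1 l * ∑ i, b.1 i *
      W t (place l (m.row i :: Z.map Bel.step)) := by
  rw [W_succ]
  congr 2
  refine Finset.sum_congr rfl fun l _ => ?_
  rw [List.map_cons]
  congr 1
  exact W_place_step t l [] (Z.map Bel.step) b

theorem W_succ_append' (t : ℕ) (b : m.Bel) (Z : List m.Bel) (q : m.Bel) (B : List m.Bel) :
    W (t + 1) (b :: (Z ++ q :: B)) = b.1 ⬝ᵥ m.R + m.β * ∑ i, b.1 i * ∑ l, q.1 l *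
      W t (place i (Z.map Bel.step ++ m.row l :: B.map Bel.step)) := by
  rw [W_succ_append]
  simp_rw [W_place_step]

theorem W_succ_dot (t : ℕ) (y : m.Bel) (Z : List m.Bel) : W (t + 1) (y :: Z)
    = y.1 ⬝ᵥ fun j => m.R j + m.β * W t (place j (Z.map Bel.step)) := by
  rw [W_succ]
  simp only [dotProduct, mul_add, Finset.sum_add_distrib, Finset.mul_sum]
  congr 1
  exact Finset.sum_congr rfl fun _ _ => by ring

theorem W_succ_append_dot (t : ℕ) (b : m.Bel) (Z : List m.Bel) (q : m.Bel) (B : List m.Bel) :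
    W (t + 1) (b :: (Z ++ q :: B)) = b.1 ⬝ᵥ m.R + q.1 ⬝ᵥ fun l => m.β * ∑ i, b.1 i *
      W t (place i (Z.map Bel.step ++ m.row l :: B.map Bel.step)) := by
  rw [W_succ_append', sum_sum_mul_comm]
  congr 1
  simp only [dotProduct, Finset.mul_sum]
  exact Finset.sum_congr rfl fun _ _ => Finset.sum_congr rfl fun _ _ => by ring

/-- The exchange inequalities for the round-robin policy over `t` steps. In each of them a belief
`x` is replaced by a belief `y` that dominates it, at two different places. -/
structure Exchange (m : SensingModel k) (t : ℕ) : Prop where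
  /-- an improvement is worth more nearer to the top -/
  swap : ∀ (A B : List m.Bel) (p x y : m.Bel), x.Le y →
    W t (A ++ p :: y :: B) - W t (A ++ p :: x :: B)
      ≤ W t (A ++ y :: p :: B) - W t (A ++ x :: p :: B)
  /-- an improvement is worth more after the top channel is moved to the end -/
  rotate : ∀ (q : m.Bel) (B A : List m.Bel) (x y : m.Bel), x.Le y →
    W t (q :: (B ++ y :: A)) - W t (q :: (B ++ x :: A))
      ≤ W t (B ++ y :: (A ++ [q])) - W t (B ++ x :: (A ++ [q]))
  -- An improvement at the top exceeds the same improvement at the end by at most the immediate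
  -- reward and the bonus, that is, the increment of `U`.
  top_end : ∀ (Z : List m.Bel) (x y : m.Bel), x.Le y →
    W t (y :: Z) - W t (x :: Z) - (W t (Z ++ [y]) - W t (Z ++ [x]))
      ≤ y.1 ⬝ᵥ m.U - x.1 ⬝ᵥ m.U
  -- Bounds the loss from sensing `x` now instead of at its place in the list. For `x = P_{K-1}`,
  -- the discounted bound is the separation `gap_last`.
  lift : ∀ (Y B : List m.Bel) (x : m.Bel),
    W t (Y ++ x :: B) - W t (x :: (Y ++ B)) ≤ m.h - x.1 ⬝ᵥ m.R
  -- Behind `P_K` the bound can be uniform in `x`: by the time `x` is sensed it has evolved into a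
  -- belief above `P_{K-1}`.
  lift_best : ∀ (Y B : List m.Bel) (x : m.Bel),
    W t (m.best :: (Y ++ x :: B)) - W t (m.best :: x :: (Y ++ B)) ≤ m.h - m.second.1 ⬝ᵥ m.R
  best_end : ∀ (Z : List m.Bel) (x y : m.Bel), x.Le y →
    W t (m.best :: y :: Z) - W t (m.best :: x :: Z)
      - (W t (m.best :: (Z ++ [y])) - W t (m.best :: (Z ++ [x]))) ≤ y.1 ⬝ᵥ m.U - x.1 ⬝ᵥ m.U
  -- The right-hand side is the increment of the expectation of the vector `M`.
  exchange_le : ∀ (X : List m.Bel) (a x y : m.Bel), x.Le y →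
    W t (y :: (X ++ [a])) - W t (x :: (X ++ [a])) - (W t (a :: (X ++ [y])) - W t (a :: (X ++ [x])))
      ≤ y.1 ⬝ᵥ m.U - x.1 ⬝ᵥ m.U
        + m.β * m.best.1 (Fin.last (k + 1)) * (y.step.1 ⬝ᵥ m.U - x.step.1 ⬝ᵥ m.U)
  le_exchange : ∀ (X : List m.Bel) (a x y : m.Bel), x.Le y →
    W t (a :: (X ++ [y])) - W t (a :: (X ++ [x])) ≤ W t (y :: (X ++ [a])) - W t (x :: (X ++ [a]))
  swap_le : ∀ (A B : List m.Bel) (p x y : m.Bel), x.Le y →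
    W t (A ++ y :: p :: B) - W t (A ++ x :: p :: B)
      - (W t (A ++ p :: y :: B) - W t (A ++ p :: x :: B)) ≤ y.1 ⬝ᵥ m.U - x.1 ⬝ᵥ m.U

namespace Exchange

variable {t : ℕ}

theorem W_swap (c : Exchange m t) (A B : List m.Bel) {x y : m.Bel} (h : x.Le y) :
    W t (A ++ x :: y :: B) ≤ W t (A ++ y :: x :: B) := by
  -- With the neighbour `p` equal to `x` itself, the two subtracted terms coincide.
  linarith [c.swap A B x x y h]

theorem move_down (c : Exchange m t) {x : m.Bel} (B Z : List m.Bel) :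
    ∀ (A : List m.Bel), (∀ z ∈ Z, x.Le z) → W t (A ++ x :: (Z ++ B)) ≤ W t (A ++ (Z ++ x :: B)) := by
  induction Z with
  | nil => intro A _; exact le_rfl
  | cons z Z ih =>
    intro A h
    have h1 := c.W_swap A (Z ++ B) (h z (by simp))
    have h2 := ih (A ++ [z]) (fun z' hz' => h z' (by simp [hz']))
    simp only [List.cons_append, List.append_assoc, List.nil_append] at h1 h2 ⊢
    exact h1.trans h2

theorem move_up (c : Exchange m t) {y : m.Bel} (B Z : List m.Bel) :
    ∀ (A : List m.Bel), (∀ z ∈ Z, z.Le y) → W t (A ++ (Z ++ y :: B)) ≤ W t (A ++ y :: (Z ++ B)) := by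
  induction Z with
  | nil => intro A _; exact le_rfl
  | cons z Z ih =>
    intro A h
    have h1 := c.W_swap A (Z ++ B) (h z (by simp))
    have h2 := ih (A ++ [z]) (fun z' hz' => h z' (by simp [hz']))
    simp only [List.cons_append, List.append_assoc, List.nil_append] at h1 h2 ⊢
    exact h2.trans h1

theorem row_down (c : Exchange m t) {i : Fin (k + 2)} (hi : i ≠ Fin.last (k + 1))
    (A Z B : List m.Bel) : W t (A ++ m.row i :: (Z.map Bel.step ++ B))
      ≤ W t (A ++ (Z.map Bel.step ++ m.row i :: B)) := by
  refine c.move_down B _ A fun z hz => ?_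
  obtain ⟨z', _, rfl⟩ := List.mem_map.mp hz
  exact row_le_step hi z'

theorem best_up (c : Exchange m t) (A Z B : List m.Bel) :
    W t (A ++ (Z ++ m.best :: B)) ≤ W t (A ++ m.best :: (Z ++ B)) :=
  c.move_up B _ A fun z _ => z.le_best

/-- Iterates `rotate`: a whole block in front can be moved to the end. -/
theorem rotate_list (c : Exchange m t) {x y : m.Bel} (h : x.Le y) (B Q : List m.Bel) :
    ∀ A : List m.Bel, W t (Q ++ (B ++ y :: A)) - W t (Q ++ (B ++ x :: A))
      ≤ W t (B ++ y :: (A ++ Q)) - W t (B ++ x :: (A ++ Q)) := by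
  induction Q with
  | nil => simp
  | cons q Q ih =>
    intro A
    have h1 := c.rotate q (Q ++ B) A x y h
    have h2 := ih (A ++ [q])
    simp only [List.cons_append, List.append_assoc, List.nil_append] at h1 h2 ⊢
    exact h1.trans h2

/-- Compare `P_K` with `P_{K-1}` through `top_end`; for `P_{K-1}` itself the end is at least as good
as the top, since all stepped beliefs dominate it. -/
theorem best_sub_le (c : Exchange m t) (Z : List m.Bel) :
    W t (m.best :: Z.map Bel.step) - W t (Z.map Bel.step ++ [m.best]) ≤ m.gainU := by
  have h1 := c.top_end (Z.map Bel.step) m.second m.best m.second.le_best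
  have h2 := c.row_down (Fin.castSucc_lt_last (Fin.last k)).ne [] Z []
  simp only [List.nil_append, List.append_nil] at h2
  rw [gainU]
  linarith

/-- If `l` is the best state, nothing moves; otherwise this is `rotate`. -/
theorem rotate_place (c : Exchange m t) {x y : m.Bel} (h : x.Le y) (l : Fin (k + 2))
    (B A : List m.Bel) :
    W t (m.row l :: (B ++ y :: A)) - W t (m.row l :: (B ++ x :: A))
      ≤ W t (place l (B ++ y :: A)) - W t (place l (B ++ x :: A)) := by
  by_cases hl : l = Fin.last (k + 1)
  · subst hl
    simp
  · have := c.rotate (m.row l) B A x y h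
    simpa [place_of_ne hl] using this

theorem rotate_place_place (c : Exchange m t) {x y : m.Bel} (h : x.Le y) (l i : Fin (k + 2))
    (B A : List m.Bel) :
    W t (place l (m.row i :: (B ++ y :: A))) - W t (place l (m.row i :: (B ++ x :: A)))
      ≤ W t (place i (B ++ y :: (A ++ [m.row l]))) - W t (place i (B ++ x :: (A ++ [m.row l]))) := by
  by_cases hl : l = Fin.last (k + 1)
  · subst hl
    have h1 := c.rotate m.best (m.row i :: B) A x y h
    have h2 := c.rotate_place h i B (A ++ [m.best])
    simp only [place_last, List.cons_append] at h1 h2 ⊢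
    exact h1.trans h2
  · have h2 := c.rotate_place h i B (A ++ [m.row l])
    simpa [place_of_ne hl] using h2

/-- The top channel earns its reward and, when seen in state `K`, stays on top, worth at most
`gainU` more than going to the end: together the increment of `U`. What remains compares an
improvement at the end before and after the next channel `z` is placed, which is `rotate_place`. -/
theorem succ_top_end (c : Exchange m t) (Z : List m.Bel) (x y : m.Bel) (h : x.Le y) :
    W (t + 1) (y :: Z) - W (t + 1) (x :: Z) - (W (t + 1) (Z ++ [y]) - W (t + 1) (Z ++ [x]))
      ≤ y.1 ⬝ᵥ m.U - x.1 ⬝ᵥ m.U := by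
  cases Z with
  | nil => simpa using h.U_le
  | cons z Z =>
    have h1 := mul_le_mul_of_nonneg_left (c.best_sub_le (z :: Z)) m.β_pos.le
    have h2 := mul_le_mul_of_nonneg_left h1 (sub_nonneg.mpr h.apply_last)
    have h3 : W t (z.step :: (Z.map Bel.step ++ [y.step]))
        - W t (z.step :: (Z.map Bel.step ++ [x.step]))
        ≤ ∑ i, z.1 i * W t (place i (Z.map Bel.step ++ [y.step]))
          - ∑ i, z.1 i * W t (place i (Z.map Bel.step ++ [x.step])) := by
      rw [W_step_cons, W_step_cons]
      exact z.sum_mul_sub_le fun i => c.rotate_place h.step i _ []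
    have h4 := mul_le_mul_of_nonneg_left h3 m.β_pos.le
    rw [W_succ_eq, W_succ_eq, dotProduct_U, dotProduct_U, List.cons_append, List.cons_append,
      W_succ_append, W_succ_append]
    simp only [List.map_cons, List.cons_append, List.map_nil] at h1 h2 h4 ⊢
    linarith

/-- If some `b` is sensed before the improved channel, conditioning on the states of `q` and `b`
reduces the claim to `rotate_place_place`. If the improved channel comes right after `q`, the `A4`
separations are needed. -/
theorem succ_rotate (c : Exchange m t) (q : m.Bel) (B A : List m.Bel) (x y : m.Bel)
    (h : x.Le y) :
    W (t + 1) (q :: (B ++ y :: A)) - W (t + 1) (q :: (B ++ x :: A))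
      ≤ W (t + 1) (B ++ y :: (A ++ [q])) - W (t + 1) (B ++ x :: (A ++ [q])) := by
  cases B with
  | cons b B =>
    have key := q.sum_sum_mul_sub_le b fun l i =>
      c.rotate_place_place h.step l i (B.map Bel.step) (A.map Bel.step)
    have e : ∀ z : m.Bel, W (t + 1) (b :: (B ++ z :: (A ++ [q])))
        = b.1 ⬝ᵥ m.R + m.β * ∑ l, q.1 l * ∑ i, b.1 i *
          W t (place i (B.map Bel.step ++ z.step :: (A.map Bel.step ++ [m.row l]))) := by
      intro z
      have := W_succ_append' t b (B ++ z :: A) q []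
      rw [sum_sum_mul_comm] at this
      simpa using this
    have e2 : ∀ z : m.Bel, W (t + 1) (q :: b :: (B ++ z :: A))
        = q.1 ⬝ᵥ m.R + m.β * ∑ l, q.1 l * ∑ i, b.1 i *
          W t (place l (m.row i :: (B.map Bel.step ++ z.step :: A.map Bel.step))) := by
      intro z
      simp [W_succ_cons_cons]
    simp only [List.cons_append]
    rw [e, e, e2, e2]
    have := mul_le_mul_of_nonneg_left key m.β_pos.le
    linarith
  | nil =>
    simp only [List.nil_append]
    -- The other channels one step later, with `q` at the end and its state averaged out.
    set Z := A.map Bel.step ++ [q.step] with hZ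
    have hZ' : Z = (A ++ [q]).map Bel.step := by simp [hZ]
    have h1 : W (t + 1) (q :: y :: A) - W (t + 1) (q :: x :: A)
        ≤ m.β * (W t (y.step :: Z) - W t (x.step :: Z)) := by
      have e : ∀ z : m.Bel, W t (z.step :: Z)
          = ∑ l, q.1 l * W t (z.step :: (A.map Bel.step ++ [m.row l])) := fun z => by
        simpa using W_step t (z.step :: A.map Bel.step) [] q
      have := q.sum_mul_sub_le (f₁ := fun l => W t (place l (y.step :: A.map Bel.step)))
        (f₂ := fun l => W t (place l (x.step :: A.map Bel.step)))
        (g₁ := fun l => W t (y.step :: (A.map Bel.step ++ [m.row l])))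
        (g₂ := fun l => W t (x.step :: (A.map Bel.step ++ [m.row l]))) (fun l => by
          by_cases hl : l = Fin.last (k + 1)
          · subst hl
            simpa using c.rotate m.best [] (A.map Bel.step) _ _ h.step
          · simp [place_of_ne hl])
      rw [e, e, W_succ, W_succ]
      have := mul_le_mul_of_nonneg_left this m.β_pos.le
      simp only [List.map_cons]
      linarith
    -- The gain from having `v` on top instead of at the end. It is affine in `v`, so it suffices to
    -- bound its discounted increments along the rows: by `top_end` below the top pair, by `lift`
    -- and `gap_last` for `(K-1, K)`.
    set r : m.Bel → ℝ := fun v => W t (v :: Z) - W t (Z ++ [v]) with hr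
    have hrs : ∀ z : m.Bel, r z.step = z.1 ⬝ᵥ fun j => r (m.row j) := by
      intro z
      simp only [hr, dotProduct, mul_sub, Finset.sum_sub_distrib]
      rw [W_step_cons, W_step]
    have h2 : m.β * (r y.step - r x.step) ≤ y.1 ⬝ᵥ m.R - x.1 ⬝ᵥ m.R
        + m.β * (y.1 (Fin.last (k + 1)) - x.1 (Fin.last (k + 1))) * r m.best := by
      have := h.dotProduct_sub_le (f := m.β • fun j => r (m.row j))
        (g := m.R + Pi.single (Fin.last (k + 1)) (m.β * r m.best)) (by
          intro i
          simp only [Pi.smul_apply, Pi.add_apply, smul_eq_mul]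
          by_cases hi : i = Fin.last k
          · subst hi
            have h5 := c.lift Z [] m.second
            simp only [List.append_nil] at h5
            have h6 := mul_le_mul_of_nonneg_left h5 m.β_pos.le
            have h7 := m.gap_last
            rw [Fin.succ_last, Pi.single_eq_same,
              Pi.single_eq_of_ne (Fin.castSucc_lt_last (Fin.last k)).ne]
            have h8 : m.second.1 ⬝ᵥ m.R = m.P (Fin.last k).castSucc ⬝ᵥ m.R := rfl
            have h9 : r m.second = W t (m.second :: Z) - W t (Z ++ [m.second]) := rfl
            rw [h8] at h6
            have : m.β * r m.second = m.β * r (m.row (Fin.last k).castSucc) := rfl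
            rw [← this, h9]
            linarith
          · have h2 : i.succ ≠ Fin.last (k + 1) := by
              simpa [← Fin.succ_last] using hi
            rw [Pi.single_eq_of_ne h2, Pi.single_eq_of_ne (Fin.castSucc_lt_last i).ne]
            have h5 := c.top_end Z _ _ (row_castSucc_le_succ i)
            have h6 := mul_le_mul_of_nonneg_left h5 m.β_pos.le
            have h7 := row_gap_U (m := m) i hi
            simp only [hr]
            linarith)
      rw [dotProduct_smul, dotProduct_smul, dotProduct_add, dotProduct_add, dotProduct_single,
        dotProduct_single, ← hrs, ← hrs, smul_eq_mul, smul_eq_mul] at this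
      linarith
    rw [W_succ_eq t y, W_succ_eq t x, ← hZ']
    have h3 : r m.best = W t (m.best :: Z) - W t (Z ++ [m.best]) := rfl
    have h4 : r y.step = W t (y.step :: Z) - W t (Z ++ [y.step]) := rfl
    have h5 : r x.step = W t (x.step :: Z) - W t (Z ++ [x.step]) := rfl
    rw [← h3]
    rw [h4, h5] at h2
    linarith

end Exchange
end SensingModel
end ChannelSensing
end

/-! ### The remaining inductive steps of the exchange inequalities. -/

noncomputable section

namespace ChannelSensing
namespace SensingModel

variable {k : ℕ} {m : SensingModel k}

theorem W_succ_cons (t : ℕ) (a x : m.Bel) (B : List m.Bel) :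
    W (t + 1) (a :: x :: B) = a.1 ⬝ᵥ m.R + m.β * ∑ i, a.1 i *
      W t (place i (x.step :: B.map Bel.step)) := by
  rw [W_succ, List.map_cons]

theorem Bel.sum_mul_le (a : m.Bel) {f g : Fin (k + 2) → ℝ} (H : ∀ i, f i ≤ g i) :
    ∑ i, a.1 i * f i ≤ ∑ i, a.1 i * g i :=
  Finset.sum_le_sum fun i _ => mul_le_mul_of_nonneg_left (H i) (a.nonneg i)

theorem succ_ne_last {i : Fin (k + 1)} (hi : i ≠ Fin.last k) : i.succ ≠ Fin.last (k + 1) := by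
  simpa [← Fin.succ_last] using hi

theorem place_succ {i : Fin (k + 1)} (hi : i ≠ Fin.last k) (Z : List m.Bel) :
    place i.succ Z = Z ++ [m.row i.succ] := place_of_ne (succ_ne_last hi) Z

theorem second_R_le_h : m.second.1 ⬝ᵥ m.R ≤ m.h := m.second.R_le_h

/-- The immediate reward plus the discounted bound on what is lost by a state below the best. -/
theorem Bel.R_add_le_h (y : m.Bel) : y.1 ⬝ᵥ m.R + m.β * ∑ i, y.1 i *
    (if i = Fin.last (k + 1) then 0 else m.h - (m.row i).1 ⬝ᵥ m.R) ≤ m.h := by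
  have e : ∀ z : m.Bel, z.1 ⬝ᵥ m.R + m.β * ∑ i, z.1 i *
      (if i = Fin.last (k + 1) then 0 else m.h - (m.row i).1 ⬝ᵥ m.R)
      = z.1 ⬝ᵥ (m.R + m.β • fun i => if i = Fin.last (k + 1) then 0
        else m.h - (m.row i).1 ⬝ᵥ m.R) := by
    intro z
    rw [dotProduct_add, dotProduct_smul, smul_eq_mul]
    rfl
  -- The defining equation of `h` is equality at `P_K`. The left-hand side is the expectation of a
  -- nondecreasing function of the state, so `P_K` is extremal.
  have hbest : m.best.1 ⬝ᵥ m.R + m.β * ∑ i, m.best.1 i *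
      (if i = Fin.last (k + 1) then 0 else m.h - (m.row i).1 ⬝ᵥ m.R) = m.h := m.h_eq.symm
  refine le_trans ?_ hbest.le
  rw [e, e]
  refine y.le_best.dotProduct_le (f := m.R + m.β • fun i => if i = Fin.last (k + 1) then 0
        else m.h - (m.row i).1 ⬝ᵥ m.R) (by
    intro i
    have hi' := (Fin.castSucc_lt_last i).ne
    simp only [Pi.add_apply, Pi.smul_apply, smul_eq_mul, if_neg hi']
    by_cases hi : i = Fin.last k
    · subst hi
      rw [Fin.succ_last, if_pos rfl]
      have h1 := m.gap_last
      have h2 : (m.row (Fin.last k).castSucc).1 ⬝ᵥ m.R = m.P (Fin.last k).castSucc ⬝ᵥ m.R := rfl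
      rw [h2]
      linarith
    · rw [if_neg (succ_ne_last hi)]
      have h1 := row_gap_R (m := m) i hi
      linarith)

namespace Exchange

variable {t : ℕ}

/-- `i` is the state of the channel sensed first in the original order, `l` that of the lifted one.
If `i` is the best state, the original order only has `P_K` lower or a bad row higher than it should
be, so nothing is lost. Otherwise that channel went to the end in one list and not in the other, and
`lift` or `lift_best` bounds the effect. -/
theorem lift_term (c : Exchange m t) (Y B : List m.Bel) (i l : Fin (k + 2)) :
    W t (place i (Y.map Bel.step ++ m.row l :: B.map Bel.step))
      - W t (place l (m.row i :: (Y.map Bel.step ++ B.map Bel.step)))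
      ≤ if i = Fin.last (k + 1) then 0 else m.h - (m.row i).1 ⬝ᵥ m.R := by
  by_cases hi : i = Fin.last (k + 1)
  · subst hi
    rw [if_pos rfl, sub_nonpos, place_last]
    by_cases hl : l = Fin.last (k + 1)
    · subst hl
      rw [place_last]
      exact c.best_up [m.best] _ _
    · have := c.row_down hl (m.best :: Y.map Bel.step) B []
      simpa [place_of_ne hl] using this
  · rw [if_neg hi, place_of_ne hi]
    by_cases hl : l = Fin.last (k + 1)
    · subst hl
      have h1 := c.best_up [] (Y.map Bel.step) (B.map Bel.step ++ [m.row i])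
      have h2 := c.lift_best (Y.map Bel.step ++ B.map Bel.step) [] (m.row i)
      have h3 := (row_le_second (m := m) hi).R_le
      simp only [List.nil_append, List.append_nil, List.append_assoc, place_last,
        List.cons_append] at h1 h2 ⊢
      linarith
    · have h1 := c.lift (Y.map Bel.step ++ m.row l :: B.map Bel.step) [] (m.row i)
      have h2 := c.row_down hl (m.row i :: Y.map Bel.step) B []
      simp only [List.append_nil, List.append_assoc, place_of_ne hl,
        List.cons_append] at h1 h2 ⊢
      linarith

/-- One step costs `yR - xR` plus the discounted average of the bounds in `lift_term`; `R_add_le_h`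
closes the recursion. -/
theorem succ_lift (c : Exchange m t) (Y B : List m.Bel) (x : m.Bel) :
    W (t + 1) (Y ++ x :: B) - W (t + 1) (x :: (Y ++ B)) ≤ m.h - x.1 ⬝ᵥ m.R := by
  cases Y with
  | nil => simpa using x.R_le_h
  | cons y Y =>
    have h1 := y.sum_sum_mul_sub_le x (g₁ := fun i _ => if i = Fin.last (k + 1) then 0
      else m.h - (m.row i).1 ⬝ᵥ m.R) (g₂ := fun _ _ => 0)
      fun i l => by simpa only [sub_zero] using c.lift_term Y B i l
    simp only [x.sum_mul_const, mul_zero, Finset.sum_const_zero, sub_zero] at h1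
    have h2 := y.R_add_le_h
    have h3 := mul_le_mul_of_nonneg_left h1 m.β_pos.le
    simp only [List.cons_append]
    rw [W_succ_append', W_succ_cons_cons, sum_sum_mul_comm x y, List.map_append]
    linarith

/-- Both lists sense `P_K` first, so only the discounted future differs. -/
theorem succ_lift_best (c : Exchange m t) (Y B : List m.Bel) (x : m.Bel) :
    W (t + 1) (m.best :: (Y ++ x :: B)) - W (t + 1) (m.best :: x :: (Y ++ B))
      ≤ m.h - m.second.1 ⬝ᵥ m.R := by
  have h1 := m.best.sum_mul_sub_le
    (f₁ := fun i => W t (place i (Y.map Bel.step ++ x.step :: B.map Bel.step)))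
    (f₂ := fun i => W t (place i (x.step :: (Y ++ B).map Bel.step)))
    (g₁ := fun _ => m.h - m.second.1 ⬝ᵥ m.R) (g₂ := fun _ => 0) fun i => by
      rw [sub_zero, List.map_append]
      by_cases hi : i = Fin.last (k + 1)
      · subst hi
        simpa using c.lift_best (Y.map Bel.step) (B.map Bel.step) x.step
      · have h2 := c.lift (Y.map Bel.step) (B.map Bel.step ++ [m.row i]) x.step
        have h3 := x.second_le_step.R_le
        simp only [place_of_ne hi, List.append_assoc, List.cons_append] at h2 ⊢
        linarith
  simp only [m.best.sum_mul_const, sub_zero] at h1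
  rw [W_succ_append, W_succ_cons]
  have h2 := mul_le_mul_of_nonneg_left h1 m.β_pos.le
  have h3 := second_R_le_h (m := m)
  nlinarith [m.β_lt]

theorem succ_best_end (c : Exchange m t) (Z : List m.Bel) (x y : m.Bel) (h : x.Le y) :
    W (t + 1) (m.best :: y :: Z) - W (t + 1) (m.best :: x :: Z)
      - (W (t + 1) (m.best :: (Z ++ [y])) - W (t + 1) (m.best :: (Z ++ [x])))
      ≤ y.1 ⬝ᵥ m.U - x.1 ⬝ᵥ m.U := by
  set G := y.step.1 ⬝ᵥ m.U - x.step.1 ⬝ᵥ m.U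
  have h1 := m.best.sum_mul_sub_le
    (f₁ := fun i => W t (place i (y.step :: Z.map Bel.step))
      - W t (place i (x.step :: Z.map Bel.step)))
    (f₂ := fun i => W t (place i (Z.map Bel.step ++ [y.step]))
      - W t (place i (Z.map Bel.step ++ [x.step])))
    (g₁ := fun _ => G) (g₂ := fun _ => 0) fun i => by
      rw [sub_zero]
      by_cases hi : i = Fin.last (k + 1)
      · subst hi
        simpa using c.best_end (Z.map Bel.step) _ _ h.step
      · have h2 := c.top_end (Z.map Bel.step ++ [m.row i]) _ _ h.step
        have h3 := c.swap (Z.map Bel.step) [] (m.row i) _ _ h.step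
        simp only [place_of_ne hi, List.append_assoc, List.cons_append, List.nil_append] at h2 h3 ⊢
        linarith
  simp only [m.best.sum_mul_const, sub_zero, mul_zero, Finset.sum_const_zero, mul_sub,
    Finset.sum_sub_distrib] at h1
  have h2 := mul_le_mul_of_nonneg_left h1 m.β_pos.le
  have h3 := h.step_U
  rw [W_succ_append, W_succ_append, W_succ_cons, W_succ_cons]
  simp only [List.map_nil]
  linarith

/-- The first step with `x` or `y` on top gives the `U`-increment. The rest differs only if `a` is
found in the best state, where `best_end` bounds the excess by the `U`-increment one step later;
this has probability at most `p_KK`. -/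
theorem succ_exchange_le (c : Exchange m t) (X : List m.Bel) (a x y : m.Bel) (h : x.Le y) :
    W (t + 1) (y :: (X ++ [a])) - W (t + 1) (x :: (X ++ [a]))
      - (W (t + 1) (a :: (X ++ [y])) - W (t + 1) (a :: (X ++ [x])))
      ≤ y.1 ⬝ᵥ m.U - x.1 ⬝ᵥ m.U
        + m.β * m.best.1 (Fin.last (k + 1)) * (y.step.1 ⬝ᵥ m.U - x.step.1 ⬝ᵥ m.U) := by
  set G := y.step.1 ⬝ᵥ m.U - x.step.1 ⬝ᵥ m.U with hG
  have hG0 : 0 ≤ G := sub_nonneg.mpr h.step.U_le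
  have h1 := mul_le_mul_of_nonneg_left (c.best_sub_le (X ++ [a])) m.β_pos.le
  have h2 := mul_le_mul_of_nonneg_left h1 (sub_nonneg.mpr h.apply_last)
  have h3 := a.sum_mul_sub_le
    (f₁ := fun i => W t (X.map Bel.step ++ m.row i :: [y.step])
      - W t (X.map Bel.step ++ m.row i :: [x.step]))
    (f₂ := fun i => W t (place i (X.map Bel.step ++ [y.step]))
      - W t (place i (X.map Bel.step ++ [x.step])))
    (g₁ := fun i => if i = Fin.last (k + 1) then G else 0) (g₂ := fun _ => 0) fun i => by
      rw [sub_zero]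
      by_cases hi : i = Fin.last (k + 1)
      · subst hi
        rw [if_pos rfl]
        have h4 := c.rotate_list h.step [m.best] (X.map Bel.step) []
        have h5 := c.best_end (X.map Bel.step) _ _ h.step
        simp only [place_last, List.cons_append, List.nil_append] at h4 h5 ⊢
        linarith
      · rw [if_neg hi]
        have h4 := c.swap (X.map Bel.step) [] (m.row i) _ _ h.step
        simp only [place_of_ne hi, List.append_assoc, List.cons_append, List.nil_append] at h4 ⊢
        linarith
  simp only [sub_zero, mul_zero, Finset.sum_const_zero, mul_sub, mul_ite,
    Finset.sum_sub_distrib, Finset.sum_ite_eq', Finset.mem_univ, if_true] at h3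
  have h4 := mul_le_mul_of_nonneg_left h3 m.β_pos.le
  have h5 := mul_le_mul_of_nonneg_left
    (mul_le_mul_of_nonneg_right a.le_best.apply_last hG0) m.β_pos.le
  have e : ∀ z : m.Bel, W t (X.map Bel.step ++ [a.step] ++ [z.step])
      = ∑ i, a.1 i * W t (X.map Bel.step ++ m.row i :: [z.step]) := by
    intro z
    rw [List.append_assoc, List.cons_append, List.nil_append, W_step]
  rw [W_succ_eq, W_succ_eq, W_succ_append, W_succ_append, dotProduct_U, dotProduct_U]
  simp only [List.map_append, List.map_cons, List.map_nil] at h1 h2 ⊢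
  rw [e, e]
  linarith

/-- The heart of the induction. Both sides are expectations of functions `f`, `g` of the state of
the improved channel, so only increments between consecutive states matter. Below the pair `(K-1,
K)` the future loss is at most an increment of `M` (`best_end`, `exchange_le`); for that pair it is
at most `h - P_{K-1} R` (`lift_best`, `le_exchange`). Discounted, these are exactly the reward
separations assumed in `A4`. -/
theorem succ_swap_zero (c : Exchange m t) (B : List m.Bel) (p x y : m.Bel) (h : x.Le y) :
    W (t + 1) (p :: y :: B) - W (t + 1) (p :: x :: B)
      ≤ W (t + 1) (y :: p :: B) - W (t + 1) (x :: p :: B) := by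
  set f : Fin (k + 2) → ℝ := fun l => m.β * ∑ i, p.1 i *
      W t (place i (m.row l :: B.map Bel.step)) with hf
  set g : Fin (k + 2) → ℝ := fun l => m.R l + m.β * ∑ i, p.1 i *
      W t (place l (m.row i :: B.map Bel.step)) with hg
  have e1 : ∀ z : m.Bel, W (t + 1) (p :: z :: B) = p.1 ⬝ᵥ m.R + z.1 ⬝ᵥ f := fun z => by
    simpa using W_succ_append_dot t p [] z B
  have e2 : ∀ z : m.Bel, W (t + 1) (z :: p :: B) = z.1 ⬝ᵥ g := fun z => by
    rw [W_succ_dot]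
    congr 1
    funext l
    rw [hg]
    simp only [List.map_cons]
    congr 2
    exact W_place_step t l [] _ p
  rw [e1, e1, e2, e2]
  have := h.dotProduct_sub_le (f := f) (g := g) (fun j => by
    -- The bound does not depend on the state `i` of `p`, so averaging over `p` preserves it.
    have key : ∀ i, W t (place i (m.row j.succ :: B.map Bel.step))
        - W t (place i (m.row j.castSucc :: B.map Bel.step))
        - (W t (place j.succ (m.row i :: B.map Bel.step))
          - W t (place j.castSucc (m.row i :: B.map Bel.step)))
        ≤ (m.R j.succ - m.R j.castSucc) / m.β := by
      intro i
      have hle := row_castSucc_le_succ (m := m) j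
      rw [le_div_iff₀' m.β_pos, place_castSucc]
      by_cases hj : j = Fin.last k
      · subst hj
        rw [Fin.succ_last]
        refine le_trans (mul_le_mul_of_nonneg_left ?_ m.β_pos.le) m.gap_last
        show _ ≤ m.h - m.second.1 ⬝ᵥ m.R
        by_cases hi : i = Fin.last (k + 1)
        · subst hi
          have h1 := c.lift_best (B.map Bel.step) [] m.second
          simp only [place_last, List.append_nil, List.cons_append] at h1 ⊢
          linarith
        · have h1 := c.lift_best (B.map Bel.step) [] (m.row i)
          have h2 := c.le_exchange (B.map Bel.step) (m.row i) (m.row i) m.second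
            (row_le_second hi)
          simp only [place_last, place_of_ne hi, List.append_nil, List.cons_append] at h1 h2 ⊢
          linarith
      · rw [place_succ hj]
        refine le_trans (mul_le_mul_of_nonneg_left ?_ m.β_pos.le) (row_gap_M j hj)
        by_cases hi : i = Fin.last (k + 1)
        · subst hi
          have h1 := c.best_end (B.map Bel.step) _ _ hle
          have h2 : 0 ≤ m.β * m.best.1 (Fin.last (k + 1)) * ((m.row j.succ).step.1 ⬝ᵥ m.U
              - (m.row j.castSucc).step.1 ⬝ᵥ m.U) :=
            mul_nonneg (mul_nonneg m.β_pos.le (m.best.nonneg _)) (sub_nonneg.mpr hle.step.U_le)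
          simp only [place_last, List.cons_append] at h1 ⊢
          linarith
        · have h1 := c.exchange_le (B.map Bel.step) (m.row i) _ _ hle
          simp only [place_of_ne hi, List.cons_append] at h1 ⊢
          linarith
    have h1 := p.sum_mul_le key
    rw [p.sum_mul_const, le_div_iff₀' m.β_pos] at h1
    simp only [mul_sub, Finset.sum_sub_distrib] at h1
    simp only [hf, hg]
    linarith)
  linarith

theorem succ_swap (c : Exchange m t) (A B : List m.Bel) (p x y : m.Bel) (h : x.Le y) :
    W (t + 1) (A ++ p :: y :: B) - W (t + 1) (A ++ p :: x :: B)
      ≤ W (t + 1) (A ++ y :: p :: B) - W (t + 1) (A ++ x :: p :: B) := by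
  cases A with
  | nil => exact c.succ_swap_zero B p x y h
  | cons a A =>
    have key := a.sum_mul_sub_le
      (f₁ := fun i => W t (place i (A.map Bel.step ++ p.step :: y.step :: B.map Bel.step)))
      (f₂ := fun i => W t (place i (A.map Bel.step ++ p.step :: x.step :: B.map Bel.step)))
      (g₁ := fun i => W t (place i (A.map Bel.step ++ y.step :: p.step :: B.map Bel.step)))
      (g₂ := fun i => W t (place i (A.map Bel.step ++ x.step :: p.step :: B.map Bel.step)))
      fun i => by
        by_cases hi : i = Fin.last (k + 1)
        · subst hi
          simpa using c.swap (m.best :: A.map Bel.step) (B.map Bel.step) p.step _ _ h.step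
        · simpa [place_of_ne hi] using
            c.swap (A.map Bel.step) (B.map Bel.step ++ [m.row i]) p.step _ _ h.step
    have h1 := mul_le_mul_of_nonneg_left key m.β_pos.le
    simp only [List.cons_append, W_succ_append, List.map_cons]
    linarith

/-- At the head, `succ_top_end` compares with the end of the list, and repeated `succ_swap` brings
the improvement from the end up to second place. Behind a sensed channel the increment is one step
later and discounted, hence smaller by `step_U`. -/
theorem succ_swap_le (c : Exchange m t) (A B : List m.Bel) (p x y : m.Bel) (h : x.Le y) :
    W (t + 1) (A ++ y :: p :: B) - W (t + 1) (A ++ x :: p :: B)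
      - (W (t + 1) (A ++ p :: y :: B) - W (t + 1) (A ++ p :: x :: B))
      ≤ y.1 ⬝ᵥ m.U - x.1 ⬝ᵥ m.U := by
  cases A with
  | nil =>
    have h1 := c.succ_top_end (p :: B) x y h
    have h2 : ∀ B A, W (t + 1) (A ++ (B ++ [y])) - W (t + 1) (A ++ (B ++ [x]))
        ≤ W (t + 1) (A ++ y :: B) - W (t + 1) (A ++ x :: B) := by
      intro B
      induction B with
      | nil => intro A; exact le_rfl
      | cons b B ih =>
        intro A
        have h3 := ih (A ++ [b])
        have h4 := c.succ_swap A B b x y h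
        simp only [List.append_assoc, List.cons_append, List.nil_append] at h3 h4 ⊢
        linarith
    have h5 := h2 B [p]
    simp only [List.cons_append, List.nil_append] at h1 h5 ⊢
    linarith
  | cons a A =>
    have key := a.sum_mul_sub_le
      (f₁ := fun i => W t (place i (A.map Bel.step ++ y.step :: p.step :: B.map Bel.step))
        - W t (place i (A.map Bel.step ++ x.step :: p.step :: B.map Bel.step)))
      (f₂ := fun i => W t (place i (A.map Bel.step ++ p.step :: y.step :: B.map Bel.step))
        - W t (place i (A.map Bel.step ++ p.step :: x.step :: B.map Bel.step)))
      (g₁ := fun _ => y.step.1 ⬝ᵥ m.U - x.step.1 ⬝ᵥ m.U) (g₂ := fun _ => 0)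
      fun i => by
        rw [sub_zero]
        by_cases hi : i = Fin.last (k + 1)
        · subst hi
          simpa using c.swap_le (m.best :: A.map Bel.step) (B.map Bel.step) p.step _ _ h.step
        · simpa [place_of_ne hi] using
            c.swap_le (A.map Bel.step) (B.map Bel.step ++ [m.row i]) p.step _ _ h.step
    simp only [a.sum_mul_const, sub_zero, mul_zero, Finset.sum_const_zero, mul_sub,
      Finset.sum_sub_distrib] at key
    have h1 := mul_le_mul_of_nonneg_left key m.β_pos.le
    have h2 := h.step_U
    simp only [List.cons_append, W_succ_append, List.map_cons]
    linarith

/-- Compared state by state as in `succ_swap_zero`. For the pair `(K-1, K)` rearranging the lists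
shows that there is no future loss at all; for the other pairs `swap_le` bounds it by an increment
of `U`. -/
theorem succ_le_exchange (c : Exchange m t) (X : List m.Bel) (a x y : m.Bel) (h : x.Le y) :
    W (t + 1) (a :: (X ++ [y])) - W (t + 1) (a :: (X ++ [x]))
      ≤ W (t + 1) (y :: (X ++ [a])) - W (t + 1) (x :: (X ++ [a])) := by
  set f : Fin (k + 2) → ℝ := fun l => m.β * ∑ i, a.1 i *
      W t (place i (X.map Bel.step ++ [m.row l])) with hf
  set g : Fin (k + 2) → ℝ := fun l => m.R l + m.β * ∑ i, a.1 i *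
      W t (place l (X.map Bel.step ++ [m.row i])) with hg
  have e1 : ∀ z : m.Bel, W (t + 1) (a :: (X ++ [z])) = a.1 ⬝ᵥ m.R + z.1 ⬝ᵥ f := fun z => by
    simpa using W_succ_append_dot t a X z []
  have e2 : ∀ z : m.Bel, W (t + 1) (z :: (X ++ [a])) = z.1 ⬝ᵥ g := fun z => by
    rw [W_succ_dot]
    congr 1
    funext l
    rw [hg]
    simp only [List.map_append, List.map_cons, List.map_nil]
    rw [W_place_step t l _ _ a]
  rw [e1, e1, e2, e2]
  have := h.dotProduct_sub_le (f := f) (g := g) (fun j => by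
    have key : ∀ i, W t (place i (X.map Bel.step ++ [m.row j.succ]))
        - W t (place i (X.map Bel.step ++ [m.row j.castSucc]))
        - (W t (place j.succ (X.map Bel.step ++ [m.row i]))
          - W t (place j.castSucc (X.map Bel.step ++ [m.row i])))
        ≤ (m.R j.succ - m.R j.castSucc) / m.β := by
      intro i
      have hle := row_castSucc_le_succ (m := m) j
      rw [le_div_iff₀' m.β_pos, place_castSucc]
      by_cases hj : j = Fin.last k
      · subst hj
        have hR := R_mono (m := m) (Fin.last k)
        rw [Fin.succ_last] at hR ⊢
        refine le_trans (mul_nonpos_of_nonneg_of_nonpos m.β_pos.le ?_) (sub_nonneg.mpr hR)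
        by_cases hi : i = Fin.last (k + 1)
        · subst hi
          have h1 := c.best_up [] (X.map Bel.step) [m.second]
          have h2 := c.row_down (Fin.castSucc_lt_last (Fin.last k)).ne [] X [m.best]
          simp only [place_last, List.append_assoc, List.cons_append, List.nil_append] at h1 ⊢
          linarith
        · have h1 := c.best_up [] (X.map Bel.step) [m.row i]
          have h2 := c.W_swap (X.map Bel.step) [] (row_le_second hi)
          simp only [place_last, place_of_ne hi, List.append_assoc, List.cons_append,
            List.nil_append] at h1 h2 ⊢
          linarith
      · rw [place_succ hj]
        refine le_trans (mul_le_mul_of_nonneg_left ?_ m.β_pos.le) (row_gap_U j hj)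
        by_cases hi : i = Fin.last (k + 1)
        · subst hi
          have h1 := c.rotate m.best (X.map Bel.step) [] _ _ hle
          have h2 := c.swap_le (X.map Bel.step) [] m.best _ _ hle
          simp only [place_last, List.append_assoc, List.cons_append, List.nil_append] at h1 h2 ⊢
          linarith
        · have h1 := c.swap_le (X.map Bel.step) [] (m.row i) _ _ hle
          simp only [place_of_ne hi, List.append_assoc, List.cons_append, List.nil_append] at h1 ⊢
          linarith
    have h1 := a.sum_mul_le key
    rw [a.sum_mul_const, le_div_iff₀' m.β_pos] at h1
    simp only [mul_sub, Finset.sum_sub_distrib] at h1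
    simp only [hf, hg]
    linarith)
  linarith

end Exchange

/-- The inequalities at horizon `t + 1` draw on one another at horizon `t`, so they are proved
simultaneously. -/
theorem exchange (m : SensingModel k) (t : ℕ) : Exchange m t := by
  induction t with
  | zero =>
    constructor <;> intros <;> simp only [W_zero, sub_self, le_refl]
    · exact sub_nonneg.mpr (Bel.Le.U_le ‹_›)
    · exact sub_nonneg.mpr (Bel.R_le_h _)
    · exact sub_nonneg.mpr second_R_le_h
    · exact sub_nonneg.mpr (Bel.Le.U_le ‹_›)
    · exact add_nonneg (sub_nonneg.mpr (Bel.Le.U_le ‹_›))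
        (mul_nonneg (mul_nonneg m.β_pos.le (m.best.nonneg _))
          (sub_nonneg.mpr (Bel.Le.U_le (Bel.Le.step ‹_›))))
    · exact sub_nonneg.mpr (Bel.Le.U_le ‹_›)
  | succ t c =>
    exact ⟨c.succ_swap, c.succ_rotate, c.succ_top_end, c.succ_lift, c.succ_lift_best,
      c.succ_best_end, c.succ_exchange_le, c.succ_le_exchange, c.succ_swap_le⟩

/-- Sensing the better of two neighbouring channels first is better. -/
theorem W_swap_le (t : ℕ) (A B : List m.Bel) {x y : m.Bel} (h : x.Le y) :
    W t (A ++ x :: y :: B) ≤ W t (A ++ y :: x :: B) :=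
  (m.exchange t).W_swap A B h

/-- The order of two neighbouring channels with the same immediate reward does not matter. -/
theorem W_swap_eq (t : ℕ) (A B : List m.Bel) {x y : m.Bel} (h : x.Le y)
    (hR : x.1 ⬝ᵥ m.R = y.1 ⬝ᵥ m.R) : W t (A ++ x :: y :: B) = W t (A ++ y :: x :: B) := by
  refine le_antisymm (W_swap_le t A B h) ?_
  -- Equal rewards of comparable beliefs mean equal `U`-values, so the bound in `swap_le` is zero;
  -- again `p = x` cancels the other terms.
  have := (m.exchange t).swap_le A B x x y h
  rw [h.U_eq hR] at this
  linarith

end SensingModel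
end ChannelSensing
end

/-! ### Finite-state Markov chains: Markov property and existence. -/

noncomputable section

namespace ChannelSensing

section FiniteChains

variable {S Ω : Type*} [MeasurableSpace Ω] {μ : Measure Ω}

theorem integral_comp_of_fintype {F : Type*} [Fintype F] [MeasurableSpace F]
    [MeasurableSingletonClass F] [IsFiniteMeasure μ] {Z : Ω → F} (hZ : Measurable Z)
    (f : F → ℝ) : ∫ ω, f (Z ω) ∂μ = ∑ z, μ.real {ω | Z ω = z} * f z := by
  rw [← integral_map hZ.aemeasurable (measurable_of_finite f).aestronglyMeasurable,
    integral_fintype (.of_finite)]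
  refine Finset.sum_congr rfl fun z _ => ?_
  rw [map_measureReal_apply hZ (measurableSet_singleton z), smul_eq_mul]
  rfl

/-- The first `n` values of a process. -/
def past (Y : ℕ → Ω → S) (n : ℕ) (ω : Ω) : Fin n → S := fun i => Y i ω

theorem measurable_past [MeasurableSpace S] {Y : ℕ → Ω → S} (hY : ∀ t, Measurable (Y t)) (n : ℕ) :
    Measurable (past Y n) := measurable_pi_iff.mpr fun i => hY i

/-- The finite-dimensional laws of a Markov chain on a finite state space. -/
def ChainLaw (μ : Measure Ω) (p : S → ℝ) (Q : S → S → ℝ) (Y : ℕ → Ω → S) : Prop :=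
  ∀ (T : ℕ) (y : ℕ → S), μ.real {ω | ∀ t ≤ T, Y t ω = y t}
    = p (y 0) * ∏ t ∈ Finset.range T, Q (y t) (y (t + 1))

variable {p : S → ℝ} {Q : S → S → ℝ} {Y : ℕ → Ω → S}

theorem ChainLaw.real_past_succ (h : ChainLaw μ p Q Y) (n : ℕ) (w : Fin (n + 1) → S) (j : S) :
    μ.real {ω | past Y (n + 1) ω = w ∧ Y (n + 1) ω = j}
      = μ.real {ω | past Y (n + 1) ω = w} * Q (w (Fin.last n)) j := by
  -- The finite word followed by `j` forever, since the law is stated through infinite sequences.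
  set y : ℕ → S := fun t => if ht : t < n + 1 then w ⟨t, ht⟩ else j with hy
  have hyw : ∀ i : Fin (n + 1), y i = w i := fun i => dif_pos i.2
  have hyn : y n = w (Fin.last n) := hyw (Fin.last n)
  have hyj : y (n + 1) = j := by simp [hy]
  have e1 : {ω | past Y (n + 1) ω = w} = {ω | ∀ t ≤ n, Y t ω = y t} := by
    ext ω
    simp only [Set.mem_ofPred_eq, funext_iff, past]
    constructor
    · intro hw t ht
      rw [hw ⟨t, by omega⟩, ← hyw]
    · intro hw i
      rw [hw i (by omega), hyw]
  have e2 : {ω | past Y (n + 1) ω = w ∧ Y (n + 1) ω = j}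
      = {ω | ∀ t ≤ n + 1, Y t ω = y t} := by
    ext ω
    have := Set.ext_iff.mp e1 ω
    simp only [Set.mem_ofPred_eq] at this ⊢
    rw [this]
    constructor
    · rintro ⟨h1, h2⟩ t ht
      rcases Nat.lt_or_ge t (n + 1) with h3 | h3
      · exact h1 t (by omega)
      · obtain rfl : t = n + 1 := by omega
        rw [h2, hyj]
    · intro h1
      exact ⟨fun t ht => h1 t (by omega), by rw [h1 _ le_rfl, hyj]⟩
  rw [e1, e2, h, h, Finset.prod_range_succ, hyn, hyj]
  ring

/-- The Markov property in integrated form. -/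
theorem ChainLaw.integral_mul [Fintype S] [MeasurableSpace S] [MeasurableSingletonClass S]
    [IsFiniteMeasure μ] (h : ChainLaw μ p Q Y)
    (hY : ∀ t, Measurable (Y t)) (n : ℕ) (g : (Fin (n + 1) → S) → ℝ) (f : S → ℝ) :
    ∫ ω, g (past Y (n + 1) ω) * f (Y (n + 1) ω) ∂μ
      = ∫ ω, g (past Y (n + 1) ω) * ∑ j, Q (Y n ω) j * f j ∂μ := by
  have h1 := integral_comp_of_fintype (μ := μ)
    (Z := fun ω => (past Y (n + 1) ω, Y (n + 1) ω))
    ((measurable_past hY _).prodMk (hY _)) (fun z => g z.1 * f z.2)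
  have h2 := integral_comp_of_fintype (μ := μ) (measurable_past hY (n + 1))
    (fun w => g w * ∑ j, Q (w (Fin.last n)) j * f j)
  simp only at h1
  rw [h1]
  refine Eq.trans ?_ h2.symm
  rw [Fintype.sum_prod_type]
  refine Finset.sum_congr rfl fun w _ => ?_
  rw [Finset.mul_sum, Finset.mul_sum]
  refine Finset.sum_congr rfl fun j _ => ?_
  have : {ω | (past Y (n + 1) ω, Y (n + 1) ω) = (w, j)}
      = {ω | past Y (n + 1) ω = w ∧ Y (n + 1) ω = j} := by
    ext ω
    simp [Prod.ext_iff]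
  rw [this, h.real_past_succ]
  ring

theorem ChainLaw.real_zero (h : ChainLaw μ p Q Y) (j : S) :
    μ.real {ω | Y 0 ω = j} = p j := by
  have := h 0 (fun _ => j)
  simpa using this

theorem ChainLaw.integral_zero [Fintype S] [MeasurableSpace S] [MeasurableSingletonClass S]
    [IsFiniteMeasure μ] (h : ChainLaw μ p Q Y)
    (hY : ∀ t, Measurable (Y t)) (f : S → ℝ) :
    ∫ ω, f (Y 0 ω) ∂μ = ∑ j, p j * f j := by
  rw [integral_comp_of_fintype (hY 0)]
  simp_rw [h.real_zero]

/-- The probability measure with given masses on a finite space. -/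
def massMeasure [Fintype S] [MeasurableSpace S] (x : S → ℝ) : Measure S := ∑ i, ENNReal.ofReal (x i) • Measure.dirac i

theorem massMeasure_singleton [Fintype S] [MeasurableSpace S] [MeasurableSingletonClass S] (x : S → ℝ) (i : S) :
    massMeasure x {i} = ENNReal.ofReal (x i) := by
  classical
  simp only [massMeasure, Measure.coe_finsetSum, Finset.sum_apply, Measure.smul_apply,
    Measure.dirac_apply, smul_eq_mul]
  rw [Finset.sum_eq_single i]
  · simp
  · intro j _ hj
    simp [hj]
  · simp

theorem isProbabilityMeasure_massMeasure [Fintype S] [MeasurableSpace S] {x : S → ℝ} (hx : x ∈ stdSimplex ℝ S) :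
    IsProbabilityMeasure (massMeasure x) := by
  constructor
  simp only [massMeasure, Measure.coe_finsetSum, Finset.sum_apply, Measure.smul_apply,
    measure_univ, smul_eq_mul, mul_one]
  rw [← ENNReal.ofReal_sum_of_nonneg fun i _ => hx.1 i, hx.2, ENNReal.ofReal_one]

/-- Existence of Markov chains with a finite state space, as laws on the path space. -/
theorem exists_chainLaw [Fintype S] [MeasurableSpace S] [MeasurableSingletonClass S] [Nonempty S] {p : S → ℝ} {Q : S → S → ℝ} (hp : p ∈ stdSimplex ℝ S)
    (hQ : ∀ i, Q i ∈ stdSimplex ℝ S) : ∃ μ : Measure (ℕ → S), IsProbabilityMeasure μ ∧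
      ChainLaw μ p Q (fun t y => y t) := by
  have := isProbabilityMeasure_massMeasure hp
  let κ : (n : ℕ) → Kernel ((i : Finset.Iic n) → S) S := fun n =>
    Kernel.ofFunOfCountable fun w => massMeasure (Q (w ⟨n, by simp⟩))
  have hκ : ∀ n, IsMarkovKernel (κ n) := fun n =>
    ⟨fun w => isProbabilityMeasure_massMeasure (hQ _)⟩
  -- The Ionescu-Tulcea measure of kernels that depend only on the last coordinate.
  let μ : Measure (ℕ → S) := Kernel.trajMeasure (X := fun _ => S) (massMeasure p) κ
  have hμ : IsProbabilityMeasure μ :=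
    inferInstanceAs (IsProbabilityMeasure (Kernel.trajMeasure (X := fun _ => S) _ κ))
  refine ⟨μ, hμ, ?_⟩
  have key : ∀ (T : ℕ) (y : ℕ → S), μ {ω | ∀ t ≤ T, ω t = y t}
      = ENNReal.ofReal (p (y 0) * ∏ t ∈ Finset.range T, Q (y t) (y (t + 1))) := by
    have hset : ∀ (T : ℕ) (y : ℕ → S), {ω : ℕ → S | ∀ t ≤ T, ω t = y t}
        = Preorder.frestrictLe (π := fun _ => S) T ⁻¹' {fun i : Finset.Iic T => y i} := by
      intro T y
      ext ω
      simp [funext_iff, Preorder.frestrictLe]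
    intro T
    induction T with
    | zero =>
      intro y
      have h0 : μ.map (Preorder.frestrictLe (π := fun _ => S) 0)
          = (massMeasure p).map (MeasurableEquiv.piUnique (fun _ : Finset.Iic 0 => S)).symm := by
        simp only [μ, Kernel.trajMeasure]
        rw [Measure.map_comp _ _ (by fun_prop), Kernel.traj_map_frestrictLe,
          Kernel.partialTraj_self, Measure.id_comp]
      rw [hset, ← Measure.map_apply (by fun_prop) (measurableSet_singleton _), h0,
        Measure.map_apply (by fun_prop) (measurableSet_singleton _)]
      have : (MeasurableEquiv.piUnique (fun _ : Finset.Iic 0 => S)).symm ⁻¹'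
          {fun i : Finset.Iic 0 => y i} = {y 0} := by
        ext s
        simp only [Set.mem_preimage, Set.mem_singleton_iff]
        constructor
        · intro h
          exact congrFun h ⟨0, by simp⟩
        · rintro rfl
          ext ⟨i, hi⟩
          obtain rfl : i = 0 := by simpa using hi
          rfl
      rw [this, massMeasure_singleton]
      simp
    | succ T ih =>
      intro y
      have h1 := Kernel.map_frestrictLe_trajMeasure_compProd_eq_map_trajMeasure
        (X := fun _ => S) (μ₀ := massMeasure p) (κ := κ) (a := T)
      have h2 : {ω : ℕ → S | ∀ t ≤ T + 1, ω t = y t}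
          = (fun ω : ℕ → S => (Preorder.frestrictLe (π := fun _ => S) T ω, ω (T + 1))) ⁻¹'
            ({fun i : Finset.Iic T => y i} ×ˢ {y (T + 1)}) := by
        rw [Set.mk_preimage_prod, ← hset]
        ext ω
        simp only [Set.mem_ofPred_eq, Set.mem_inter_iff, Set.mem_preimage, Set.mem_singleton_iff]
        constructor
        · intro h
          exact ⟨fun t ht => h t (by omega), h _ le_rfl⟩
        · rintro ⟨h, h'⟩ t ht
          rcases Nat.lt_or_ge t (T + 1) with h3 | h3
          · exact h t (by omega)
          · obtain rfl : t = T + 1 := by omega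
            exact h'
      rw [h2, ← Measure.map_apply (by fun_prop)
        ((measurableSet_singleton _).prod (measurableSet_singleton _))]
      change (Measure.map _ (Kernel.trajMeasure (X := fun _ => S) (massMeasure p) κ)) _ = _
      rw [← h1, Measure.compProd_apply_prod (measurableSet_singleton _)
        (measurableSet_singleton _), lintegral_singleton,
        Measure.map_apply (by fun_prop) (measurableSet_singleton _), ← hset]
      change massMeasure _ _ * μ _ = _
      rw [ih, massMeasure_singleton, Finset.prod_range_succ, ← mul_assoc,
        ENNReal.ofReal_mul' ((hQ _).1 _), mul_comm]
  intro T y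
  rw [measureReal_def, key, ENNReal.toReal_ofReal]
  exact mul_nonneg (hp.1 _) (Finset.prod_nonneg fun t _ => (hQ _).1 _)

end FiniteChains

variable {k : ℕ}

theorem exists_isMarkovChain {P : Matrix (Fin (k + 2)) (Fin (k + 2)) ℝ}
    (hP : ∀ i, P i ∈ stdSimplex ℝ (Fin (k + 2))) {π : Fin (k + 2) → ℝ}
    (hπ : π ∈ stdSimplex ℝ (Fin (k + 2))) :
    ∃ μ : Measure (ℕ → Fin (k + 2)), IsMarkovChain μ π P (fun t y => y t) := by
  obtain ⟨μ, h1, h2⟩ := exists_chainLaw hπ hP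
  exact ⟨μ, h1, fun t => measurable_pi_apply t, h2⟩

theorem IsMarkovChain.chainLaw {Ω : Type*} [MeasurableSpace Ω] {μ : Measure Ω}
    {π : Fin (k + 2) → ℝ} {P : Matrix (Fin (k + 2)) (Fin (k + 2)) ℝ}
    {Y : ℕ → Ω → Fin (k + 2)} (h : IsMarkovChain μ π P Y) : ChainLaw μ π P Y := h.law

end ChannelSensing
end

/-! ### Discounted rewards before a stopping time. -/

noncomputable section

namespace ChannelSensing

variable {k : ℕ}

/-- The payment at time `t` is made if and only if `t` is before the stopping time `τ`. -/
def active (τ : (ℕ → Fin (k + 2)) → WithTop ℕ) (t : ℕ) (y : ℕ → Fin (k + 2)) : ℝ :=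
  open Classical in if (t : WithTop ℕ) < τ y then 1 else 0

theorem active_nonneg (τ : (ℕ → Fin (k + 2)) → WithTop ℕ) (t : ℕ) (y : ℕ → Fin (k + 2)) :
    0 ≤ active τ t y := by
  rw [active]
  split_ifs <;> norm_num

theorem active_le_one (τ : (ℕ → Fin (k + 2)) → WithTop ℕ) (t : ℕ) (y : ℕ → Fin (k + 2)) :
    active τ t y ≤ 1 := by
  rw [active]
  split_ifs <;> norm_num

theorem active_succ_le (τ : (ℕ → Fin (k + 2)) → WithTop ℕ) (t : ℕ) (y : ℕ → Fin (k + 2)) :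
    active τ (t + 1) y ≤ active τ t y := by
  rw [active, active]
  split_ifs with h1 h2
  · rfl
  · refine absurd (lt_of_le_of_lt ?_ h1) h2
    exact_mod_cast Nat.le_succ t
  · norm_num
  · rfl

theorem active_zero {τ : (ℕ → Fin (k + 2)) → WithTop ℕ} {y : ℕ → Fin (k + 2)} (h : 1 ≤ τ y) :
    active τ 0 y = 1 := by
  rw [active, if_pos]
  exact lt_of_lt_of_le (by exact_mod_cast Nat.zero_lt_one) h

section StoppingTimes

variable {P : Matrix (Fin (k + 2)) (Fin (k + 2)) ℝ} {π : Fin (k + 2) → ℝ}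
  {τ : (ℕ → Fin (k + 2)) → WithTop ℕ}

theorem measurable_active (hτ : IsStoppingTime
    (Filtration.natural (sensedPMF P π) (stronglyMeasurable_sensedPMF P π)) τ) (t : ℕ) :
    Measurable (active τ t) := by
  classical
  have h : MeasurableSet {y | τ y ≤ t} := Filtration.le _ t _ (hτ t)
  have h2 : MeasurableSet {y | (t : WithTop ℕ) < τ y} := by
    have : {y | (t : WithTop ℕ) < τ y} = {y | τ y ≤ t}ᶜ := by
      ext y
      simp
    rw [this]
    exact h.compl
  exact Measurable.ite h2 measurable_const measurable_const

/-- The PMF at time `t` depends on the observation at time `t - 1`, so the decision whether to stop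
by time `t` uses only the states before `t`. This is what lets the Markov property be applied at
time `t`. -/
theorem active_eq_past (hτ : IsStoppingTime
    (Filtration.natural (sensedPMF P π) (stronglyMeasurable_sensedPMF P π)) τ) (t : ℕ) :
    ∃ g : (Fin t → Fin (k + 2)) → ℝ, ∀ y, active τ t y = g (past (fun s y => y s) t y) := by
  classical
  have hle : (Filtration.natural (sensedPMF P π) (stronglyMeasurable_sensedPMF P π)) t
      ≤ MeasurableSpace.comap (past (fun s (y : ℕ → Fin (k + 2)) => y s) t) ⊤ := by
    refine iSup₂_le fun j hj => ?_
    rintro s ⟨B, -, rfl⟩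
    cases j with
    | zero => exact ⟨(fun _ => π) ⁻¹' B, trivial, rfl⟩
    | succ j => exact ⟨(fun w => P (w ⟨j, hj⟩)) ⁻¹' B, trivial, rfl⟩
  obtain ⟨B, -, hB⟩ := hle _ (hτ t)
  refine ⟨fun w => if w ∈ B then 0 else 1, fun y => ?_⟩
  have : past (fun s (y : ℕ → Fin (k + 2)) => y s) t y ∈ B ↔ τ y ≤ t :=
    Set.ext_iff.mp hB y
  rw [active]
  simp only [this]
  by_cases h : τ y ≤ t
  · simp [h]
  · simp [h, not_le.mp h]

/-- The geometric bound allows sum and expectation to be exchanged. -/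
theorem hasSum_discountedBefore {μ : Measure (ℕ → Fin (k + 2))} [IsProbabilityMeasure μ]
    (hτ : IsStoppingTime
      (Filtration.natural (sensedPMF P π) (stronglyMeasurable_sensedPMF P π)) τ)
    {β : ℝ} (hβ0 : 0 ≤ β) (hβ1 : β < 1) {c : ℕ → (ℕ → Fin (k + 2)) → ℝ}
    (hc : ∀ t, Measurable (c t)) {C : ℝ} (hC : ∀ t y, |c t y| ≤ C) :
    HasSum (fun t => β ^ t * ∫ y, active τ t y * c t y ∂μ) (discountedBefore μ β c τ) := by
  have e : ∀ (t : ℕ) (y : ℕ → Fin (k + 2)),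
      {t : ℕ | (t : WithTop ℕ) < τ y}.indicator (fun t => β ^ t * c t y) t
        = β ^ t * (active τ t y * c t y) := by
    intro t y
    by_cases h : (t : WithTop ℕ) < τ y
    · simp [Set.indicator, active, h]
    · simp [Set.indicator, active, h]
  have hb : ∀ t y, ‖β ^ t * (active τ t y * c t y)‖ ≤ β ^ t * C := by
    intro t y
    rw [norm_mul, norm_pow, Real.norm_of_nonneg hβ0, norm_mul,
      Real.norm_of_nonneg (active_nonneg τ t y)]
    refine mul_le_mul_of_nonneg_left ?_ (pow_nonneg hβ0 t)
    exact (mul_le_of_le_one_left (norm_nonneg _) (active_le_one τ t y)).trans (hC t y)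
  have hint : ∀ t, Integrable (fun y => β ^ t * (active τ t y * c t y)) μ := fun t =>
    Integrable.of_bound ((((measurable_active hτ t).mul (hc t)).const_mul _).aestronglyMeasurable)
      (β ^ t * C) (ae_of_all _ (hb t))
  have hsum : Summable fun t => ∫ y, ‖β ^ t * (active τ t y * c t y)‖ ∂μ := by
    refine Summable.of_nonneg_of_le (fun t => integral_nonneg fun y => norm_nonneg _)
      (fun t => ?_) ((summable_geometric_of_lt_one hβ0 hβ1).mul_right C)
    calc _ ≤ ∫ _, β ^ t * C ∂μ := integral_mono (hint t).norm (integrable_const _) (hb t)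
      _ = β ^ t * C := by simp
  have := hasSum_integral_of_summable_integral_norm hint hsum
  simp only [discountedBefore, e]
  simpa only [integral_const_mul] using this

end StoppingTimes

namespace SensingModel

variable {m : SensingModel k}

theorem abs_dotProduct_le {x : Fin (k + 2) → ℝ} (hx : x ∈ stdSimplex ℝ (Fin (k + 2)))
    (f : Fin (k + 2) → ℝ) : |x ⬝ᵥ f| ≤ ∑ i, |f i| := by
  have h1 : ∀ i, x i ≤ 1 := fun i => by
    rw [← hx.2]
    exact Finset.single_le_sum (fun i _ => hx.1 i) (Finset.mem_univ i)
  refine (Finset.abs_sum_le_sum_abs _ _).trans (Finset.sum_le_sum fun i _ => ?_)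
  rw [abs_mul, abs_of_nonneg (hx.1 i)]
  exact mul_le_of_le_one_left (abs_nonneg _) (h1 i)

theorem sensedPMF_mem (x : m.Bel) (t : ℕ) (y : ℕ → Fin (k + 2)) :
    sensedPMF m.P x.1 t y ∈ stdSimplex ℝ (Fin (k + 2)) := by
  cases t with
  | zero => exact x.2.1
  | succ t => exact m.row_mem _

theorem measurable_sensedPMF_dot (x : m.Bel) (t : ℕ) :
    Measurable fun y => sensedPMF m.P x.1 t y ⬝ᵥ m.R := by
  cases t with
  | zero =>
    simp only [sensedPMF]
    exact measurable_const
  | succ t =>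
    exact (measurable_of_finite fun i : Fin (k + 2) => m.P i ⬝ᵥ m.R).comp (measurable_pi_apply t)

/-- The value of sensing a channel with belief `x` against the charge `c`, if the value of
continuing after a state is `a` for the best state and zero for the others. -/
def charged (c a : ℝ) (x : Fin (k + 2) → ℝ) : ℝ :=
  x ⬝ᵥ m.R - c + m.β * (x (Fin.last (k + 1)) * a)

variable {x : m.Bel} {μ : Measure (ℕ → Fin (k + 2))} {τ : (ℕ → Fin (k + 2)) → WithTop ℕ}

/-- Optional stopping up to time `n`: the Markov property turns the continuation value `a` in the
best state into the term `β p_{iK} a` of `charged`, and the sum telescopes. The right-hand sum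
collects the errors from not continuing optimally. -/
theorem sum_charged_eq (hμ : IsMarkovChain μ x.1 m.P (fun t y => y t))
    (hτ : IsStoppingTime
      (Filtration.natural (sensedPMF m.P x.1) (stronglyMeasurable_sensedPMF m.P x.1)) τ)
    (hτ1 : ∀ y, 1 ≤ τ y) (c a : ℝ) (n : ℕ) :
    ∑ t ∈ Finset.range (n + 1), m.β ^ t *
        ∫ y, active τ t y * (sensedPMF m.P x.1 t y ⬝ᵥ m.R - c) ∂μ
      + m.β ^ (n + 1) * ∫ y, active τ n y * (if y n = Fin.last (k + 1) then a else 0) ∂μ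
      = m.charged c a x.1 + ∑ t ∈ Finset.range n, m.β ^ (t + 1) *
        ∫ y, (active τ (t + 1) y * m.charged c a (m.P (y t))
          - active τ t y * (if y t = Fin.last (k + 1) then a else 0)) ∂μ := by
  have := hμ.isProbabilityMeasure
  have hY : ∀ t, Measurable (fun y : ℕ → Fin (k + 2) => y t) := fun t => measurable_pi_apply t
  have hint : ∀ (t n : ℕ) (f : Fin (k + 2) → ℝ),
      Integrable (fun y => active τ t y * f (y n)) μ := by
    intro t n f
    refine Integrable.of_bound (((measurable_active hτ t).mul
      ((measurable_of_finite f).comp (measurable_pi_apply n))).aestronglyMeasurable)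
      (∑ i, |f i|) (ae_of_all _ fun y => ?_)
    rw [norm_mul, Real.norm_of_nonneg (active_nonneg τ t y)]
    refine (mul_le_of_le_one_left (norm_nonneg _) (active_le_one τ t y)).trans ?_
    exact Finset.single_le_sum (f := fun i => |f i|) (fun i _ => abs_nonneg _)
      (Finset.mem_univ (y n))
  induction n with
  | zero =>
    have h1 := hμ.chainLaw.integral_zero hY (fun i => if i = Fin.last (k + 1) then a else 0)
    simp only [mul_ite, mul_zero, Finset.sum_ite_eq', Finset.mem_univ, if_true] at h1
    simp only [zero_add, Finset.range_one, Finset.sum_singleton, Finset.range_zero,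
      Finset.sum_empty, active_zero (hτ1 _), one_mul, pow_zero, pow_one, add_zero]
    rw [h1]
    simp [sensedPMF, charged]
  | succ n ih =>
    obtain ⟨g, hg⟩ := active_eq_past hτ (n + 1)
    have h1 := hμ.chainLaw.integral_mul hY n g (fun i => if i = Fin.last (k + 1) then a else 0)
    simp only [mul_ite, mul_zero, Finset.sum_ite_eq', Finset.mem_univ, if_true] at h1
    have h2 : ∫ y, active τ (n + 1) y * (if y (n + 1) = Fin.last (k + 1) then a else 0) ∂μ
        = ∫ y, active τ (n + 1) y * (m.P (y n) (Fin.last (k + 1)) * a) ∂μ := by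
      simp only [hg]
      simpa only [mul_ite, mul_zero] using h1
    conv_lhs => rw [Finset.sum_range_succ, h2]
    conv_rhs => rw [Finset.sum_range_succ]
    have h3 : ∫ y, (active τ (n + 1) y * m.charged c a (m.P (y n))
          - active τ n y * (if y n = Fin.last (k + 1) then a else 0)) ∂μ
        = ∫ y, active τ (n + 1) y * (m.P (y n) ⬝ᵥ m.R - c) ∂μ
          + m.β * ∫ y, active τ (n + 1) y * (m.P (y n) (Fin.last (k + 1)) * a) ∂μ
          - ∫ y, active τ n y * (if y n = Fin.last (k + 1) then a else 0) ∂μ := by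
      rw [integral_sub (hint (n + 1) n fun i => m.charged c a (m.P i))
        (hint n n fun i => if i = Fin.last (k + 1) then a else 0), ← integral_const_mul,
        ← integral_add (hint (n + 1) n fun i => m.P i ⬝ᵥ m.R - c)
          ((hint (n + 1) n fun i => m.P i (Fin.last (k + 1)) * a).const_mul _)]
      congr 2
      ext y
      rw [charged]
      ring
    have h4 : ∀ y : ℕ → Fin (k + 2), sensedPMF m.P x.1 (n + 1) y = m.P (y n) := fun y => rfl
    rw [h3]
    simp only [h4]
    linear_combination ih

theorem hasSum_reward_sub (hμ : IsMarkovChain μ x.1 m.P (fun t y => y t))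
    (hτ : IsStoppingTime
      (Filtration.natural (sensedPMF m.P x.1) (stronglyMeasurable_sensedPMF m.P x.1)) τ)
    (c : ℝ) : HasSum (fun t => m.β ^ t *
        ∫ y, active τ t y * (sensedPMF m.P x.1 t y ⬝ᵥ m.R - c) ∂μ)
      (discountedBefore μ m.β (fun t y => sensedPMF m.P x.1 t y ⬝ᵥ m.R) τ
        - c * discountedBefore μ m.β (fun _ _ => 1) τ) := by
  have := hμ.isProbabilityMeasure
  have h1 := hasSum_discountedBefore (μ := μ) hτ m.β_pos.le m.β_lt
    (measurable_sensedPMF_dot x) (fun t y => abs_dotProduct_le (sensedPMF_mem x t y) m.R)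
  have h2 := hasSum_discountedBefore (μ := μ) hτ m.β_pos.le m.β_lt
    (c := fun _ _ => 1) (fun _ => measurable_const) (C := 1) (fun _ _ => by simp)
  have e : ∀ t : ℕ, m.β ^ t * ∫ y, active τ t y * (sensedPMF m.P x.1 t y ⬝ᵥ m.R - c) ∂μ
      = m.β ^ t * ∫ y, active τ t y * (sensedPMF m.P x.1 t y ⬝ᵥ m.R) ∂μ
        - c * (m.β ^ t * ∫ y, active τ t y * 1 ∂μ) := by
    intro t
    have i1 : Integrable (fun y => active τ t y * (sensedPMF m.P x.1 t y ⬝ᵥ m.R)) μ := by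
      refine Integrable.of_bound (((measurable_active hτ t).mul
        (measurable_sensedPMF_dot x t)).aestronglyMeasurable) (∑ i, |m.R i|)
        (ae_of_all _ fun y => ?_)
      rw [norm_mul, Real.norm_of_nonneg (active_nonneg τ t y)]
      exact (mul_le_of_le_one_left (norm_nonneg _) (active_le_one τ t y)).trans
        (abs_dotProduct_le (sensedPMF_mem x t y) m.R)
    have i2 : Integrable (fun y => active τ t y) μ := by
      refine Integrable.of_bound (measurable_active hτ t).aestronglyMeasurable 1
        (ae_of_all _ fun y => ?_)
      rw [Real.norm_of_nonneg (active_nonneg τ t y)]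
      exact active_le_one τ t y
    simp only [mul_sub, mul_one]
    rw [integral_sub i1 (i2.mul_const c), integral_mul_const]
    ring
  simp only [e]
  exact h1.sub (h2.mul_left c)

theorem one_le_discountedBefore (hμ : IsMarkovChain μ x.1 m.P (fun t y => y t))
    (hτ : IsStoppingTime
      (Filtration.natural (sensedPMF m.P x.1) (stronglyMeasurable_sensedPMF m.P x.1)) τ)
    (hτ1 : ∀ y, 1 ≤ τ y) : 1 ≤ discountedBefore μ m.β (fun _ _ => 1) τ := by
  have := hμ.isProbabilityMeasure
  have h2 := hasSum_discountedBefore (μ := μ) hτ m.β_pos.le m.β_lt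
    (c := fun _ _ => 1) (fun _ => measurable_const) (C := 1) (fun _ _ => by simp)
  have h3 := le_hasSum h2 0 fun t _ => mul_nonneg (pow_nonneg m.β_pos.le t)
    (integral_nonneg fun y => mul_nonneg (active_nonneg τ t y) zero_le_one)
  simpa [active_zero (hτ1 _)] using h3

theorem discountedBefore_le (hμ : IsMarkovChain μ x.1 m.P (fun t y => y t))
    (hτ : IsStoppingTime
      (Filtration.natural (sensedPMF m.P x.1) (stronglyMeasurable_sensedPMF m.P x.1)) τ) :
    discountedBefore μ m.β (fun _ _ => 1) τ * (1 - m.β) ≤ 1 := by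
  have := hμ.isProbabilityMeasure
  have h2 := hasSum_discountedBefore (μ := μ) hτ m.β_pos.le m.β_lt
    (c := fun _ _ => 1) (fun _ => measurable_const) (C := 1) (fun _ _ => by simp)
  have h3 := hasSum_le (fun t => ?_) h2 (hasSum_geometric_of_lt_one m.β_pos.le m.β_lt)
  · have h4 : 0 < 1 - m.β := sub_pos.mpr m.β_lt
    calc _ ≤ (1 - m.β)⁻¹ * (1 - m.β) := mul_le_mul_of_nonneg_right h3 h4.le
      _ = 1 := inv_mul_cancel₀ h4.ne'
  · refine mul_le_of_le_one_right (pow_nonneg m.β_pos.le t) ?_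
    have : ∫ y, active τ t y * 1 ∂μ ≤ ∫ _, (1 : ℝ) ∂μ := by
      refine integral_mono_of_nonneg (ae_of_all _ fun y => ?_) (integrable_const _)
        (ae_of_all _ fun y => ?_)
      · exact mul_nonneg (active_nonneg τ t y) zero_le_one
      · simpa using active_le_one τ t y
    simpa using this

/-- The charged reward before any stopping time is at most the charged value, if continuing after
a state is worth at most `a` after the best state and nothing after the other states. -/
theorem reward_sub_le (hμ : IsMarkovChain μ x.1 m.P (fun t y => y t))
    (hτ : IsStoppingTime
      (Filtration.natural (sensedPMF m.P x.1) (stronglyMeasurable_sensedPMF m.P x.1)) τ)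
    (hτ1 : ∀ y, 1 ≤ τ y) {c a : ℝ} (ha : 0 ≤ a) (hbest : m.charged c a m.best.1 ≤ a)
    (hrow : ∀ i ≠ Fin.last (k + 1), m.charged c a (m.P i) ≤ 0) :
    discountedBefore μ m.β (fun t y => sensedPMF m.P x.1 t y ⬝ᵥ m.R) τ
        - c * discountedBefore μ m.β (fun _ _ => 1) τ ≤ m.charged c a x.1 := by
  have hlim := (hasSum_reward_sub hμ hτ c).tendsto_sum_nat
  rw [← Filter.tendsto_add_atTop_iff_nat 1] at hlim
  refine le_of_tendsto' hlim fun n => ?_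
  have h1 := sum_charged_eq hμ hτ hτ1 c a n
  have h2 : 0 ≤ m.β ^ (n + 1) * ∫ y, active τ n y * (if y n = Fin.last (k + 1) then a else 0) ∂μ :=
    mul_nonneg (pow_nonneg m.β_pos.le _) (integral_nonneg fun y =>
      mul_nonneg (active_nonneg τ n y) (by split_ifs <;> [exact ha; exact le_rfl]))
  have h3 : ∑ t ∈ Finset.range n, m.β ^ (t + 1) *
      ∫ y, (active τ (t + 1) y * m.charged c a (m.P (y t))
        - active τ t y * (if y t = Fin.last (k + 1) then a else 0)) ∂μ ≤ 0 := by
    -- Supermartingale property: continuing is worth at most `a` after the best state, at most `0`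
    -- after any other, and stopping gives `0`.
    refine Finset.sum_nonpos fun t _ => mul_nonpos_of_nonneg_of_nonpos (pow_nonneg m.β_pos.le _)
      (integral_nonpos fun y => ?_)
    have h4 := active_nonneg τ (t + 1) y
    have h5 := active_succ_le τ t y
    simp only [Pi.zero_apply, sub_nonpos]
    by_cases hy : y t = Fin.last (k + 1)
    · rw [hy, if_pos rfl]
      calc _ ≤ active τ (t + 1) y * a := mul_le_mul_of_nonneg_left hbest h4
        _ ≤ _ := mul_le_mul_of_nonneg_right h5 ha
    · rw [if_neg hy, mul_zero]
      exact mul_nonpos_of_nonneg_of_nonpos h4 (hrow _ hy)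
  linarith

/-- The charged reward before a stopping time that continues exactly when this is worth it is the
charged value. -/
theorem reward_sub_eq (hμ : IsMarkovChain μ x.1 m.P (fun t y => y t))
    (hτ : IsStoppingTime
      (Filtration.natural (sensedPMF m.P x.1) (stronglyMeasurable_sensedPMF m.P x.1)) τ)
    (hτ1 : ∀ y, 1 ≤ τ y) {c a : ℝ}
    (hact : ∀ t y, active τ (t + 1) y * m.charged c a (m.P (y t))
      = active τ t y * if y t = Fin.last (k + 1) then a else 0) :
    discountedBefore μ m.β (fun t y => sensedPMF m.P x.1 t y ⬝ᵥ m.R) τ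
        - c * discountedBefore μ m.β (fun _ _ => 1) τ = m.charged c a x.1 := by
  have := hμ.isProbabilityMeasure
  have hlim := (hasSum_reward_sub hμ hτ c).tendsto_sum_nat
  rw [← Filter.tendsto_add_atTop_iff_nat 1] at hlim
  refine tendsto_nhds_unique hlim ?_
  have h3 : ∀ n, ∑ t ∈ Finset.range n, m.β ^ (t + 1) *
      ∫ y, (active τ (t + 1) y * m.charged c a (m.P (y t))
        - active τ t y * (if y t = Fin.last (k + 1) then a else 0)) ∂μ = 0 := by
    refine fun n => Finset.sum_eq_zero fun t _ => ?_
    simp only [hact, sub_self, integral_zero, mul_zero]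
  -- The continuation value still outstanding at time `n` is bounded, so discounting removes it in
  -- the limit.
  have h4 : Filter.Tendsto (fun n => m.β ^ (n + 1) *
      ∫ y, active τ n y * (if y n = Fin.last (k + 1) then a else 0) ∂μ) Filter.atTop (nhds 0) := by
    have hpow : Filter.Tendsto (fun n => m.β ^ (n + 1) * |a|) Filter.atTop (nhds 0) := by
      have := ((tendsto_pow_atTop_nhds_zero_of_lt_one m.β_pos.le m.β_lt).comp
        (Filter.tendsto_add_atTop_nat 1)).mul_const |a|
      simpa using this
    refine squeeze_zero_norm (fun n => ?_) hpow
    rw [norm_mul, norm_pow, Real.norm_of_nonneg m.β_pos.le]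
    refine mul_le_mul_of_nonneg_left ?_ (pow_nonneg m.β_pos.le _)
    have hle := norm_integral_le_of_norm_le_const (μ := μ) (C := |a|)
      (f := fun y => active τ n y * (if y n = Fin.last (k + 1) then a else 0))
      (ae_of_all _ fun y => by
        rw [norm_mul, Real.norm_of_nonneg (active_nonneg τ n y)]
        refine (mul_le_of_le_one_left (norm_nonneg _) (active_le_one τ n y)).trans ?_
        split_ifs
        · exact le_rfl
        · simp)
    simpa using hle
  have h5 := (tendsto_const_nhds (x := m.charged c a x.1)).sub h4
  rw [sub_zero] at h5
  refine h5.congr fun n => ?_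
  have h1 := sum_charged_eq hμ hτ hτ1 c a n
  rw [h3, add_zero] at h1
  linarith

end SensingModel
end ChannelSensing
end

/-! ### The Gittins index of beliefs above `P_{K-1}`. -/

noncomputable section

namespace ChannelSensing
namespace SensingModel

variable {k : ℕ} {m : SensingModel k}

variable (m) in
/-- The ratios whose supremum is the Gittins index of `x`. -/
def ratios (x : Fin (k + 2) → ℝ) : Set ℝ :=
  {r : ℝ | ∃ (μ : Measure (ℕ → Fin (k + 2))) (τ : (ℕ → Fin (k + 2)) → WithTop ℕ),
    IsMarkovChain μ x m.P (fun t y => y t) ∧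
    IsStoppingTime
      (Filtration.natural (sensedPMF m.P x) (stronglyMeasurable_sensedPMF m.P x)) τ ∧
    (∀ y, 1 ≤ τ y) ∧
    r = discountedBefore μ m.β (fun t y => sensedPMF m.P x t y ⬝ᵥ m.R) τ /
      discountedBefore μ m.β (fun _ _ => 1) τ}

theorem ratios_nonempty (x : m.Bel) : (m.ratios x.1).Nonempty := by
  obtain ⟨μ, hμ⟩ := exists_isMarkovChain m.row_mem x.2.1
  exact ⟨_, μ, fun _ => (1 : ℕ), hμ, isStoppingTime_const _ 1, fun _ => le_rfl, rfl⟩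

variable (m) in
/-- The charge at which it is fair to sense a channel with belief `y` until it leaves the best
state. -/
def fairCharge (y : Fin (k + 2) → ℝ) : ℝ :=
  (y ⬝ᵥ m.R * (1 - m.β * m.best.1 (Fin.last (k + 1)))
      + m.β * y (Fin.last (k + 1)) * (m.best.1 ⬝ᵥ m.R)) /
    (1 - m.β * m.best.1 (Fin.last (k + 1)) + m.β * y (Fin.last (k + 1)))

variable (m) in
/-- The value of a channel that was observed in the best state, against the charge `c`. -/
def bestValue (c : ℝ) : ℝ :=
  (m.best.1 ⬝ᵥ m.R - c) / (1 - m.β * m.best.1 (Fin.last (k + 1)))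

theorem one_sub_best_pos : 0 < 1 - m.β * m.best.1 (Fin.last (k + 1)) := by
  have h1 := m.best.apply_le_one (Fin.last (k + 1))
  have h2 := m.best.nonneg (Fin.last (k + 1))
  nlinarith [m.β_pos, m.β_lt]

/-- `bestValue c` is the fixed point of the recursion "sense once more, and go on if state `K` is
seen". -/
theorem charged_best (c : ℝ) : m.charged c (m.bestValue c) m.best.1 = m.bestValue c := by
  have h := one_sub_best_pos (m := m)
  have h1 : m.bestValue c * (1 - m.β * m.best.1 (Fin.last (k + 1))) = m.best.1 ⬝ᵥ m.R - c := by
    rw [bestValue, div_mul_cancel₀ _ h.ne']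
  rw [charged]
  linarith

theorem fairCharge_den_pos (y : m.Bel) :
    0 < 1 - m.β * m.best.1 (Fin.last (k + 1)) + m.β * y.1 (Fin.last (k + 1)) :=
  add_pos_of_pos_of_nonneg one_sub_best_pos (mul_nonneg m.β_pos.le (y.nonneg _))

theorem fairCharge_mul (y : m.Bel) : m.fairCharge y.1 *
    (1 - m.β * m.best.1 (Fin.last (k + 1)) + m.β * y.1 (Fin.last (k + 1)))
    = y.1 ⬝ᵥ m.R * (1 - m.β * m.best.1 (Fin.last (k + 1)))
      + m.β * y.1 (Fin.last (k + 1)) * (m.best.1 ⬝ᵥ m.R) := by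
  rw [fairCharge, div_mul_cancel₀ _ (fairCharge_den_pos y).ne']

theorem charged_fairCharge (y : m.Bel) :
    m.charged (m.fairCharge y.1) (m.bestValue (m.fairCharge y.1)) y.1 = 0 := by
  have h := one_sub_best_pos (m := m)
  have h1 := fairCharge_mul y
  have h2 : m.bestValue (m.fairCharge y.1) * (1 - m.β * m.best.1 (Fin.last (k + 1)))
      = m.best.1 ⬝ᵥ m.R - m.fairCharge y.1 := by
    rw [bestValue, div_mul_cancel₀ _ h.ne']
  rw [charged]
  refine mul_right_cancel₀ h.ne' ?_
  rw [zero_mul, add_mul, sub_mul]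
  linear_combination (-1) * h1 + m.β * y.1 (Fin.last (k + 1)) * h2

theorem bestValue_fairCharge_nonneg (y : m.Bel) : 0 ≤ m.bestValue (m.fairCharge y.1) := by
  refine div_nonneg ?_ one_sub_best_pos.le
  rw [sub_nonneg]
  refine le_of_mul_le_mul_right ?_ (fairCharge_den_pos y)
  rw [fairCharge_mul]
  have h1 := mul_le_mul_of_nonneg_right y.le_best.R_le (one_sub_best_pos (m := m)).le
  linarith

theorem Bel.Le.charged_le {x y : m.Bel} (h : x.Le y) {c a : ℝ} (ha : 0 ≤ a) :
    y.1 ⬝ᵥ m.R - x.1 ⬝ᵥ m.R ≤ m.charged c a y.1 - m.charged c a x.1 := by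
  have h1 := mul_le_mul_of_nonneg_left (mul_le_mul_of_nonneg_right h.apply_last ha) m.β_pos.le
  rw [charged, charged]
  linarith

/-- At the charge `fairCharge y` the belief `y` breaks even, rows below `K` do not exceed zero as
`y` dominates them, and `x` falls short by at least `yR - xR`. The expected discounted time is at
most `1 / (1 - β)`, which turns this shortfall into one of the ratio. -/
theorem ratio_le {x y : m.Bel} (h : x.Le y) (hy : m.second.Le y) {r : ℝ}
    (hr : r ∈ m.ratios x.1) :
    r ≤ m.fairCharge y.1 - (1 - m.β) * (y.1 ⬝ᵥ m.R - x.1 ⬝ᵥ m.R) := by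
  obtain ⟨μ, τ, hμ, hτ, hτ1, rfl⟩ := hr
  have ha := bestValue_fairCharge_nonneg y
  have h0 := charged_fairCharge y
  have h1 := reward_sub_le hμ hτ hτ1 (c := m.fairCharge y.1) ha (charged_best _).le
    (fun i hi => by
      have hle : (m.row i).Le y := (row_le_second hi).trans hy
      have h2 := hle.charged_le (c := m.fairCharge y.1) ha
      have h3 := hle.R_le
      have : m.charged (m.fairCharge y.1) (m.bestValue (m.fairCharge y.1)) (m.row i).1 ≤ 0 := by
        linarith
      exact this)
  have h2 := h.charged_le (c := m.fairCharge y.1) ha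
  have h3 := one_le_discountedBefore hμ hτ hτ1
  have h4 := discountedBefore_le hμ hτ
  have h5 := mul_le_mul_of_nonneg_left h4 (sub_nonneg.mpr h.R_le)
  rw [div_le_iff₀ (by linarith)]
  linarith

/-- The ratio is attained by sensing until a state other than `K` is seen, whenever the PMFs reveal
this. -/
theorem fairCharge_mem_ratios {y : m.Bel} (hy : m.second.Le y) :
    m.fairCharge y.1 ∈ m.ratios y.1 := by
  obtain ⟨μ, hμ⟩ := exists_isMarkovChain m.row_mem y.2.1
  suffices h : ∃ τ, IsStoppingTime (Filtration.natural (sensedPMF m.P y.1)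
      (stronglyMeasurable_sensedPMF m.P y.1)) τ ∧ (∀ z, 1 ≤ τ z) ∧
      ∀ t z, active τ (t + 1) z * m.charged (m.fairCharge y.1)
          (m.bestValue (m.fairCharge y.1)) (m.P (z t))
        = active τ t z * if z t = Fin.last (k + 1) then m.bestValue (m.fairCharge y.1) else 0 by
    obtain ⟨τ, hτ, hτ1, hact⟩ := h
    refine ⟨μ, τ, hμ, hτ, hτ1, ?_⟩
    have h1 := reward_sub_eq hμ hτ hτ1 hact
    rw [charged_fairCharge] at h1
    have h3 := one_le_discountedBefore hμ hτ hτ1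
    rw [eq_div_iff (by linarith)]
    linarith
  classical
  -- Stopping times see only the PMFs. If `P_{K-1} = P_K`, these may not reveal state `K`; but then
  -- `y = P_K`, the continuation value is zero, and stopping at time 1 is as good.
  by_cases hsec : m.second.1 = m.best.1
  · have hyb : y.1 = m.best.1 := by
      refine StLE.antisymm y.le_best ?_ (by rw [y.sum, m.best.sum])
      rw [← hsec]
      exact hy
    have hc : m.bestValue (m.fairCharge y.1) = 0 := by
      have h1 := charged_fairCharge y
      have h2 := charged_best (m := m) (m.fairCharge y.1)
      rw [← h2, ← hyb, h1]
    refine ⟨fun _ => (1 : ℕ), isStoppingTime_const _ 1, fun _ => le_rfl, fun t z => ?_⟩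
    have : active (fun _ => ((1 : ℕ) : WithTop ℕ)) (t + 1) z = 0 := by
      rw [active, if_neg]
      rw [not_lt]
      exact_mod_cast Nat.le_add_left 1 t
    rw [this, hc]
    simp
  -- Otherwise only row `K` equals `P_K`, since all other rows are below `P_{K-1}`. So the first PMF
  -- after time 0 that differs from `P_K` marks the first other state.
  · have hrow : ∀ i, m.P i = m.best.1 ↔ i = Fin.last (k + 1) := by
      intro i
      constructor
      · intro hi
        by_contra hne
        refine hsec (StLE.antisymm m.second.le_best ?_ (by rw [m.second.sum, m.best.sum]))
        rw [← hi]
        exact row_le_second hne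
      · rintro rfl
        rfl
    have hiff : ∀ (t : ℕ) (z : ℕ → Fin (k + 2)),
        (t : WithTop ℕ) < hittingAfter (sensedPMF m.P y.1) {m.best.1}ᶜ 1 z
          ↔ ∀ s < t, z s = Fin.last (k + 1) := by
      intro t z
      rw [← not_le]
      refine (not_congr (hittingAfter_le_iff (u := sensedPMF m.P y.1) (s := {m.best.1}ᶜ) (n := 1)
        (i := t) (ω := z))).trans ?_
      simp only [Set.mem_Icc, Set.mem_compl_iff, Set.mem_singleton_iff, not_exists, not_and,
        not_not, and_imp]
      constructor
      · intro h s hs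
        exact (hrow _).mp (h (s + 1) (by omega) (by omega))
      · intro h j hj1 hj2
        obtain ⟨s, rfl⟩ : ∃ s, j = s + 1 := ⟨j - 1, by omega⟩
        exact (hrow _).mpr (h s (by omega))
    refine ⟨hittingAfter (sensedPMF m.P y.1) {m.best.1}ᶜ 1, ?_, fun z => ?_, fun t z => ?_⟩
    · refine Adapted.isStoppingTime_hittingAfter ?_ (measurableSet_singleton _).compl
      exact (Filtration.stronglyAdapted_natural _).adapted
    · exact_mod_cast le_hittingAfter (u := sensedPMF m.P y.1) (s := {m.best.1}ᶜ) (n := 1) z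
    · simp only [active, hiff]
      by_cases hz : z t = Fin.last (k + 1)
      · have e : (∀ s < t + 1, z s = Fin.last (k + 1)) ↔ ∀ s < t, z s = Fin.last (k + 1) := by
          constructor
          · intro h s hs
            exact h s (by omega)
          · intro h s hs
            rcases Nat.lt_succ_iff_lt_or_eq.mp hs with h1 | rfl
            · exact h s h1
            · exact hz
        have hb : m.charged (m.fairCharge y.1) (m.bestValue (m.fairCharge y.1))
            (m.P (Fin.last (k + 1))) = m.bestValue (m.fairCharge y.1) := charged_best _
        simp only [e]
        rw [hz, if_pos rfl, hb]
      · have e : ¬ ∀ s < t + 1, z s = Fin.last (k + 1) := fun h => hz (h t (by omega))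
        rw [if_neg e, if_neg hz, zero_mul, mul_zero]

/-- The Gittins index of a belief above `P_{K-1}` exceeds that of any belief that it dominates, by
at least a multiple of the difference of the immediate rewards. -/
theorem gittinsIndex_le {x y : m.Bel} (h : x.Le y) (hy : m.second.Le y) :
    gittinsIndex m.β m.P m.R x.1
      ≤ gittinsIndex m.β m.P m.R y.1 - (1 - m.β) * (y.1 ⬝ᵥ m.R - x.1 ⬝ᵥ m.R) := by
  have h1 : gittinsIndex m.β m.P m.R x.1
      ≤ m.fairCharge y.1 - (1 - m.β) * (y.1 ⬝ᵥ m.R - x.1 ⬝ᵥ m.R) :=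
    csSup_le (ratios_nonempty x) fun r hr => ratio_le h hy hr
  have h2 : m.fairCharge y.1 ≤ gittinsIndex m.β m.P m.R y.1 :=
    le_csSup ⟨_, fun r hr => ratio_le (Bel.Le.refl y) hy hr⟩ (fairCharge_mem_ratios hy)
  linarith

end SensingModel
end ChannelSensing
end

/-! ### The law of histories, the information state, and the value of a policy. -/

noncomputable section

namespace ChannelSensing

variable {k N : ℕ}

section ProductSums

/-- Sums over product distributions with one coordinate singled out. -/
theorem sum_prod_mul_apply {κ : Type*} [Fintype κ] (b : Fin N → κ → ℝ) (n : Fin N)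
    (hb : ∀ j, j ≠ n → ∑ i, b j i = 1) (f : κ → ℝ) :
    ∑ s : Fin N → κ, (∏ j, b j (s j)) * f (s n) = ∑ i, b n i * f i := by
  have h := Finset.prod_univ_sum (fun _ : Fin N => (Finset.univ : Finset κ))
    (fun j i => b j i * if j = n then f i else 1)
  rw [Fintype.piFinset_univ] at h
  have e : ∀ s : Fin N → κ, ∏ j, (b j (s j) * if j = n then f (s j) else 1)
      = (∏ j, b j (s j)) * f (s n) := by
    intro s
    rw [Finset.prod_mul_distrib, Finset.prod_ite_eq' Finset.univ n (fun j => f (s j)),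
      if_pos (Finset.mem_univ _)]
  simp only [e] at h
  rw [← h]
  rw [Finset.prod_eq_single n]
  · simp
  · intro j _ hj
    simpa [hj] using hb j hj
  · simp

theorem sum_prod_eq_one {κ : Type*} [Fintype κ] (b : Fin N → κ → ℝ)
    (hb : ∀ j, ∑ i, b j i = 1) : ∑ s : Fin N → κ, ∏ j, b j (s j) = 1 := by
  have h := Finset.prod_univ_sum (fun _ : Fin N => (Finset.univ : Finset κ)) b
  rw [Fintype.piFinset_univ] at h
  rw [← h]
  simp [hb]

end ProductSums

section History

variable {Ω : Type*} (X : Fin N → ℕ → Ω → Fin (k + 2))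

/-- The states of all channels. -/
def joint (t : ℕ) (ω : Ω) : Fin N → Fin (k + 2) := fun n => X n t ω

variable {X}

theorem length_history (g : Policy N k) (t : ℕ) (ω : Ω) : (history X g t ω).length = t := by
  induction t with
  | zero => rfl
  | succ t ih => simp [history, ih]

/-- Makes every event about the history depend on finitely many joint states, hence measurable and
accessible to the Markov property. -/
theorem history_eq_past (g : Policy N k) (t : ℕ) :
    ∃ H : (Fin t → Fin N → Fin (k + 2)) → List (Fin N × Fin (k + 2)),
      ∀ ω, history X g t ω = H (past (joint X) t ω) := by
  induction t with
  | zero => exact ⟨fun _ => [], fun _ => rfl⟩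
  | succ t ih =>
    obtain ⟨H, hH⟩ := ih
    refine ⟨fun w => (g (H fun i => w i.castSucc), w (Fin.last t) (g (H fun i => w i.castSucc)))
      :: H fun i => w i.castSucc, fun ω => ?_⟩
    have : (fun i : Fin t => past (joint X) (t + 1) ω i.castSucc) = past (joint X) t ω := rfl
    simp only [history, this, hH]
    rfl

theorem abs_reward_le (R : Fin (k + 2) → ℝ) (g : Policy N k) (t : ℕ) (ω : Ω) :
    |reward R X g t ω| ≤ ∑ i, |R i| :=
  Finset.single_le_sum (f := fun i => |R i|) (fun _ _ => abs_nonneg _) (Finset.mem_univ _)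

variable [MeasurableSpace Ω]

theorem measurable_joint (hX : ∀ n t, Measurable (X n t)) (t : ℕ) : Measurable (joint X t) :=
  measurable_pi_iff.mpr fun n => hX n t

theorem measurableSet_history (hX : ∀ n t, Measurable (X n t)) (g : Policy N k) (t : ℕ)
    (h : List (Fin N × Fin (k + 2))) : MeasurableSet {ω | history X g t ω = h} := by
  obtain ⟨H, hH⟩ := history_eq_past (X := X) g t
  simp only [hH]
  exact measurable_past (measurable_joint hX) t (MeasurableSet.of_discrete (s := {w | H w = h}))

theorem measurable_reward (hX : ∀ n t, Measurable (X n t)) (R : Fin (k + 2) → ℝ)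
    (g : Policy N k) (t : ℕ) : Measurable (reward R X g t) := by
  obtain ⟨H, hH⟩ := history_eq_past (X := X) g t
  have : reward R X g t = (fun w : Fin (t + 1) → Fin N → Fin (k + 2) =>
      R (w (Fin.last t) (g (H fun i => w i.castSucc)))) ∘ past (joint X) (t + 1) := by
    funext ω
    simp only [reward, choice, hH]
    rfl
  rw [this]
  exact (measurable_of_finite _).comp (measurable_past (measurable_joint hX) _)

theorem integrable_reward {μ : Measure Ω} [IsFiniteMeasure μ] (hX : ∀ n t, Measurable (X n t))
    (R : Fin (k + 2) → ℝ) (g : Policy N k) (t : ℕ) : Integrable (reward R X g t) μ :=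
  Integrable.of_bound (measurable_reward hX R g t).aestronglyMeasurable _
    (ae_of_all _ fun ω => abs_reward_le R g t ω)

/-- Independent channels form a Markov chain. -/
theorem chainLaw_joint {μ : Measure Ω} {P : Matrix (Fin (k + 2)) (Fin (k + 2)) ℝ}
    {π₀ : Fin N → Fin (k + 2) → ℝ} (hX : ∀ n, IsMarkovChain μ (π₀ n) P (X n))
    (hind : iIndepFun (fun n ω t => X n t ω) μ) :
    ChainLaw μ (fun s => ∏ n, π₀ n (s n)) (fun s s' => ∏ n, P (s n) (s' n)) (joint X) := by
  intro T y
  have h1 := hind.measure_inter_preimage_eq_mul Finset.univ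
    (sets := fun n => {z : ℕ → Fin (k + 2) | ∀ t ≤ T, z t = y t n}) (fun n _ => by
      simp only [Set.ofPred_forall]
      exact MeasurableSet.iInter fun t => MeasurableSet.iInter fun _ =>
        measurableSet_eq_fun (measurable_pi_apply t) measurable_const)
  have h2 : {ω | ∀ t ≤ T, joint X t ω = y t} = ⋂ n ∈ (Finset.univ : Finset (Fin N)),
      (fun ω t => X n t ω) ⁻¹' {z : ℕ → Fin (k + 2) | ∀ t ≤ T, z t = y t n} := by
    ext ω
    simp only [Set.mem_ofPred_eq, joint, funext_iff, Set.mem_iInter, Finset.mem_univ,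
      Set.mem_preimage, forall_true_left]
    exact ⟨fun h n t ht => h t ht n, fun h t ht n => h n t ht⟩
  rw [measureReal_def, h2, h1, ENNReal.toReal_prod, Finset.prod_comm, ← Finset.prod_mul_distrib]
  exact Finset.prod_congr rfl fun n _ => (hX n).law T fun t => y t n

end History

namespace SensingModel

variable {m : SensingModel k}

variable (m) in
/-- The beliefs about all channels after a history of observations. -/
def beliefs (π₀ : Fin N → m.Bel) : List (Fin N × Fin (k + 2)) → Fin N → m.Bel
  | [], n => π₀ n
  | (u, y) :: h, n => if n = u then m.row y else (beliefs π₀ h n).step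

/-- The probability of a history under a policy. -/
def weight (π₀ : Fin N → m.Bel) (g : Policy N k) : List (Fin N × Fin (k + 2)) → ℝ
  | [] => 1
  | (u, y) :: h => if g h = u then weight π₀ g h * (m.beliefs π₀ h u).1 y else 0

/-- One filtering step: product laws stay product laws. The sensed channel contributes the
likelihood of `y` and restarts from its row; the others evolve by `P`. -/
theorem sum_beliefs_transition (π₀ : Fin N → m.Bel) (h : List (Fin N × Fin (k + 2))) (u : Fin N)
    (y : Fin (k + 2)) (s' : Fin N → Fin (k + 2)) :
    ∑ s : Fin N → Fin (k + 2), (∏ n, (m.beliefs π₀ h n).1 (s n)) *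
      ((if s u = y then 1 else 0) * ∏ n, m.P (s n) (s' n))
      = (m.beliefs π₀ h u).1 y * ∏ n, (m.beliefs π₀ ((u, y) :: h) n).1 (s' n) := by
  have h1 := Finset.prod_univ_sum (fun _ : Fin N => (Finset.univ : Finset (Fin (k + 2))))
    (fun n i => (m.beliefs π₀ h n).1 i * ((if n = u then (if i = y then 1 else 0) else 1) *
      m.P i (s' n)))
  rw [Fintype.piFinset_univ] at h1
  have e : ∀ s : Fin N → Fin (k + 2), ∏ n, ((m.beliefs π₀ h n).1 (s n) *
      ((if n = u then (if s n = y then (1 : ℝ) else 0) else 1) * m.P (s n) (s' n)))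
      = (∏ n, (m.beliefs π₀ h n).1 (s n)) *
      ((if s u = y then 1 else 0) * ∏ n, m.P (s n) (s' n)) := by
    intro s
    rw [Finset.prod_mul_distrib, Finset.prod_mul_distrib,
      Finset.prod_ite_eq' Finset.univ u (fun n => if s n = y then (1 : ℝ) else 0),
      if_pos (Finset.mem_univ _)]
  simp only [e] at h1
  rw [← h1]
  have e2 : ∀ n, ∑ i, (m.beliefs π₀ h n).1 i *
      ((if n = u then (if i = y then (1 : ℝ) else 0) else 1) * m.P i (s' n))
      = (if n = u then (m.beliefs π₀ h n).1 y else 1) *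
        (m.beliefs π₀ ((u, y) :: h) n).1 (s' n) := by
    intro n
    rw [beliefs]
    by_cases hn : n = u
    · simp [hn, row]
    · simp only [hn, if_false, one_mul]
      rfl
  simp only [e2]
  rw [Finset.prod_mul_distrib, Finset.prod_ite_eq' Finset.univ u
    (fun n => (m.beliefs π₀ h n).1 y), if_pos (Finset.mem_univ _)]

section Law

variable {Ω : Type*} [MeasurableSpace Ω] {μ : Measure Ω} [IsProbabilityMeasure μ]
  {X : Fin N → ℕ → Ω → Fin (k + 2)} {π₀ : Fin N → m.Bel}

/-- Given the history, the channels are independent and distributed according to the beliefs. -/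
theorem setIntegral_history (hX : ∀ n, IsMarkovChain μ (π₀ n).1 m.P (X n))
    (hind : iIndepFun (fun n ω t => X n t ω) μ) (g : Policy N k) (t : ℕ) :
    ∀ h : List (Fin N × Fin (k + 2)), h.length = t → ∀ F : (Fin N → Fin (k + 2)) → ℝ,
    ∫ ω in {ω | history X g t ω = h}, F (joint X t ω) ∂μ
      = weight π₀ g h * ∑ s, (∏ n, (m.beliefs π₀ h n).1 (s n)) * F s := by
  have hmeas : ∀ n t, Measurable (X n t) := fun n t => (hX n).measurable t
  have hlaw := chainLaw_joint hX hind
  induction t with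
  | zero =>
    intro h hh F
    obtain rfl := List.length_eq_zero_iff.mp hh
    have : {ω | history X g 0 ω = []} = Set.univ := by
      ext ω
      simp [history]
    rw [this, setIntegral_univ, hlaw.integral_zero (measurable_joint hmeas)]
    simp [weight, beliefs]
  | succ t ih =>
    intro h hh F
    cases h with
    | nil => simp at hh
    | cons a h =>
      obtain ⟨u, y⟩ := a
      have hset : ∀ ω, history X g (t + 1) ω = (u, y) :: h
          ↔ history X g t ω = h ∧ g h = u ∧ X u t ω = y := by
        intro ω
        simp only [history, List.cons.injEq, Prod.mk.injEq]
        constructor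
        · rintro ⟨⟨h1, h2⟩, rfl⟩
          subst h1
          exact ⟨rfl, rfl, h2⟩
        · rintro ⟨rfl, rfl, h2⟩
          exact ⟨⟨rfl, h2⟩, rfl⟩
      rw [weight]
      by_cases hu : g h = u
      · rw [if_pos hu]
        obtain ⟨H, hH⟩ := history_eq_past (X := X) g t
        have h1 := hlaw.integral_mul (measurable_joint hmeas) t
          (fun w => if H (fun i => w i.castSucc) = h ∧ w (Fin.last t) u = y then 1 else 0) F
        have e1 : ∀ ω, (fun i : Fin t => past (joint X) (t + 1) ω i.castSucc)
          = past (joint X) t ω := fun ω => rfl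
        have e2 : ∀ ω, past (joint X) (t + 1) ω (Fin.last t) u = X u t ω := fun ω => rfl
        simp only [e1, ← hH, e2] at h1
        have h2 : ∫ ω in {ω | history X g (t + 1) ω = (u, y) :: h}, F (joint X (t + 1) ω) ∂μ
            = ∫ ω, (if history X g t ω = h ∧ X u t ω = y then 1 else 0)
              * F (joint X (t + 1) ω) ∂μ := by
          rw [← integral_indicator (measurableSet_history hmeas g (t + 1) _)]
          congr 1
          ext ω
          by_cases hc : history X g t ω = h ∧ X u t ω = y
          · have : history X g (t + 1) ω = (u, y) :: h := (hset ω).mpr ⟨hc.1, hu, hc.2⟩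
            simp [Set.indicator, this, hc]
          · have : ¬ history X g (t + 1) ω = (u, y) :: h := fun h' =>
              hc ⟨((hset ω).mp h').1, ((hset ω).mp h').2.2⟩
            simp [Set.indicator, this, hc]
        have h3 : ∫ ω, (if history X g t ω = h ∧ X u t ω = y then (1 : ℝ) else 0)
              * ∑ j, (∏ n, m.P (joint X t ω n) (j n)) * F j ∂μ
            = ∫ ω in {ω | history X g t ω = h}, (if joint X t ω u = y then (1 : ℝ) else 0) *
              ∑ j, (∏ n, m.P (joint X t ω n) (j n)) * F j ∂μ := by
          rw [← integral_indicator (measurableSet_history hmeas g t _)]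
          congr 1
          ext ω
          have e3 : joint X t ω u = X u t ω := rfl
          by_cases hc : history X g t ω = h
          · simp [Set.indicator, hc, e3]
          · simp [Set.indicator, hc]
        rw [h2, h1, h3, ih h (by simpa using hh) fun s => (if s u = y then (1 : ℝ) else 0) *
              ∑ j, (∏ n, m.P (s n) (j n)) * F j, mul_assoc]
        congr 1
        rw [Finset.mul_sum]
        simp_rw [← mul_assoc _ _ (F _), ← sum_beliefs_transition, Finset.mul_sum, Finset.sum_mul]
        rw [Finset.sum_comm]
        refine Finset.sum_congr rfl fun s' _ => Finset.sum_congr rfl fun s _ => ?_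
        ring
      · have : {ω | history X g (t + 1) ω = (u, y) :: h} = ∅ := by
          ext ω
          simp only [Set.mem_ofPred_eq, hset, Set.mem_empty_iff_false, iff_false]
          exact fun h' => hu h'.2.1
        rw [this, if_neg hu]
        simp

theorem setIntegral_history_apply (hX : ∀ n, IsMarkovChain μ (π₀ n).1 m.P (X n))
    (hind : iIndepFun (fun n ω t => X n t ω) μ) (g : Policy N k)
    (h : List (Fin N × Fin (k + 2))) (n : Fin N) (f : Fin (k + 2) → ℝ) :
    ∫ ω in {ω | history X g h.length ω = h}, f (X n h.length ω) ∂μ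
      = weight π₀ g h * ((m.beliefs π₀ h n).1 ⬝ᵥ f) := by
  have h1 := setIntegral_history hX hind g h.length h rfl fun s => f (s n)
  rw [sum_prod_mul_apply _ n fun j _ => Bel.sum _] at h1
  exact h1

theorem real_history (hX : ∀ n, IsMarkovChain μ (π₀ n).1 m.P (X n))
    (hind : iIndepFun (fun n ω t => X n t ω) μ) (g : Policy N k)
    (h : List (Fin N × Fin (k + 2))) :
    μ.real {ω | history X g h.length ω = h} = weight π₀ g h := by
  have h1 := setIntegral_history hX hind g h.length h rfl fun _ => 1
  simp only [mul_one] at h1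
  rw [sum_prod_eq_one _ fun n => Bel.sum _] at h1
  simpa using h1

/-- There are countably many histories, and each one of weight zero is a null event. -/
theorem ae_weight_pos (hX : ∀ n, IsMarkovChain μ (π₀ n).1 m.P (X n))
    (hind : iIndepFun (fun n ω t => X n t ω) μ) (g : Policy N k) (t : ℕ) :
    ∀ᵐ ω ∂μ, weight π₀ g (history X g t ω) ≠ 0 := by
  have : ∀ᵐ ω ∂μ, ∀ h : List (Fin N × Fin (k + 2)), h.length = t → weight π₀ g h = 0 →
      history X g t ω ≠ h := by
    rw [ae_all_iff]
    intro h
    by_cases hh : h.length = t ∧ weight π₀ g h = 0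
    · obtain ⟨rfl, hw⟩ := hh
      have h1 := real_history hX hind g h
      rw [hw, measureReal_def, ENNReal.toReal_eq_zero_iff] at h1
      have h2 : μ {ω | history X g h.length ω = h} = 0 := h1.resolve_right (measure_ne_top _ _)
      have h3 : ∀ᵐ ω ∂μ, ¬ history X g h.length ω = h := by
        rw [ae_iff]
        simpa using h2
      filter_upwards [h3] with ω hω _ _
      exact hω
    · exact ae_of_all _ fun ω h1 h2 => absurd ⟨h1, h2⟩ hh
  filter_upwards [this] with ω hω h0
  exact hω _ (length_history g t ω) h0 rfl

theorem belief_eq (hX : ∀ n, IsMarkovChain μ (π₀ n).1 m.P (X n))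
    (hind : iIndepFun (fun n ω t => X n t ω) μ) (g : Policy N k) (t : ℕ) (ω : Ω)
    (hw : weight π₀ g (history X g t ω) ≠ 0) :
    belief μ X g t ω = fun n => (m.beliefs π₀ (history X g t ω) n).1 := by
  have hmeas : ∀ n t, Measurable (X n t) := fun n t => (hX n).measurable t
  set h := history X g t ω with hh
  have hl : h.length = t := length_history g t ω
  funext n i
  have h1 := real_history hX hind g h
  have h2 := setIntegral_history_apply hX hind g h n (Pi.single i 1)
  rw [hl] at h1 h2
  have hs : MeasurableSet {ω' | X n t ω' = i} := hmeas n t (measurableSet_singleton i)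
  have h3 : ∫ ω in {ω | history X g t ω = h}, (Pi.single i 1 : Fin (k + 2) → ℝ) (X n t ω) ∂μ
      = μ.real ({ω | history X g t ω = h} ∩ {ω' | X n t ω' = i}) := by
    have : ∀ ω, (Pi.single i 1 : Fin (k + 2) → ℝ) (X n t ω)
        = {ω' | X n t ω' = i}.indicator (fun _ => (1 : ℝ)) ω := by
      intro ω
      by_cases hc : X n t ω = i
      · simp [hc]
      · simp [hc]
    simp only [this]
    rw [integral_indicator hs, Measure.restrict_restrict hs, Set.inter_comm]
    simp
  rw [belief, measureReal_def, cond_apply (measurableSet_history hmeas g t _), ENNReal.toReal_mul,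
    ENNReal.toReal_inv]
  rw [h3] at h2
  rw [← hh]
  change (μ.real _)⁻¹ * μ.real _ = _
  rw [h1, h2, ← mul_assoc, inv_mul_cancel₀ hw, one_mul]
  simp

/-- The expected discounted reward collected by a policy over `T` steps after a history. -/
def value (π₀ : Fin N → m.Bel) (g : Policy N k) : ℕ → List (Fin N × Fin (k + 2)) → ℝ
  | 0, _ => 0
  | T + 1, h => (m.beliefs π₀ h (g h)).1 ⬝ᵥ m.R
      + m.β * ∑ i, (m.beliefs π₀ h (g h)).1 i * value π₀ g T ((g h, i) :: h)

theorem integrable_sum_reward (hX : ∀ n t, Measurable (X n t)) (g : Policy N k) (t T : ℕ) :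
    Integrable (fun ω => ∑ s ∈ Finset.range T, m.β ^ s * reward m.R X g (t + s) ω) μ :=
  integrable_finsetSum _ fun s _ => (integrable_reward hX m.R g (t + s)).const_mul _

theorem setIntegral_reward (hX : ∀ n, IsMarkovChain μ (π₀ n).1 m.P (X n))
    (hind : iIndepFun (fun n ω t => X n t ω) μ) (g : Policy N k) (T : ℕ) :
    ∀ h : List (Fin N × Fin (k + 2)), ∫ ω in {ω | history X g h.length ω = h},
      ∑ s ∈ Finset.range T, m.β ^ s * reward m.R X g (h.length + s) ω ∂μ
      = weight π₀ g h * value π₀ g T h := by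
  have hmeas : ∀ n t, Measurable (X n t) := fun n t => (hX n).measurable t
  induction T with
  | zero => simp [value]
  | succ T ih =>
    intro h
    have e1 : ∀ ω, ∑ s ∈ Finset.range (T + 1), m.β ^ s * reward m.R X g (h.length + s) ω
        = reward m.R X g h.length ω + m.β * ∑ s ∈ Finset.range T,
          m.β ^ s * reward m.R X g (h.length + 1 + s) ω := by
      intro ω
      rw [Finset.sum_range_succ', Finset.mul_sum, add_comm]
      congr 1
      · simp
      · refine Finset.sum_congr rfl fun s _ => ?_
        rw [pow_succ', mul_assoc, add_assoc, add_comm 1 s]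
    simp only [e1]
    rw [integral_add (integrable_reward hmeas m.R g _).integrableOn
      ((integrable_sum_reward hmeas g _ T).const_mul _).integrableOn, integral_const_mul]
    have h1 : ∫ ω in {ω | history X g h.length ω = h}, reward m.R X g h.length ω ∂μ
        = weight π₀ g h * ((m.beliefs π₀ h (g h)).1 ⬝ᵥ m.R) := by
      rw [← setIntegral_history_apply hX hind g h (g h) m.R]
      refine setIntegral_congr_fun (measurableSet_history hmeas g _ _) fun ω hω => ?_
      have : history X g h.length ω = h := hω
      simp only [reward, choice, this]
    have h2 : {ω | history X g h.length ω = h}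
        = ⋃ i, {ω | history X g (h.length + 1) ω = (g h, i) :: h} := by
      ext ω
      simp only [Set.mem_ofPred_eq, Set.mem_iUnion, history, List.cons.injEq, Prod.mk.injEq]
      constructor
      · intro hω
        exact ⟨X (g h) h.length ω, by rw [hω]; exact ⟨⟨rfl, rfl⟩, rfl⟩⟩
      · rintro ⟨i, _, hω⟩
        exact hω
    have h3 : ∫ ω in {ω | history X g h.length ω = h}, ∑ s ∈ Finset.range T,
          m.β ^ s * reward m.R X g (h.length + 1 + s) ω ∂μ
        = ∑ i, weight π₀ g h * ((m.beliefs π₀ h (g h)).1 i * value π₀ g T ((g h, i) :: h)) := by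
      rw [h2, integral_iUnion_fintype (fun i => measurableSet_history hmeas g _ _) ?_
        fun i => (integrable_sum_reward hmeas g _ T).integrableOn]
      · refine Finset.sum_congr rfl fun i _ => ?_
        have := ih ((g h, i) :: h)
        rw [List.length_cons] at this
        rw [this, weight, if_pos rfl, mul_assoc]
      · intro i j hij
        rw [Function.onFun, Set.disjoint_left]
        intro ω h1 h2
        have h3 : history X g (h.length + 1) ω = (g h, i) :: h := h1
        have h4 : history X g (h.length + 1) ω = (g h, j) :: h := h2
        rw [h3] at h4
        simp only [List.cons.injEq, Prod.mk.injEq, true_and, and_true] at h4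
        exact hij h4
    rw [h1, h3, value, ← Finset.mul_sum]
    ring

theorem finiteReward_eq (hX : ∀ n, IsMarkovChain μ (π₀ n).1 m.P (X n))
    (hind : iIndepFun (fun n ω t => X n t ω) μ) (g : Policy N k) (T : ℕ) :
    finiteReward μ m.β m.R X T g = value π₀ g (T + 1) [] := by
  have h := setIntegral_reward hX hind g (T + 1) []
  have : {ω | history X g ([] : List (Fin N × Fin (k + 2))).length ω = []} = Set.univ := by
    ext ω
    simp [history]
  rw [this, setIntegral_univ, weight, one_mul] at h
  rw [← h, finiteReward]
  simp

/-- Rewards are bounded, so the discounted series may be integrated term by term. -/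
theorem tendsto_finiteReward (hX : ∀ n t, Measurable (X n t)) (g : Policy N k) :
    Filter.Tendsto (fun T => finiteReward μ m.β m.R X T g) Filter.atTop
      (nhds (infiniteReward μ m.β m.R X g)) := by
  have hint : ∀ t, Integrable (fun ω => m.β ^ t * reward m.R X g t ω) μ := fun t =>
    (integrable_reward hX m.R g t).const_mul _
  have hb : ∀ t ω, ‖m.β ^ t * reward m.R X g t ω‖ ≤ m.β ^ t * ∑ i, |m.R i| := by
    intro t ω
    rw [norm_mul, norm_pow, Real.norm_of_nonneg m.β_pos.le]
    exact mul_le_mul_of_nonneg_left (abs_reward_le m.R g t ω) (pow_nonneg m.β_pos.le t)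
  have hsum : Summable fun t => ∫ ω, ‖m.β ^ t * reward m.R X g t ω‖ ∂μ := by
    refine Summable.of_nonneg_of_le (fun t => integral_nonneg fun y => norm_nonneg _)
      (fun t => ?_) ((summable_geometric_of_lt_one m.β_pos.le m.β_lt).mul_right (∑ i, |m.R i|))
    calc _ ≤ ∫ _, m.β ^ t * ∑ i, |m.R i| ∂μ :=
          integral_mono (hint t).norm (integrable_const _) (hb t)
      _ = m.β ^ t * ∑ i, |m.R i| := by simp
  have h := (hasSum_integral_of_summable_integral_norm hint hsum).tendsto_sum_nat
  rw [← Filter.tendsto_add_atTop_iff_nat 1] at h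
  refine h.congr fun T => ?_
  rw [finiteReward, integral_finsetSum _ fun t _ => hint t]

end Law

end SensingModel
end ChannelSensing
end

/-! ### Rankings, optimality of greedy policies, and greediness of the index rule. -/

noncomputable section

namespace ChannelSensing
namespace SensingModel

variable {k N : ℕ} {m : SensingModel k}

theorem W_append_cons_eq (t : ℕ) (B : List m.Bel) (x : m.Bel) : ∀ (Z C : List m.Bel),
    (∀ z ∈ Z, x.Le z ∧ x.1 ⬝ᵥ m.R = z.1 ⬝ᵥ m.R) →
    W t (C ++ x :: (Z ++ B)) = W t (C ++ (Z ++ x :: B)) := by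
  intro Z
  induction Z with
  | nil => intro C _; rfl
  | cons z Z ih =>
    intro C h
    have hz := h z List.mem_cons_self
    have h1 := ih (C ++ [z]) fun w hw => h w (List.mem_cons_of_mem _ hw)
    simp only [List.append_assoc, List.singleton_append] at h1
    exact (W_swap_eq t C (Z ++ B) hz.1 hz.2).trans h1

/-- The list `ℓ` enumerates all channels from the stochastically largest to the smallest. -/
structure IsRanking (b : Fin N → m.Bel) (ℓ : List (Fin N)) : Prop where
  nodup : ℓ.Nodup
  mem : ∀ n, n ∈ ℓ
  sorted : (ℓ.map b).Pairwise fun x y => y.Le x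

theorem exists_isRanking (b : Fin N → m.Bel) (hb : ∀ n n', (b n).Le (b n') ∨ (b n').Le (b n)) :
    ∃ ℓ, IsRanking b ℓ := by
  classical
  let r : Fin N → Fin N → Prop := fun n n' => (b n').Le (b n)
  have : Std.Total r := ⟨fun n n' => hb n' n⟩
  have : IsTrans (Fin N) r := ⟨fun _ _ _ h h' => Bel.Le.trans h' h⟩
  have hp := List.perm_insertionSort r (List.finRange N)
  refine ⟨List.insertionSort r (List.finRange N), hp.nodup_iff.mpr (List.nodup_finRange N),
    fun n => hp.mem_iff.mpr (List.mem_finRange n), ?_⟩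
  rw [List.pairwise_map]
  exact List.pairwise_insertionSort r _

theorem IsRanking.exists_largest {b : Fin N → m.Bel} {ℓ : List (Fin N)} (hℓ : IsRanking b ℓ)
    (hN : 0 < N) : ∃ n, ∀ n', (b n').Le (b n) := by
  cases ℓ with
  | nil => exact absurd (hℓ.mem ⟨0, hN⟩) List.not_mem_nil
  | cons n ℓ =>
    refine ⟨n, fun n' => ?_⟩
    have hs := hℓ.sorted
    rw [List.map_cons, List.pairwise_cons] at hs
    rcases List.mem_cons.mp (hℓ.mem n') with rfl | h
    · exact Bel.Le.refl _
    · exact hs.1 _ (List.mem_map_of_mem h)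

theorem beliefs_cons_of_ne (π₀ : Fin N → m.Bel) {u n : Fin N} (y : Fin (k + 2))
    (h : List (Fin N × Fin (k + 2))) (hn : n ≠ u) :
    m.beliefs π₀ ((u, y) :: h) n = (m.beliefs π₀ h n).step := if_neg hn

theorem beliefs_cons_self (π₀ : Fin N → m.Bel) (u : Fin N) (y : Fin (k + 2))
    (h : List (Fin N × Fin (k + 2))) :
    m.beliefs π₀ ((u, y) :: h) u = m.row y := if_pos rfl

/-- Keeps dominance total along every history: a new observation is either above or below all
unsensed channels. -/
theorem row_comparable_step (i : Fin (k + 2)) (x : m.Bel) :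
    (m.row i).Le x.step ∨ x.step.Le (m.row i) := by
  by_cases hi : i = Fin.last (k + 1)
  · subst hi
    exact Or.inr x.step.le_best
  · exact Or.inl (row_le_step hi x)

theorem beliefs_comparable {π₀ : Fin N → m.Bel}
    (hπ : ∀ n n', (π₀ n).Le (π₀ n') ∨ (π₀ n').Le (π₀ n)) (h : List (Fin N × Fin (k + 2))) :
    ∀ n n', (m.beliefs π₀ h n).Le (m.beliefs π₀ h n') ∨
      (m.beliefs π₀ h n').Le (m.beliefs π₀ h n) := by
  induction h with
  | nil => exact hπ
  | cons a h ih =>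
    obtain ⟨u, y⟩ := a
    intro n n'
    by_cases hn : n = u
    · subst hn
      by_cases hn' : n' = n
      · subst hn'
        exact Or.inl (Bel.Le.refl _)
      · rw [beliefs_cons_self, beliefs_cons_of_ne _ _ _ hn']
        exact row_comparable_step _ _
    · rw [beliefs_cons_of_ne _ _ _ hn]
      by_cases hn' : n' = u
      · subst hn'
        rw [beliefs_cons_self]
        exact (row_comparable_step _ _).symm
      · rw [beliefs_cons_of_ne _ _ _ hn']
        exact (ih n n').imp Bel.Le.step Bel.Le.step

/-- After an observation, the sensed channel moves to the top or to the bottom of the ranking. -/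
theorem IsRanking.cons {π₀ : Fin N → m.Bel} {h : List (Fin N × Fin (k + 2))} {A B : List (Fin N)}
    {u : Fin N} (hℓ : IsRanking (m.beliefs π₀ h) (A ++ u :: B)) (y : Fin (k + 2)) :
    ∃ ℓ, IsRanking (m.beliefs π₀ ((u, y) :: h)) ℓ ∧
      ℓ.map (m.beliefs π₀ ((u, y) :: h))
        = place y (((A ++ B).map (m.beliefs π₀ h)).map Bel.step) := by
  have hperm : (A ++ u :: B).Perm (u :: (A ++ B)) := List.perm_middle
  have hnd := hperm.nodup_iff.mp hℓ.nodup
  have hu : u ∉ A ++ B := (List.nodup_cons.mp hnd).1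
  have hmem : ∀ n, n ∈ u :: (A ++ B) := fun n => hperm.mem_iff.mp (hℓ.mem n)
  have hmap : (A ++ B).map (m.beliefs π₀ ((u, y) :: h))
      = ((A ++ B).map (m.beliefs π₀ h)).map Bel.step := by
    rw [List.map_map]
    exact List.map_congr_left fun n hn =>
      beliefs_cons_of_ne π₀ y h fun e => hu (e ▸ hn)
  have hsort : (((A ++ B).map (m.beliefs π₀ h)).map Bel.step).Pairwise fun x y => y.Le x := by
    rw [List.pairwise_map]
    have hs : (A ++ B).Sublist (A ++ u :: B) :=
      List.Sublist.append_left (List.sublist_cons_self u B) A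
    exact (hℓ.sorted.sublist (hs.map _)).imp fun h => Bel.Le.step h
  by_cases hy : y = Fin.last (k + 1)
  · subst hy
    refine ⟨u :: (A ++ B), ⟨hnd, hmem, ?_⟩, ?_⟩
    · rw [List.map_cons, hmap, List.pairwise_cons, beliefs_cons_self]
      exact ⟨fun x _ => x.le_best, hsort⟩
    · rw [List.map_cons, hmap, beliefs_cons_self, place_last]
  · have hperm' : (u :: (A ++ B)).Perm ((A ++ B) ++ [u]) := (List.perm_append_singleton _ _).symm
    refine ⟨(A ++ B) ++ [u], ⟨hperm'.nodup_iff.mp hnd, fun n => hperm'.mem_iff.mp (hmem n), ?_⟩, ?_⟩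
    · rw [List.map_append, hmap, List.pairwise_append]
      refine ⟨hsort, List.pairwise_singleton _ _, fun x hx z hz => ?_⟩
      obtain ⟨w, -, rfl⟩ := List.mem_map.mp hx
      rw [List.map_singleton, List.mem_singleton, beliefs_cons_self] at hz
      subst hz
      exact row_le_step hy w
    · rw [List.map_append, hmap, List.map_singleton, beliefs_cons_self, place_of_ne hy]

theorem IsRanking.le_of_append {b : Fin N → m.Bel} {A B : List (Fin N)} {u : Fin N}
    (hℓ : IsRanking b (A ++ u :: B)) : ∀ z ∈ A.map b, (b u).Le z := by
  intro z hz
  have hs := hℓ.sorted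
  rw [List.map_append, List.pairwise_append] at hs
  exact hs.2.2 z hz (b u) (List.mem_map_of_mem List.mem_cons_self)

/-- The round-robin reward bounds the reward of every policy. -/
theorem value_le_W (π₀ : Fin N → m.Bel) (g : Policy N k) (T : ℕ) :
    ∀ (h : List (Fin N × Fin (k + 2))) (ℓ : List (Fin N)), IsRanking (m.beliefs π₀ h) ℓ →
      value π₀ g T h ≤ W T (ℓ.map (m.beliefs π₀ h)) := by
  induction T with
  | zero =>
    intro h ℓ _
    simp [value]
  | succ T ih =>
    intro h ℓ hℓ
    obtain ⟨A, B, rfl⟩ := List.append_of_mem (hℓ.mem (g h))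
    -- By induction the value is at most that of sensing `g h` first and continuing round robin.
    -- This is `W` of the list with that channel pulled to the front, and putting it back behind the
    -- channels dominating it does not decrease `W`.
    have h1 := (m.exchange (T + 1)).move_down (B.map (m.beliefs π₀ h)) (A.map (m.beliefs π₀ h))
      [] (x := m.beliefs π₀ h (g h)) hℓ.le_of_append
    rw [List.nil_append, List.nil_append, ← List.map_append] at h1
    rw [List.map_append, List.map_cons, value]
    refine le_trans ?_ h1
    rw [W_succ]
    refine add_le_add le_rfl (mul_le_mul_of_nonneg_left (Bel.sum_mul_le _ fun i => ?_) m.β_pos.le)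
    obtain ⟨ℓ', h2, h3⟩ := hℓ.cons i
    rw [← h3]
    exact ih _ _ h2

/-- A policy that always senses a channel with the largest expected reward collects the
round-robin reward. -/
theorem value_eq_W (π₀ : Fin N → m.Bel) (g : Policy N k) (T : ℕ) :
    ∀ (h : List (Fin N × Fin (k + 2))) (ℓ : List (Fin N)), IsRanking (m.beliefs π₀ h) ℓ →
      weight π₀ g h ≠ 0 →
      (∀ h', h.length ≤ h'.length → h'.length < h.length + T → weight π₀ g h' ≠ 0 →
        ∀ n, (m.beliefs π₀ h' n).1 ⬝ᵥ m.R ≤ (m.beliefs π₀ h' (g h')).1 ⬝ᵥ m.R) →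
      value π₀ g T h = W T (ℓ.map (m.beliefs π₀ h)) := by
  induction T with
  | zero =>
    intro h ℓ _ _ _
    simp [value]
  | succ T ih =>
    intro h ℓ hℓ hw hg
    obtain ⟨A, B, rfl⟩ := List.append_of_mem (hℓ.mem (g h))
    -- The channels ranked above the chosen one dominate it but have no larger expected reward, so
    -- they tie with it and can be passed at no cost.
    have h1 := W_append_cons_eq (T + 1) (B.map (m.beliefs π₀ h)) (m.beliefs π₀ h (g h))
      (A.map (m.beliefs π₀ h)) [] (fun z hz => ⟨hℓ.le_of_append z hz,
        (hℓ.le_of_append z hz).R_le.antisymm (by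
          obtain ⟨n, -, rfl⟩ := List.mem_map.mp hz
          exact hg h le_rfl (by omega) hw n)⟩)
    rw [List.nil_append, List.nil_append, ← List.map_append] at h1
    rw [List.map_append, List.map_cons, value, ← h1, W_succ]
    congr 2
    refine Finset.sum_congr rfl fun i _ => ?_
    -- Observations of probability zero lead to histories where nothing is known about the policy;
    -- they do not contribute.
    by_cases hi : (m.beliefs π₀ h (g h)).1 i = 0
    · rw [hi, zero_mul, zero_mul]
    · obtain ⟨ℓ', h2, h3⟩ := hℓ.cons i
      rw [← h3, ih _ _ h2]
      · rw [weight, if_pos rfl]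
        exact mul_ne_zero hw hi
      · intro h' hl hl'
        rw [List.length_cons] at hl hl'
        exact hg h' (by omega) (by omega)

/-- Along the histories of positive probability and length in `[a, b]`, the policy `g` senses a
channel with the largest expected reward. -/
def IsGreedy (π₀ : Fin N → m.Bel) (g : Policy N k) (a b : ℕ) : Prop :=
  ∀ h, a ≤ h.length → h.length ≤ b → weight π₀ g h ≠ 0 →
    ∀ n, (m.beliefs π₀ h n).1 ⬝ᵥ m.R ≤ (m.beliefs π₀ h (g h)).1 ⬝ᵥ m.R

theorem value_le_of_isGreedy {π₀ : Fin N → m.Bel}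
    (hπ : ∀ n n', (π₀ n).Le (π₀ n') ∨ (π₀ n').Le (π₀ n)) {g : Policy N k} {T : ℕ}
    (hg : IsGreedy π₀ g 0 T) (g' : Policy N k) : value π₀ g' (T + 1) [] ≤ value π₀ g (T + 1) [] := by
  obtain ⟨ℓ, hℓ⟩ := exists_isRanking (m.beliefs π₀ []) (beliefs_comparable hπ [])
  rw [value_eq_W π₀ g (T + 1) [] ℓ hℓ one_ne_zero fun h' h1 h2 =>
    hg h' h1 (by rw [List.length_nil] at h2; omega)]
  exact value_le_W π₀ g' (T + 1) [] ℓ hℓ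

/-- Both policies make the same first choice, hence have the same first observations; the comparison
is made after each of them, from beliefs that are again totally ordered. -/
theorem value_le_of_isGreedy_succ {π₀ : Fin N → m.Bel}
    (hπ : ∀ n n', (π₀ n).Le (π₀ n') ∨ (π₀ n').Le (π₀ n)) {g : Policy N k} {T : ℕ}
    (hg : IsGreedy π₀ g 1 T) {g' : Policy N k} (h0 : g' [] = g []) :
    value π₀ g' (T + 1) [] ≤ value π₀ g (T + 1) [] := by
  rw [value, value, h0]
  refine add_le_add le_rfl (mul_le_mul_of_nonneg_left (Finset.sum_le_sum fun i _ => ?_) m.β_pos.le)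
  by_cases hi : (m.beliefs π₀ [] (g [])).1 i = 0
  · rw [hi, zero_mul, zero_mul]
  · obtain ⟨ℓ, hℓ⟩ := exists_isRanking _ (beliefs_comparable hπ [(g [], i)])
    have hw : weight π₀ g [(g [], i)] ≠ 0 := by
      rw [weight, if_pos rfl, weight, one_mul]
      exact hi
    rw [value_eq_W π₀ g T _ ℓ hℓ hw fun h' h1 h2 =>
      hg h' h1 (by rw [List.length_singleton] at h2; omega)]
    exact mul_le_mul_of_nonneg_left (value_le_W π₀ g' T _ ℓ hℓ) (Bel.nonneg _ _)

/-- After the first observation, a stochastically largest channel has an index that exceeds the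
others at least in proportion to the expected rewards. -/
theorem gittinsIndex_beliefs_le (π₀ : Fin N → m.Bel) {h : List (Fin N × Fin (k + 2))} (hh : h ≠ [])
    {n : Fin N} (hn : ∀ n', (m.beliefs π₀ h n').Le (m.beliefs π₀ h n)) (n' : Fin N) :
    gittinsIndex m.β m.P m.R (m.beliefs π₀ h n').1
      ≤ gittinsIndex m.β m.P m.R (m.beliefs π₀ h n).1
        - (1 - m.β) * ((m.beliefs π₀ h n).1 ⬝ᵥ m.R - (m.beliefs π₀ h n').1 ⬝ᵥ m.R) := by
  by_cases hne : n' = n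
  · subst hne
    simp
  · refine gittinsIndex_le (hn n') ?_
    cases h with
    | nil => exact absurd rfl hh
    | cons a h =>
      obtain ⟨u, y⟩ := a
      by_cases hu : n = u
      -- If the largest channel was just sensed, another channel `n'` was not; its stepped belief is
      -- above `P_{K-1}` and is dominated by the largest one.
      · have h1 := hn n'
        rw [beliefs_cons_of_ne _ _ _ (hu ▸ hne)] at h1
        exact (Bel.second_le_step _).trans h1
      · rw [beliefs_cons_of_ne _ _ _ hu]
        exact Bel.second_le_step _

theorem hasMaxIndex_of_largest (π₀ : Fin N → m.Bel) {h : List (Fin N × Fin (k + 2))} (hh : h ≠ [])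
    {n : Fin N} (hn : ∀ n', (m.beliefs π₀ h n').Le (m.beliefs π₀ h n)) :
    HasMaxIndex m.β m.P m.R (fun n => (m.beliefs π₀ h n).1) n := by
  intro n'
  have h1 := gittinsIndex_beliefs_le π₀ hh hn n'
  have h2 := mul_nonneg (sub_nonneg.mpr m.β_lt.le) (sub_nonneg.mpr (hn n').R_le)
  linarith

theorem reward_eq_of_hasMaxIndex (π₀ : Fin N → m.Bel) {h : List (Fin N × Fin (k + 2))}
    (hh : h ≠ []) {n : Fin N} (hn : ∀ n', (m.beliefs π₀ h n').Le (m.beliefs π₀ h n)) {n' : Fin N}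
    (hn' : HasMaxIndex m.β m.P m.R (fun n => (m.beliefs π₀ h n).1) n') :
    (m.beliefs π₀ h n').1 ⬝ᵥ m.R = (m.beliefs π₀ h n).1 ⬝ᵥ m.R := by
  have h1 := gittinsIndex_beliefs_le π₀ hh hn n'
  have h2 : gittinsIndex m.β m.P m.R (m.beliefs π₀ h n).1
    ≤ gittinsIndex m.β m.P m.R (m.beliefs π₀ h n').1 := hn' n
  refine (hn n').R_le.antisymm (sub_nonpos.mp ?_)
  by_contra hc
  have := mul_pos (sub_pos.mpr m.β_lt) (not_le.mp hc)
  linarith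

theorem exists_largest {π₀ : Fin N → m.Bel} (hN : 0 < N)
    (hπ : ∀ n n', (π₀ n).Le (π₀ n') ∨ (π₀ n').Le (π₀ n)) (h : List (Fin N × Fin (k + 2))) :
    ∃ n, ∀ n', (m.beliefs π₀ h n').Le (m.beliefs π₀ h n) := by
  obtain ⟨ℓ, hℓ⟩ := exists_isRanking _ (beliefs_comparable hπ h)
  exact hℓ.exists_largest hN

section Law

variable {Ω : Type*} [MeasurableSpace Ω] {μ : Measure Ω} [IsProbabilityMeasure μ]
  {X : Fin N → ℕ → Ω → Fin (k + 2)} {π₀ : Fin N → m.Bel}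

/-- A history of positive weight is an event of positive probability, so an almost sure property
holds there. -/
theorem hasMaxIndex_of_followsGittins (hX : ∀ n, IsMarkovChain μ (π₀ n).1 m.P (X n))
    (hind : iIndepFun (fun n ω t => X n t ω) μ) {g : Policy N k} {h : List (Fin N × Fin (k + 2))}
    (hg : FollowsGittins μ m.β m.P m.R X g h.length) (hw : weight π₀ g h ≠ 0) :
    HasMaxIndex m.β m.P m.R (fun n => (m.beliefs π₀ h n).1) (g h) := by
  by_contra hc
  have h1 : ∀ᵐ ω ∂μ, ¬ history X g h.length ω = h := by
    filter_upwards [hg] with ω hω he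
    rw [belief_eq hX hind g _ ω (by rwa [he]), choice, he] at hω
    exact hc hω
  have h2 : μ {ω | history X g h.length ω = h} = 0 := by
    rw [ae_iff] at h1
    simpa using h1
  exact hw (by rw [← real_history hX hind g h, measureReal_def, h2, ENNReal.toReal_zero])

theorem isGreedy_of_followsGittins (hN : 0 < N)
    (hπ : ∀ n n', (π₀ n).Le (π₀ n') ∨ (π₀ n').Le (π₀ n))
    (hX : ∀ n, IsMarkovChain μ (π₀ n).1 m.P (X n))
    (hind : iIndepFun (fun n ω t => X n t ω) μ) {g : Policy N k} {T : ℕ}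
    (hg : ∀ t, 1 ≤ t → t ≤ T → FollowsGittins μ m.β m.P m.R X g t) : IsGreedy π₀ g 1 T := by
  intro h h1 hT hw n
  obtain ⟨n', hn'⟩ := exists_largest hN hπ h
  rw [reward_eq_of_hasMaxIndex π₀ (List.ne_nil_of_length_pos h1) hn'
    (hasMaxIndex_of_followsGittins hX hind (hg _ h1 hT) hw)]
  exact (hn' n).R_le

end Law

theorem IsGreedy.zero {π₀ : Fin N → m.Bel} {g : Policy N k} {T : ℕ} (hg : IsGreedy π₀ g 1 T)
    (h0 : ∀ n, (π₀ n).Le (π₀ (g []))) : IsGreedy π₀ g 0 T := by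
  intro h _ hT hw n
  cases h with
  | nil => exact (h0 n).R_le
  | cons a h => exact hg _ (by simp) hT hw n

end SensingModel
end ChannelSensing
end

/-! ### The main theorem. -/

theorem theorem4 {k N : ℕ} (hN : 0 < N)
    (P : Matrix (Fin (k + 2)) (Fin (k + 2)) ℝ) (R : Fin (k + 2) → ℝ) (β : ℝ)
    (π₀ : Fin N → Fin (k + 2) → ℝ)
    (hP : ∀ i, P i ∈ stdSimplex ℝ (Fin (k + 2))) (hβ0 : 0 < β) (hβ1 : β < 1)
    -- assumptions (A1)-(A4) for the largest value `L = K`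
    (h1 : A1 P) (h2 : A2 P π₀) (h3 : A3 (Fin.last k) P) (h4 : A4 (Fin.last k) β P R)
    -- the channels are independent Markov chains with transition matrix `P`
    {Ω : Type*} [MeasurableSpace Ω] (μ : Measure Ω) (X : Fin N → ℕ → Ω → Fin (k + 2))
    (hX : ∀ n, IsMarkovChain μ (π₀ n) P (X n))
    (hind : iIndepFun (fun n ω t => X n t ω) μ) :
    -- after time 0, under any policy: there is a myopic choice, every myopic choice has the largest
    -- Gittins index, and a channel with the largest index differs from it at most by a tie
    (∀ (g : Policy N k) (t : ℕ), 1 ≤ t → ∀ᵐ ω ∂μ,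
      (∃ m, IsStLargest (belief μ X g t ω) m) ∧
      ∀ m, IsStLargest (belief μ X g t ω) m →
        HasMaxIndex β P R (belief μ X g t ω) m ∧
        ∀ n, HasMaxIndex β P R (belief μ X g t ω) n →
          belief μ X g t ω n ⬝ᵥ R = belief μ X g t ω m ⬝ᵥ R) ∧
    -- the myopic policy exists and follows the Gittins index rule after time 0
    (∃ g : Policy N k, (∀ t, FollowsMyopic μ X g t) ∧
      ∀ t, 1 ≤ t → FollowsGittins μ β P R X g t) ∧
    -- the Gittins index rule after time 0 is optimal for the finite-horizon problem (P1):
    -- among all policies with the same initial choice, and among all policies if that is myopic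
    (∀ (g : Policy N k) (T : ℕ),
      (∀ t, 1 ≤ t → t ≤ T → FollowsGittins μ β P R X g t) →
      (∀ g' : Policy N k, g' [] = g [] →
        finiteReward μ β R X T g' ≤ finiteReward μ β R X T g) ∧
      (IsStLargest π₀ (g []) → ∀ g' : Policy N k,
        finiteReward μ β R X T g' ≤ finiteReward μ β R X T g)) ∧
    -- the same for the infinite-horizon problem (P2)
    (∀ g : Policy N k,
      (∀ t, 1 ≤ t → FollowsGittins μ β P R X g t) →
      (∀ g' : Policy N k, g' [] = g [] →
        infiniteReward μ β R X g' ≤ infiniteReward μ β R X g) ∧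
      (IsStLargest π₀ (g []) → ∀ g' : Policy N k,
        infiniteReward μ β R X g' ≤ infiniteReward μ β R X g)) := by
  obtain ⟨m, rfl, rfl, rfl⟩ := exists_sensingModel P R β hP hβ0 hβ1 h1 h3 h4
  have hbel : ∀ n, ∃ b : m.Bel, b.1 = π₀ n := fun n => by
    obtain ⟨x, hx, he⟩ := h2.1 n
    exact ⟨⟨x ᵥ* m.P, SensingModel.vecMul_mem x hx⟩, he.symm⟩
  choose b hb using hbel
  obtain rfl : (fun n => (b n).1) = π₀ := funext hb
  have hπ : ∀ n n', (b n).Le (b n') ∨ (b n').Le (b n) := fun n n' =>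
    (le_total n n').imp (h2.2 n n') (h2.2 n' n)
  have := (hX ⟨0, hN⟩).isProbabilityMeasure
  have hmeas : ∀ n t, Measurable (X n t) := fun n t => (hX n).measurable t
  have hne : ∀ (g : Policy N k) {t : ℕ}, 1 ≤ t → ∀ ω, history X g t ω ≠ [] := fun g t ht ω =>
    List.ne_nil_of_length_pos (by rw [length_history]; exact ht)
  have hfin : ∀ (g : Policy N k) (T : ℕ),
      (∀ t, 1 ≤ t → t ≤ T → FollowsGittins μ m.β m.P m.R X g t) →
      (∀ g' : Policy N k, g' [] = g [] →
        finiteReward μ m.β m.R X T g' ≤ finiteReward μ m.β m.R X T g) ∧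
      (IsStLargest (fun n => (b n).1) (g []) → ∀ g' : Policy N k,
        finiteReward μ m.β m.R X T g' ≤ finiteReward μ m.β m.R X T g) := by
    intro g T hg
    have hgr := SensingModel.isGreedy_of_followsGittins hN hπ hX hind hg
    refine ⟨fun g' h0 => ?_, fun h0 g' => ?_⟩
    · rw [SensingModel.finiteReward_eq hX hind, SensingModel.finiteReward_eq hX hind]
      exact SensingModel.value_le_of_isGreedy_succ hπ hgr h0
    · rw [SensingModel.finiteReward_eq hX hind, SensingModel.finiteReward_eq hX hind]
      exact SensingModel.value_le_of_isGreedy hπ (hgr.zero h0) g'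
  refine ⟨fun g t ht => ?_, ?_, hfin, fun g hg => ⟨fun g' h0 => ?_, fun h0 g' => ?_⟩⟩
  · filter_upwards [SensingModel.ae_weight_pos hX hind g t] with ω hω
    rw [SensingModel.belief_eq hX hind g t ω hω]
    refine ⟨SensingModel.exists_largest hN hπ _, fun n hn => ⟨?_, fun n' hn' => ?_⟩⟩
    · exact SensingModel.hasMaxIndex_of_largest b (hne g ht ω) hn
    · exact SensingModel.reward_eq_of_hasMaxIndex b (hne g ht ω) hn hn'
  -- A largest channel is picked after every history, including those of probability zero.
  · choose g hg using SensingModel.exists_largest hN hπ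
    refine ⟨g, fun t => ?_, fun t ht => ?_⟩
    · filter_upwards [SensingModel.ae_weight_pos hX hind g t] with ω hω
      rw [SensingModel.belief_eq hX hind g t ω hω]
      exact hg _
    · filter_upwards [SensingModel.ae_weight_pos hX hind g t] with ω hω
      rw [SensingModel.belief_eq hX hind g t ω hω]
      exact SensingModel.hasMaxIndex_of_largest b (hne g ht ω) (hg _)
  -- The policy is optimal at every finite horizon, so the inequality passes to the limit.
  · exact le_of_tendsto_of_tendsto' (SensingModel.tendsto_finiteReward hmeas g')
      (SensingModel.tendsto_finiteReward hmeas g) fun T =>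
        (hfin g T fun t ht _ => hg t ht).1 g' h0
  · exact le_of_tendsto_of_tendsto' (SensingModel.tendsto_finiteReward hmeas g')
      (SensingModel.tendsto_finiteReward hmeas g) fun T =>
        (hfin g T fun t ht _ => hg t ht).2 h0 g'
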